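/- Let $\ell\ge 3$ be an integer. Write $\mathbb T$ and $\mathbb S$ for the trace-free and the symmetric real $3\times 3$ matrices, $\operatorname{sym}A=\frac12(A+A^{\intercal})$, $\operatorname{curl}$ for the row-wise curl of a matrix field, $A\times b$ for the row-wise and $b\times A$ for the column-wise cross product of a matrix with a vector, $b\cdot A=b^{\intercal}A$, and $(\cdot,\cdot)_D$ for the $L^2$ inner product on $D$. Let $\mathbb P_k(D;X)$ be the space of (restrictions to $D$ of) polynomials of degree at most $k$ with values in $X$, and $\mathbb P_k(D)=\mathbb P_k(D;\mathbb R)$. Let $K\subset\mathbb R^3$ be a nondegenerate tetrahedron with vertices $\mathcal V(K)$, edges $\mathcal E(K)$ and faces $\mathcal F(K)$. For each edge $e$ fix a unit tangent vector $t$ and orthonormal vectors $n_1,n_2$ orthogonal to $e$ with $n_2=t\times n_1$. For each face $F$ fix a unit normal vector $n$ and an origin in the plane of $F$; let $x$ be the position vector in that plane relative to this origin, $x^{\perp}=x\times n$, $\nabla_F^{\perp}=n\times\nabla$, $\nabla_F=(n\times\nabla)\times n$, and let $\mathbb P_k(F;\mathbb R^2)$ be the polynomial vector fields of degree at most $k$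 on $F$ that are tangential to $F$. Set $$\mathbb B_{\ell+1}(K)=\{\tau\in\mathbb P_{\ell+1}(K;\mathbb T): n\cdot\tau\times n=0\ \text{and}\ n\times\operatorname{sym}(\tau\times n)\times n=0\ \text{on every}\ F\in\mathcal F(K)\}.$$ Consider the following degrees of freedom of $\tau\in\mathbb P_{\ell+1}(K;\mathbb T)$: 1. $\tau(\delta)\in\mathbb T$, for $\delta\in\mathcal V(K)$; 2. $(\operatorname{sym}\operatorname{curl}\tau)(\delta)\in\mathbb S$, for $\delta\in\mathcal V(K)$; 3. $(n_i^{\intercal}(\operatorname{sym}\operatorname{curl}\tau)n_j,q)_e$, for $q\in\mathbb P_{\ell-2}(e)$, $e\in\mathcal E(K)$, $i,j\in\{1,2\}$ (symmetric in $i,j$); 4. $(n_i^{\intercal}\tau t,q)_e$, for $q\in\mathbb P_{\ell-1}(e)$, $e\in\mathcal E(K)$, $i\in\{1,2\}$; 5. $(n_2^{\intercal}(\operatorname{curl}\tau)n_1+\partial_t(t^{\intercal}\tau t),q)_e$, for $q\in\mathbb P_{\ell}(e)$, $e\in\mathcal E(K)$; 6. $(n\times\operatorname{sym}(\tau\times n)\times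 n,\varsigma)_F$, for $\varsigma\in(\nabla_F^{\perp})^2\mathbb P_{\ell-1}(F)\oplus\operatorname{sym}(x\otimes\mathbb P_{\ell-1}(F;\mathbb R^2))$, $F\in\mathcal F(K)$; 7. $(n\cdot\tau\times n,v)_F$, for $v\in\nabla_F\mathbb P_{\ell-3}(F)\oplus x^{\perp}\mathbb P_{\ell-1}(F)$, $F\in\mathcal F(K)$; 8. $(\tau,q)_K$, for $q\in\mathbb B_{\ell+1}(K)$. (a) These degrees of freedom are unisolvent for $\mathbb P_{\ell+1}(K;\mathbb T)$: for all prescribed values (a trace-free matrix at each vertex in 1, a symmetric matrix at each vertex in 2, and a linear functional on the test space for each family of moments in 3–8, the functionals in 3 being symmetric in $i,j$) there is exactly one $\tau\in\mathbb P_{\ell+1}(K;\mathbb T)$ that attains them. (b) The element is $H(\operatorname{sym}\operatorname{curl})$-conforming: let $\mathcal T_h$ be a finite conforming triangulation into tetrahedra of an open set $\Omega\subset\mathbb R^3$ (that is, $\overline\Omega$ is the union of the tetrahedra), with vectors and origins fixed once for each edge and face of $\mathcal T_h$. If $u|_K\in\mathbb P_{\ell+1}(K;\mathbb T)$ for each $K\in\mathcal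 T_h$ and the degrees of freedom 1–7 of $u$ are single-valued (they have the same value from all tetrahedra sharing the vertex, edge or face), then $u\in H(\operatorname{sym}\operatorname{curl},\Omega;\mathbb T)$, i.e. $u\in L^2(\Omega;\mathbb T)$ and its weak $\operatorname{sym}\operatorname{curl}$ belongs to $L^2(\Omega;\mathbb S)$. -/

import Mathlib

open MeasureTheory Matrix
open scoped ContDiff

namespace SymCurlFEM

noncomputable section

/-! ### Vectors, tensors, polynomials -/

/-- Points of three-dimensional Euclidean space. -/
abbrev E3 := EuclideanSpace ℝ (Fin 3)

/-- Vectors of `ℝ³`. -/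
abbrev V3 := Fin 3 → ℝ

/-- Tensors: real `3 × 3` matrices. -/
abbrev M3 := Matrix (Fin 3) (Fin 3) ℝ

/-- Scalar polynomials in three variables. -/
abbrev Pol := MvPolynomial (Fin 3) ℝ

/-- Tensor-valued polynomials in three variables. -/
abbrev PolM := Matrix (Fin 3) (Fin 3) Pol

/-- The value of a tensor-valued polynomial at a point. -/
def val (A : PolM) (x : E3) : M3 := A.map (MvPolynomial.eval x.ofLp)

/-- The symmetric part `(A + Aᵀ) / 2`. -/
def sym {R : Type*} [AddCommGroup R] [Module ℝ R] (A : Matrix (Fin 3) (Fin 3) R) :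
    Matrix (Fin 3) (Fin 3) R :=
  (1 / 2 : ℝ) • (A + Aᵀ)

/-- The Frobenius product `A : B`. -/
def frob (A B : M3) : ℝ := ∑ i, ∑ j, A i j * B i j

/-- `A × b`, the row-wise cross product from the right. -/
def crossRight (A : M3) (b : V3) : M3 := Matrix.of fun i => A i ⨯₃ b

/-- `b × A`, the column-wise cross product from the left. -/
def crossLeft (b : V3) (A : M3) : M3 := Matrix.of fun i j => (b ⨯₃ fun k => A k j) i

/-- The row-wise curl of a tensor field; `D k` is the `k`-th partial derivative. -/
def curl {R : Type*} [AddCommGroup R] (D : Fin 3 → R → R) (A : Matrix (Fin 3) (Fin 3) R) :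
    Matrix (Fin 3) (Fin 3) R :=
  Matrix.of fun i => ![D 1 (A i 2) - D 2 (A i 1), D 2 (A i 0) - D 0 (A i 2),
    D 0 (A i 1) - D 1 (A i 0)]

/-- Curl of a polynomial tensor field. -/
def polCurl (A : PolM) : PolM := curl (fun k p => MvPolynomial.pderiv k p) A

/-- `sym curl` of a polynomial tensor field. -/
def symCurl (A : PolM) : PolM := sym (polCurl A)

/-- The derivative `∂_t A` of a polynomial tensor field along a constant vector `t`. -/
def dirDeriv (t : V3) (A : PolM) : PolM :=
  Matrix.of fun i j => ∑ k, t k • MvPolynomial.pderiv k (A i j)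

/-- `tr₂ = n · A × n`. -/
def tr₂ (n : V3) (A : M3) : V3 := (n ᵥ* A) ⨯₃ n

/-- `tr₁^⊥ = n × sym (A × n) × n`. -/
def tr₁perp (n : V3) (A : M3) : M3 := crossRight (crossLeft n (sym (crossRight A n))) n

/-- `ℙ_k(K; 𝕋)`: trace-free tensor-valued polynomials of degree at most `k`. -/
def polyT (k : ℕ) : Submodule ℝ PolM where
  carrier := {A | A.trace = 0 ∧ ∀ i j, A i j ∈ MvPolynomial.restrictTotalDegree (Fin 3) ℝ k}
  add_mem' {A B} hA hB :=
    ⟨by rw [trace_add, hA.1, hB.1, add_zero], fun i j => add_mem (hA.2 i j) (hB.2 i j)⟩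
  zero_mem' := ⟨by simp, fun i j => zero_mem _⟩
  smul_mem' c A hA :=
    ⟨by rw [trace_smul, hA.1, smul_zero], fun i j => Submodule.smul_mem _ c (hA.2 i j)⟩

/-! ### Simplices

A vertex set is a `Finset` of points: two points span an edge, three a triangle and four a
tetrahedron. -/

/-- The closed simplex with vertex set `s`. -/
abbrev hull (s : Finset E3) : Set E3 := convexHull ℝ (s : Set E3)

/-- `K` is the vertex set of a (nondegenerate) tetrahedron. -/
def IsTetrahedron (K : Finset E3) : Prop :=
  K.card = 4 ∧ AffineIndependent ℝ ((↑) : K → E3)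

/-- The edges of the simplex with vertex set `s`. -/
def edges (s : Finset E3) : Finset (Finset E3) := s.powersetCard 2

/-- The triangular faces of the simplex with vertex set `s`. -/
def faces (s : Finset E3) : Finset (Finset E3) := s.powersetCard 3

/-- Length measure on an edge, as a measure on the points of the edge. -/
def lengthOn (e : Finset E3) : Measure (hull e) :=
  (μHE[1] : Measure E3).comap (Subtype.val : hull e → E3)

/-- Area measure on a face, as a measure on the points of the face. -/
def areaOn (F : Finset E3) : Measure (hull F) :=
  (μHE[2] : Measure E3).comap (Subtype.val : hull F → E3)

/-- Unit vectors and origins attached to edges and faces: a tangent vector `t e` and normal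
vectors `n₁ e`, `n₂ e` for each edge `e`, a normal vector `n F` and an origin `o F` for the
coordinates in the plane of `F` for each face `F`. -/
structure Frame where
  t : Finset E3 → V3
  n₁ : Finset E3 → V3
  n₂ : Finset E3 → V3
  n : Finset E3 → V3
  o : Finset E3 → E3

/-- The vectors chosen for the edge `e` are a unit tangent vector `t` and an orthonormal pair of
normal vectors with `n₂ = t × n₁`. -/
def Frame.GoodEdge (fr : Frame) (e : Finset E3) : Prop :=
  fr.t e ⬝ᵥ fr.t e = 1 ∧ (∀ a ∈ e, ∀ b ∈ e, ∃ c : ℝ, (b - a).ofLp = c • fr.t e) ∧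
  fr.n₁ e ⬝ᵥ fr.n₁ e = 1 ∧ fr.n₁ e ⬝ᵥ fr.t e = 0 ∧ fr.n₂ e = fr.t e ⨯₃ fr.n₁ e

/-- The vector chosen for the face `F` is a unit normal vector, and the origin is in its plane. -/
def Frame.GoodFace (fr : Frame) (F : Finset E3) : Prop :=
  fr.n F ⬝ᵥ fr.n F = 1 ∧ (∀ a ∈ F, ∀ b ∈ F, fr.n F ⬝ᵥ (b - a).ofLp = 0) ∧
  fr.o F ∈ affineSpan ℝ (F : Set E3)

/-- The frame is a correct choice for all edges and faces of the simplex `K`. -/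
def Frame.Good (fr : Frame) (K : Finset E3) : Prop :=
  (∀ e ∈ edges K, fr.GoodEdge e) ∧ (∀ F ∈ faces K, fr.GoodFace F)

/-- The two normal vectors of an edge as a family. -/
def Frame.nE (fr : Frame) (e : Finset E3) : Fin 2 → V3 := ![fr.n₁ e, fr.n₂ e]

/-! ### Test spaces -/

/-- `ℙ_k(s)`: restrictions to the simplex `s` of polynomials of degree at most `k`. -/
def polyOn (k : ℕ) (s : Finset E3) : Submodule ℝ (hull s → ℝ) :=
  Submodule.span ℝ {q | ∃ p ∈ MvPolynomial.restrictTotalDegree (Fin 3) ℝ k,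
    q = fun x : hull s => MvPolynomial.eval x.1.ofLp p}

/-- `ℙ_k(F; ℝ²)`: vector fields on the face `F`, tangential to `F`, whose components are
polynomials of degree at most `k`. -/
def IsTangPoly (fr : Frame) (k : ℕ) (F : Finset E3) (v : hull F → V3) : Prop :=
  (∀ i, (fun x => v x i) ∈ polyOn k F) ∧ ∀ x, fr.n F ⬝ᵥ v x = 0

/-- `∇_F^⊥ p = n × ∇ p`. -/
def surfCurl (n : V3) (p : Pol) : Fin 3 → Pol :=
  (fun i => MvPolynomial.C (n i)) ⨯₃ (fun i => MvPolynomial.pderiv i p)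

/-- `∇_F p = (n × ∇ p) × n`. -/
def surfGrad (n : V3) (p : Pol) : Fin 3 → Pol :=
  surfCurl n p ⨯₃ (fun i => MvPolynomial.C (n i))

/-- `(∇_F^⊥)² p = (n × ∇)(n × ∇)ᵀ p`. -/
def surfCurl₂ (n : V3) (p : Pol) : PolM := Matrix.of fun i j => surfCurl n (surfCurl n p j) i

/-- `(∇_F^⊥)² ℙ_{ℓ-1}(F) ⊕ sym (x ⊗ ℙ_{ℓ-1}(F; ℝ²))`, with `x` the position relative to the origin
chosen in the plane of `F`. -/
def faceTensorTest (fr : Frame) (ℓ : ℕ) (F : Finset E3) : Submodule ℝ (hull F → M3) :=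
  Submodule.span ℝ {ς | ∃ p ∈ MvPolynomial.restrictTotalDegree (Fin 3) ℝ (ℓ - 1),
      ς = fun x => val (surfCurl₂ (fr.n F) p) x.1} ⊔
  Submodule.span ℝ {ς | ∃ v, IsTangPoly fr (ℓ - 1) F v ∧
      ς = fun x => sym (vecMulVec (x.1 - fr.o F).ofLp (v x))}

/-- `∇_F ℙ_{ℓ-3}(F) ⊕ x^⊥ ℙ_{ℓ-1}(F)`, with `x^⊥ = x × n` the rotated position relative to the
origin chosen in the plane of `F`. -/
def faceVectorTest (fr : Frame) (ℓ : ℕ) (F : Finset E3) : Submodule ℝ (hull F → V3) :=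
  Submodule.span ℝ {v | ∃ p ∈ MvPolynomial.restrictTotalDegree (Fin 3) ℝ (ℓ - 3),
      v = fun x i => MvPolynomial.eval x.1.ofLp (surfGrad (fr.n F) p i)} ⊔
  Submodule.span ℝ {v | ∃ q ∈ polyOn (ℓ - 1) F,
      v = fun x => q x • ((x.1 - fr.o F).ofLp ⨯₃ fr.n F)}

theorem val_add (A B : PolM) (x : E3) : val (A + B) x = val A x + val B x := by
  ext i j; simp [val]

theorem val_smul (c : ℝ) (A : PolM) (x : E3) : val (c • A) x = c • val A x := by
  ext i j; simp [val]

theorem val_zero (x : E3) : val 0 x = 0 := by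
  ext i j; simp [val]

theorem tr₂_add (n : V3) (A B : M3) : tr₂ n (A + B) = tr₂ n A + tr₂ n B := by
  simp [tr₂, vecMul_add]

theorem tr₂_smul (n : V3) (c : ℝ) (A : M3) : tr₂ n (c • A) = c • tr₂ n A := by
  simp [tr₂, vecMul_smul]

theorem tr₁perp_add (n : V3) (A B : M3) : tr₁perp n (A + B) = tr₁perp n A + tr₁perp n B := by
  ext i j
  fin_cases i <;> fin_cases j <;>
    simp [tr₁perp, crossRight, crossLeft, sym, cross_apply] <;> ring

theorem tr₁perp_smul (n : V3) (c : ℝ) (A : M3) : tr₁perp n (c • A) = c • tr₁perp n A := by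
  ext i j
  fin_cases i <;> fin_cases j <;>
    simp [tr₁perp, crossRight, crossLeft, sym, cross_apply] <;> ring

/-- The bubble space `𝔹_{k}(sym curl, K; 𝕋)`: the trace-free polynomial tensors of degree at most
`k` whose two traces vanish on every face of `K`. -/
def bubble (fr : Frame) (k : ℕ) (K : Finset E3) : Submodule ℝ PolM where
  carrier := {A | A ∈ polyT k ∧ ∀ F ∈ faces K, ∀ x ∈ hull F,
    tr₂ (fr.n F) (val A x) = 0 ∧ tr₁perp (fr.n F) (val A x) = 0}
  add_mem' {A B} hA hB := by
    refine ⟨add_mem hA.1 hB.1, fun F hF x hx => ?_⟩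
    rw [val_add, tr₂_add, tr₁perp_add, (hA.2 F hF x hx).1, (hB.2 F hF x hx).1,
      (hA.2 F hF x hx).2, (hB.2 F hF x hx).2]
    simp
  zero_mem' := by
    refine ⟨zero_mem _, fun F hF x hx => ?_⟩
    have h1 := tr₂_smul (fr.n F) 0 0
    have h2 := tr₁perp_smul (fr.n F) 0 0
    simp only [zero_smul] at h1 h2
    exact ⟨by rw [val_zero, h1], by rw [val_zero, h2]⟩
  smul_mem' c A hA := by
    refine ⟨Submodule.smul_mem _ c hA.1, fun F hF x hx => ?_⟩
    rw [val_smul, tr₂_smul, tr₁perp_smul, (hA.2 F hF x hx).1, (hA.2 F hF x hx).2]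
    simp

/-! ### Degrees of freedom -/

/-- `(n_iᵀ (sym curl τ) n_j, q)_e`. -/
def edgeDofNN (fr : Frame) (τ : PolM) (e : Finset E3) (i j : Fin 2) (q : hull e → ℝ) : ℝ :=
  ∫ x, (fr.nE e i ⬝ᵥ (val (symCurl τ) x.1 *ᵥ fr.nE e j)) * q x ∂(lengthOn e)

/-- `(n_iᵀ τ t, q)_e`. -/
def edgeDofNT (fr : Frame) (τ : PolM) (e : Finset E3) (i : Fin 2) (q : hull e → ℝ) : ℝ :=
  ∫ x, (fr.nE e i ⬝ᵥ (val τ x.1 *ᵥ fr.t e)) * q x ∂(lengthOn e)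

/-- `(n₂ᵀ (curl τ) n₁ + ∂_t (tᵀ τ t), q)_e`. -/
def edgeDofCurl (fr : Frame) (τ : PolM) (e : Finset E3) (q : hull e → ℝ) : ℝ :=
  ∫ x, (fr.n₂ e ⬝ᵥ (val (polCurl τ) x.1 *ᵥ fr.n₁ e) +
    fr.t e ⬝ᵥ (val (dirDeriv (fr.t e) τ) x.1 *ᵥ fr.t e)) * q x ∂(lengthOn e)

/-- `(n × sym (τ × n) × n, ς)_F`. -/
def faceDofTensor (fr : Frame) (τ : PolM) (F : Finset E3) (ς : hull F → M3) : ℝ :=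
  ∫ x, frob (tr₁perp (fr.n F) (val τ x.1)) (ς x) ∂(areaOn F)

/-- `(n · τ × n, v)_F`. -/
def faceDofVector (fr : Frame) (τ : PolM) (F : Finset E3) (v : hull F → V3) : ℝ :=
  ∫ x, tr₂ (fr.n F) (val τ x.1) ⬝ᵥ v x ∂(areaOn F)

/-- `(τ, q)_K`. -/
def volDof (τ : PolM) (K : Finset E3) (q : PolM) : ℝ :=
  ∫ x in hull K, frob (val τ x) (val q x)

/-- Prescribed values for all degrees of freedom on `K`. A moment degree of freedom against a test
space takes a linear functional on that space as its value. The vertex values of `τ` are trace-free,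
those of `sym curl τ` are symmetric, and the moments of `n_iᵀ (sym curl τ) n_j` are symmetric
in `i`, `j`. -/
structure DofValues (fr : Frame) (ℓ : ℕ) (K : Finset E3) where
  vertex : ∀ δ ∈ K, {A : M3 // A.trace = 0}
  vertexCurl : ∀ δ ∈ K, {A : M3 // A.IsSymm}
  edgeNN : ∀ e ∈ edges K, Fin 2 → Fin 2 → Module.Dual ℝ (polyOn (ℓ - 2) e)
  edgeNN_symm : ∀ e he i j, edgeNN e he i j = edgeNN e he j i
  edgeNT : ∀ e ∈ edges K, Fin 2 → Module.Dual ℝ (polyOn (ℓ - 1) e)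
  edgeCurl : ∀ e ∈ edges K, Module.Dual ℝ (polyOn ℓ e)
  faceTensor : ∀ F ∈ faces K, Module.Dual ℝ (faceTensorTest fr ℓ F)
  faceVector : ∀ F ∈ faces K, Module.Dual ℝ (faceVectorTest fr ℓ F)
  vol : Module.Dual ℝ (bubble fr (ℓ + 1) K)

/-- The degrees of freedom of `τ` on `K` have the prescribed values `d`. -/
structure HasDofs {fr : Frame} {ℓ : ℕ} {K : Finset E3} (d : DofValues fr ℓ K) (τ : PolM) :
    Prop where
  vertex : ∀ δ (h : δ ∈ K), val τ δ = (d.vertex δ h).1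
  vertexCurl : ∀ δ (h : δ ∈ K), val (symCurl τ) δ = (d.vertexCurl δ h).1
  edgeNN : ∀ e (h : e ∈ edges K) i j (q : polyOn (ℓ - 2) e),
    edgeDofNN fr τ e i j q = d.edgeNN e h i j q
  edgeNT : ∀ e (h : e ∈ edges K) i (q : polyOn (ℓ - 1) e),
    edgeDofNT fr τ e i q = d.edgeNT e h i q
  edgeCurl : ∀ e (h : e ∈ edges K) (q : polyOn ℓ e),
    edgeDofCurl fr τ e q = d.edgeCurl e h q
  faceTensor : ∀ F (h : F ∈ faces K) (ς : faceTensorTest fr ℓ F),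
    faceDofTensor fr τ F ς = d.faceTensor F h ς
  faceVector : ∀ F (h : F ∈ faces K) (v : faceVectorTest fr ℓ F),
    faceDofVector fr τ F v = d.faceVector F h v
  vol : ∀ q : bubble fr (ℓ + 1) K, volDof τ K q = d.vol q

/-- The degrees of freedom are unisolvent for `ℙ_{ℓ+1}(K; 𝕋)`: each choice of values for them is
attained by exactly one element of the space. -/
def Unisolvent (fr : Frame) (ℓ : ℕ) (K : Finset E3) : Prop :=
  ∀ d : DofValues fr ℓ K, ∃! τ : PolM, τ ∈ polyT (ℓ + 1) ∧ HasDofs d τ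

/-! ### The global space and conformity -/

/-- The vertex sets of the tetrahedra of a simplicial complex. -/
def tets (T : Geometry.SimplicialComplex ℝ E3) : Set (Finset E3) :=
  {K | K ∈ T.faces ∧ K.card = 4}

/-- `T` is a (finite, conforming) triangulation of the domain `Ω` into tetrahedra. -/
structure IsTriangulation (T : Geometry.SimplicialComplex ℝ E3) (Ω : Set E3) : Prop where
  finite : T.faces.Finite
  isOpen : IsOpen Ω
  closure_eq : closure Ω = ⋃ K ∈ tets T, hull K

/-- The degrees of freedom of a piecewise polynomial tensor (`τ K` is the polynomial on the
tetrahedron `K`) attached to vertices, edges and faces have the same value from all tetrahedra that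
share the vertex, edge or face. -/
structure SingleValued (fr : Frame) (ℓ : ℕ) (T : Geometry.SimplicialComplex ℝ E3)
    (τ : Finset E3 → PolM) : Prop where
  vertex : ∀ K ∈ tets T, ∀ K' ∈ tets T, ∀ δ ∈ K, δ ∈ K' → val (τ K) δ = val (τ K') δ
  vertexCurl : ∀ K ∈ tets T, ∀ K' ∈ tets T, ∀ δ ∈ K, δ ∈ K' →
    val (symCurl (τ K)) δ = val (symCurl (τ K')) δ
  edgeNN : ∀ K ∈ tets T, ∀ K' ∈ tets T, ∀ e ∈ edges K, e ∈ edges K' →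
    ∀ i j, ∀ q ∈ polyOn (ℓ - 2) e, edgeDofNN fr (τ K) e i j q = edgeDofNN fr (τ K') e i j q
  edgeNT : ∀ K ∈ tets T, ∀ K' ∈ tets T, ∀ e ∈ edges K, e ∈ edges K' →
    ∀ i, ∀ q ∈ polyOn (ℓ - 1) e, edgeDofNT fr (τ K) e i q = edgeDofNT fr (τ K') e i q
  edgeCurl : ∀ K ∈ tets T, ∀ K' ∈ tets T, ∀ e ∈ edges K, e ∈ edges K' →
    ∀ q ∈ polyOn ℓ e, edgeDofCurl fr (τ K) e q = edgeDofCurl fr (τ K') e q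
  faceTensor : ∀ K ∈ tets T, ∀ K' ∈ tets T, ∀ F ∈ faces K, F ∈ faces K' →
    ∀ ς ∈ faceTensorTest fr ℓ F, faceDofTensor fr (τ K) F ς = faceDofTensor fr (τ K') F ς
  faceVector : ∀ K ∈ tets T, ∀ K' ∈ tets T, ∀ F ∈ faces K, F ∈ faces K' →
    ∀ v ∈ faceVectorTest fr ℓ F, faceDofVector fr (τ K) F v = faceDofVector fr (τ K') F v

/-- The tensor field `u` belongs to the global finite element space: on each tetrahedron it is a
trace-free polynomial tensor of degree at most `ℓ + 1`, and the degrees of freedom attached to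
vertices, edges and faces are single-valued. (The values of `u` on the boundaries of the tetrahedra,
a null set, are irrelevant.) -/
def IsFEFunction (fr : Frame) (ℓ : ℕ) (T : Geometry.SimplicialComplex ℝ E3) (u : E3 → M3) : Prop :=
  ∃ τ : Finset E3 → PolM, (∀ K ∈ tets T, τ K ∈ polyT (ℓ + 1)) ∧
    (∀ K ∈ tets T, ∀ x ∈ interior (hull K), u x = val (τ K) x) ∧ SingleValued fr ℓ T τ

/-- The `k`-th partial derivative of a function on `ℝ³`. -/
def partialDeriv (k : Fin 3) (f : E3 → ℝ) : E3 → ℝ :=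
  fun x => fderiv ℝ f x (EuclideanSpace.single k 1)

/-- The tensor field `u` has square-integrable components on `Ω`. -/
def MemL2 (Ω : Set E3) (u : E3 → M3) : Prop :=
  ∀ i j, MemLp (fun x => u x i j) 2 (volume.restrict Ω)

/-- `φ` is a symmetric-tensor-valued test function on `Ω`: smooth with compact support in `Ω`. -/
def IsTestTensor (Ω : Set E3) (φ : Matrix (Fin 3) (Fin 3) (E3 → ℝ)) : Prop :=
  φ.IsSymm ∧ ∀ i j, ContDiff ℝ ∞ (φ i j) ∧ HasCompactSupport (φ i j) ∧ tsupport (φ i j) ⊆ Ω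

/-- `u ∈ H(sym curl, Ω; 𝕋)`: `u` is trace-free and square-integrable, and its weak `sym curl`
is a square-integrable symmetric tensor field `σ`, that is `(σ, φ) = (u, curl φ)` for all symmetric
test tensors `φ`. -/
def MemHSymCurl (Ω : Set E3) (u : E3 → M3) : Prop :=
  MemL2 Ω u ∧ (∀ᵐ x ∂(volume.restrict Ω), (u x).trace = 0) ∧
  ∃ σ : E3 → M3, MemL2 Ω σ ∧ (∀ x, (σ x).IsSymm) ∧
    ∀ φ : Matrix (Fin 3) (Fin 3) (E3 → ℝ), IsTestTensor Ω φ →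
      ∫ x in Ω, frob (σ x) (Matrix.of fun i j => φ i j x) =
        ∫ x in Ω, frob (u x) (Matrix.of fun i j => curl partialDeriv φ i j x)

end

end SymCurlFEM

open SymCurlFEM

/-! Unisolvence is an injectivity statement combined with a dimension count. The degrees of freedom
form one linear map `dofMap` from ℙ_{ℓ+1}(K; 𝕋) to vertex values and dual spaces of test spaces. It
is injective (`eq_zero_of_dofs`), and its target has dimension at most 8·C(ℓ+4, 3), a lower bound
for the dimension of its source; hence it is bijective.

Injectivity rests on a statement about one face, `FaceMomentsVanish.traces`: if the data on a face,
its edges and its vertices vanish, both traces vanish on that face. On an edge, degrees and endpoint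
values are matched so that n_iᵀ(sym curl τ)n_j, n_iᵀτt and n₂ᵀ(curl τ)n₁ + ∂_t(tᵀτt) vanish
identically. Once the first family vanishes, the last condition no longer depends on the normal
frame, so it can be used on every face containing the edge. In reference coordinates of the face,
n·τ becomes a planar field v with zero tangential component and zero rotation on the boundary, and
tr₁^⊥ becomes a symmetric tensor T with T_tt = 0 and 2∂_t T_tw = ∂_w T_tt on each edge (t along the
edge, w transversal).

The moments against ∇_F ℙ_{ℓ-3} kill rot v, so v = ∇φ with φ zero on the boundary; those against x^⊥
ℙ_{ℓ-1} kill φ, because q ↦ div(xq) is onto (`vector_eq_zero_of_moments`). One order higher, the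
moments against (∇_F^⊥)² ℙ_{ℓ-1} kill the Saint-Venant operator of T, so T is the symmetric gradient
of a displacement. Up to a rigid motion the displacement vanishes on the boundary, and the moments
against sym(x ⊗ y) kill it, because y ↦ div sym(x ⊗ y) is onto (`tensor_eq_zero_of_moments`). With
all traces zero τ is a bubble, and the interior moments contain ∫|τ|².

For the count only the bubble space is delicate. Let g be a barycentric gradient and t an edge of
the face opposite to its vertex. Vanishing traces make gᵀτt vanish on both faces containing t, so
two barycentric coordinates divide it. The three edges of a triangle sum to zero, so the three
quotients satisfy a linear relation ∑ Xₖrₖ = 0. As a trace-free tensor is determined by the numbers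
gᵀτt, the bubble space embeds into four copies of the space `relations` (`finrank_bubble_le`), whose
dimension follows from rank-nullity.

For conformity, the face statement is applied to the difference of the polynomials on two tetrahedra
sharing a face: sym(τ × n) is single-valued there. Integrating by parts on each tetrahedron leaves
face integrals with the sign of the outward normal. A face meeting Ω has exactly one tetrahedron on
each side (`sum_outSign_eq_zero`), so its contributions cancel; on other faces the test tensor is
zero. The weak sym curl is therefore the piecewise one. -/

namespace SymCurlFEM

/-! ### Polynomials in several variables -/

section Polynomials

open MvPolynomial

variable {σ κ : Type*}

theorem totalDegree_sum_le {ι : Type*} {s : Finset ι} {f : ι → MvPolynomial σ ℝ} {d : ℕ}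
    (h : ∀ i ∈ s, (f i).totalDegree ≤ d) : (∑ i ∈ s, f i).totalDegree ≤ d :=
  totalDegree_finsetSum_le h

theorem totalDegree_add_le {p q : MvPolynomial σ ℝ} {d : ℕ} (hp : p.totalDegree ≤ d)
    (hq : q.totalDegree ≤ d) : (p + q).totalDegree ≤ d :=
  (totalDegree_add _ _).trans (max_le hp hq)

theorem totalDegree_sub_le {p q : MvPolynomial σ ℝ} {d : ℕ} (hp : p.totalDegree ≤ d)
    (hq : q.totalDegree ≤ d) : (p - q).totalDegree ≤ d :=
  (totalDegree_sub _ _).trans (max_le hp hq)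

theorem totalDegree_mul_le {p q : MvPolynomial σ ℝ} {a b d : ℕ} (hp : p.totalDegree ≤ a)
    (hq : q.totalDegree ≤ b) (h : a + b ≤ d) : (p * q).totalDegree ≤ d :=
  (totalDegree_mul _ _).trans ((add_le_add hp hq).trans h)

theorem totalDegree_C_mul_le {p : MvPolynomial σ ℝ} {d : ℕ} (c : ℝ) (hp : p.totalDegree ≤ d) :
    (C c * p).totalDegree ≤ d :=
  totalDegree_mul_le (a := 0) (by simp) hp (by simp)

theorem totalDegree_smul_le_of_le {p : MvPolynomial σ ℝ} {d : ℕ} (c : ℝ) (hp : p.totalDegree ≤ d) :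
    (c • p).totalDegree ≤ d :=
  (totalDegree_smul_le c p).trans hp

/-- Substituting polynomials of degree at most one does not raise the degree. -/
theorem totalDegree_aeval_le (f : σ → MvPolynomial κ ℝ) (hf : ∀ i, (f i).totalDegree ≤ 1)
    (p : MvPolynomial σ ℝ) : (aeval f p).totalDegree ≤ p.totalDegree := by
  rw [aeval_def, eval₂]
  refine totalDegree_finsetSum_le fun m hm => ?_
  refine totalDegree_mul_le (a := 0) (b := p.totalDegree) (by simp [algebraMap_eq]) ?_ (by simp)
  refine (totalDegree_finsetProd _ _).trans ?_
  refine le_trans (Finset.sum_le_sum fun i _ => ?_) (le_totalDegree hm)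
  refine (totalDegree_pow _ _).trans ?_
  simpa using Nat.mul_le_mul_left (m i) (hf i)

theorem totalDegree_pderiv_le (i : σ) (p : MvPolynomial σ ℝ) :
    (pderiv i p).totalDegree ≤ p.totalDegree - 1 := by
  classical
  refine Finset.sup_le fun m hm => ?_
  rw [mem_support_iff, coeff_pderiv] at hm
  have h : m + Finsupp.single i 1 ∈ p.support := by
    rw [mem_support_iff]
    exact left_ne_zero_of_mul hm
  have h2 := le_totalDegree h
  rw [Finsupp.sum_add_index' (by simp) (by simp), Finsupp.sum_single_index (by simp)] at h2
  omega

theorem totalDegree_pderiv_le_of_le {i : σ} {p : MvPolynomial σ ℝ} {d : ℕ}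
    (hp : p.totalDegree ≤ d + 1) : (pderiv i p).totalDegree ≤ d :=
  (totalDegree_pderiv_le i p).trans (by omega)

/-- The chain rule. -/
theorem pderiv_aeval [Fintype σ] (f : σ → MvPolynomial κ ℝ) (j : κ) (p : MvPolynomial σ ℝ) :
    pderiv j (aeval f p) = ∑ i, aeval f (pderiv i p) * pderiv j (f i) := by
  classical
  induction p using MvPolynomial.induction_on with
  | C a => simp [algebraMap_eq]
  | add p q hp hq => simp only [map_add, hp, hq, add_mul, Finset.sum_add_distrib]
  | mul_X p i hp =>
    simp only [map_mul, aeval_X, pderiv_mul, hp, map_add, pderiv_X, add_mul,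
      Finset.sum_add_distrib, Finset.sum_mul]
    congr 1
    · exact Finset.sum_congr rfl fun k _ => by ring
    · rw [Finset.sum_eq_single i]
      · simp
      · intro b _ hb
        simp [Pi.single_eq_of_ne hb.symm]
      · simp

theorem eval_aeval (f : σ → MvPolynomial κ ℝ) (x : κ → ℝ) (p : MvPolynomial σ ℝ) :
    eval x (aeval f p) = eval (fun i => eval x (f i)) p := by
  induction p using MvPolynomial.induction_on with
  | C a => simp [algebraMap_eq]
  | add p q hp hq => simp only [map_add, hp, hq]
  | mul_X p i hp => simp only [map_mul, hp, aeval_X, eval_X]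

/-- The affine polynomial `w · x + c`. -/
noncomputable def affForm [Fintype σ] (w : σ → ℝ) (c : ℝ) : MvPolynomial σ ℝ :=
  ∑ i, C (w i) * X i + C c

theorem eval_affForm [Fintype σ] (w : σ → ℝ) (c : ℝ) (x : σ → ℝ) :
    eval x (affForm w c) = w ⬝ᵥ x + c := by
  simp [affForm, dotProduct]

theorem totalDegree_affForm_le [Fintype σ] (w : σ → ℝ) (c : ℝ) :
    (affForm w c).totalDegree ≤ 1 :=
  totalDegree_add_le (totalDegree_sum_le fun i _ => totalDegree_C_mul_le _ (by simp)) (by simp)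

theorem pderiv_affForm [Fintype σ] (w : σ → ℝ) (c : ℝ) (i : σ) :
    pderiv i (affForm w c) = C (w i) := by
  classical
  simp [affForm, Pi.single_apply]

theorem affForm_ne_zero [Fintype σ] {w : σ → ℝ} (hw : w ≠ 0) (c : ℝ) : affForm w c ≠ 0 := by
  intro h
  obtain ⟨i, hi⟩ := Function.ne_iff.1 hw
  have := pderiv_affForm w c i
  rw [h, map_zero] at this
  exact hi (by simpa using this.symm)

theorem totalDegree_affForm [Fintype σ] {w : σ → ℝ} (hw : w ≠ 0) (c : ℝ) :
    (affForm w c).totalDegree = 1 := by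
  refine le_antisymm (totalDegree_affForm_le w c) ?_
  obtain ⟨i, hi⟩ := Function.ne_iff.1 hw
  by_contra h
  have h0 : (affForm w c).totalDegree = 0 := by omega
  rw [totalDegree_eq_zero_iff_eq_C] at h0
  have h1 := pderiv_affForm w c i
  rw [h0, pderiv_C] at h1
  exact hi (by simpa using h1.symm)

theorem totalDegree_le_of_mul_affForm [Fintype σ] {w : σ → ℝ} (hw : w ≠ 0) {c : ℝ}
    {q : MvPolynomial σ ℝ} {d : ℕ} (h : (affForm w c * q).totalDegree ≤ d + 1) :
    q.totalDegree ≤ d := by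
  rcases eq_or_ne q 0 with rfl | hq
  · simp
  · rw [totalDegree_mul_of_isDomain (affForm_ne_zero hw c) hq, totalDegree_affForm hw] at h
    omega

/-- The substitution moves each variable by a multiple of the affine form, hence is the identity
modulo the ideal it generates. -/
theorem affForm_dvd_sub_aeval [Fintype σ] (w : σ → ℝ) (c : ℝ) (d : σ → ℝ)
    (p : MvPolynomial σ ℝ) :
    affForm w c ∣ p - aeval (fun j => X j - C (d j) * affForm w c) p := by
  rw [← Ideal.mem_span_singleton, ← Ideal.Quotient.eq]
  set I := Ideal.span {affForm w c}
  have h : (Ideal.Quotient.mkₐ ℝ I) =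
      (Ideal.Quotient.mkₐ ℝ I).comp (aeval fun j => X j - C (d j) * affForm w c) := by
    ext j
    have : (Ideal.Quotient.mk I) (affForm w c) = 0 :=
      Ideal.Quotient.eq_zero_iff_mem.2 (Ideal.mem_span_singleton_self _)
    simp [this]
  exact DFunLike.congr_fun h p

/-- A polynomial that vanishes on a hyperplane is divisible by the affine form defining it. -/
theorem exists_eq_affForm_mul [Fintype σ] {w : σ → ℝ} (hw : w ≠ 0) (c : ℝ)
    {p : MvPolynomial σ ℝ} (hp : ∀ x, w ⬝ᵥ x + c = 0 → eval x p = 0) :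
    ∃ q, p = affForm w c * q := by
  classical
  obtain ⟨i, hi⟩ := Function.ne_iff.1 hw
  -- The direction d is chosen with w · d = 1, so x ↦ x − (w · x + c)d projects onto the hyperplane
  -- and p vanishes after the substitution.
  obtain ⟨q, hq⟩ := affForm_dvd_sub_aeval w c (Pi.single i (w i)⁻¹) p
  refine ⟨q, ?_⟩
  rw [← hq, eq_comm, sub_eq_self]
  refine MvPolynomial.funext fun x => ?_
  rw [eval_aeval, map_zero]
  apply hp
  have : (fun j => eval x (X j - C ((Pi.single i (w i)⁻¹ : σ → ℝ) j) * affForm w c)) =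
      x - (w ⬝ᵥ x + c) • Pi.single i (w i)⁻¹ := by
    ext j
    simp [eval_affForm, mul_comm]
  rw [this, dotProduct_sub, dotProduct_smul, dotProduct_single, mul_inv_cancel₀ hi]
  simp

/-- Monomials are counted degree by degree with `multichoose`; Pascal's rule sums the counts by
induction on k. -/
theorem finrank_restrictTotalDegree (d k : ℕ) :
    Module.finrank ℝ (restrictTotalDegree (Fin d) ℝ k) = (k + d).choose d := by
  classical
  rw [restrictTotalDegree, Module.finrank_eq_nat_card_basis (basisRestrictSupport ℝ _)]
  have hset : {n : Fin d →₀ ℕ | (n.sum fun _ e => e) ≤ k} =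
      ↑((Finset.range (k + 1)).biUnion fun j => (Finset.univ : Finset (Fin d)).finsuppAntidiag j) := by
    ext n
    simp [Finsupp.sum_fintype]
  rw [hset, Nat.card_eq_card_toFinset, Finset.toFinset_coe, Finset.card_biUnion]
  · simp only [Finset.card_finsuppAntidiag_nat_eq_multichoose, Finset.card_univ, Fintype.card_fin]
    induction k with
    | zero => simp
    | succ k ih =>
      rw [Finset.sum_range_succ, ih (by ext; simp [Finsupp.sum_fintype])]
      rcases d with _ | d
      · simp
      · rw [Nat.multichoose_eq, show k + 1 + (d + 1) = (k + d + 1) + 1 by ring,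
          Nat.choose_succ_succ (k + d + 1) d, show d + 1 + (k + 1) - 1 = k + d + 1 by omega,
          ← Nat.choose_symm_of_eq_add (show k + d + 1 = (k + 1) + d by ring), add_comm]
        rfl
  · intro i _ j _ hij
    rw [Function.onFun, Finset.disjoint_left]
    intro n hn hn'
    simp only [Finset.mem_finsuppAntidiag] at hn hn'
    exact hij (hn.1.symm.trans hn'.1)

/-- The antiderivative in the variable `i` that vanishes for `x i = 0`. -/
noncomputable def antideriv (i : σ) : MvPolynomial σ ℝ →ₗ[ℝ] MvPolynomial σ ℝ :=
  (basisMonomials σ ℝ).constr ℝ fun m => monomial (m + Finsupp.single i 1) ((m i : ℝ) + 1)⁻¹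

theorem antideriv_monomial (i : σ) (m : σ →₀ ℕ) (c : ℝ) :
    antideriv i (monomial m c) = monomial (m + Finsupp.single i 1) (c * ((m i : ℝ) + 1)⁻¹) := by
  have h : monomial m c = c • (basisMonomials σ ℝ) m := by simp [smul_monomial]
  rw [h, map_smul, antideriv, Module.Basis.constr_basis, smul_monomial, smul_eq_mul]

theorem pderiv_antideriv (i : σ) (p : MvPolynomial σ ℝ) : pderiv i (antideriv i p) = p := by
  induction p using MvPolynomial.induction_on' with
  | monomial m c =>
    rw [antideriv_monomial, pderiv_monomial]
    have : ((m i : ℝ) + 1) ≠ 0 := by positivity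
    congr 1
    · simp
    · simp [mul_assoc, inv_mul_cancel₀ this]
  | add p q hp hq => rw [map_add, map_add, hp, hq]

theorem pderiv_antideriv_of_ne {i j : σ} (h : i ≠ j) (p : MvPolynomial σ ℝ) :
    pderiv j (antideriv i p) = antideriv i (pderiv j p) := by
  classical
  induction p using MvPolynomial.induction_on' with
  | monomial m c =>
    rw [antideriv_monomial, pderiv_monomial, pderiv_monomial, antideriv_monomial]
    simp only [Finsupp.add_apply, Finsupp.coe_tsub, Pi.sub_apply, Finsupp.single_apply, h,
      if_false, add_zero, h.symm, Nat.sub_zero]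
    rw [mul_right_comm]
    rcases Nat.eq_zero_or_pos (m j) with h0 | h0
    · simp [h0]
    · refine congr_arg (fun n => monomial n _) (Finsupp.ext fun k => ?_)
      simp only [Finsupp.coe_tsub, Finsupp.coe_add, Pi.sub_apply, Pi.add_apply,
        Finsupp.single_apply]
      split_ifs with h1 h2 <;> grind
  | add p q hp hq => simp only [map_add, hp, hq]

theorem totalDegree_antideriv_le (i : σ) (p : MvPolynomial σ ℝ) :
    (antideriv i p).totalDegree ≤ p.totalDegree + 1 := by
  classical
  conv_lhs => rw [p.as_sum, map_sum]
  refine totalDegree_sum_le fun m hm => ?_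
  rw [antideriv_monomial]
  refine (totalDegree_monomial_le _ _).trans ?_
  rw [Finsupp.sum_add_index' (by simp) (by simp), Finsupp.sum_single_index (by simp)]
  exact Nat.add_le_add_right (le_totalDegree hm) 1

theorem eval_antideriv_of_eq_zero (i : σ) (p : MvPolynomial σ ℝ) {x : σ → ℝ} (hx : x i = 0) :
    eval x (antideriv i p) = 0 := by
  induction p using MvPolynomial.induction_on' with
  | monomial m c =>
    rw [antideriv_monomial, show m + Finsupp.single i 1 = Finsupp.single i 1 + m by rw [add_comm]]
    rw [eval_monomial, Finsupp.prod_add_index' (by simp) (by intros; rw [pow_add])]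
    simp [hx]
  | add p q hp hq => rw [map_add, map_add, hp, hq, add_zero]

/-- The Euler operator `(x - o) · ∇`. -/
noncomputable def euler [Fintype σ] (o : σ → ℝ) (p : MvPolynomial σ ℝ) : MvPolynomial σ ℝ :=
  ∑ i, (X i - C (o i)) * pderiv i p

/-- Compare coefficients at a monomial m of maximal degree. There the Euler operator multiplies by
|m|, since the shift by o only brings in coefficients of degree |m| + 1, which are zero; and c + |m|
> 0. -/
theorem eq_zero_of_euler_eq [Fintype σ] {o : σ → ℝ} {c : ℝ} (hc : 0 < c) {p : MvPolynomial σ ℝ}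
    (h : C c * p + euler o p = 0) : p = 0 := by
  classical
  by_contra hp
  obtain ⟨m, hm, hmax⟩ := p.support.exists_max_image (fun m => m.sum fun _ e => e)
    (support_nonempty.2 hp)
  have h1 : ∀ i, coeff m ((X i - C (o i)) * pderiv i p) = coeff m p * m i := by
    intro i
    have h2 : coeff (m + Finsupp.single i 1) p = 0 := by
      by_contra h3
      have := hmax _ (mem_support_iff.2 h3)
      rw [Finsupp.sum_add_index' (by simp) (by simp), Finsupp.sum_single_index (by simp)] at this
      omega
    rw [sub_mul, coeff_sub, coeff_C_mul, coeff_pderiv, h2, mul_comm (X i), coeff_mul_X']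
    rcases Nat.eq_zero_or_pos (m i) with h0 | h0
    · simp [h0]
    · rw [if_pos (by simpa using h0.ne'), coeff_pderiv]
      have : m - Finsupp.single i 1 + Finsupp.single i 1 = m := by
        ext k
        by_cases hk : i = k
        · subst hk; simp; omega
        · simp [hk]
      rw [this]
      simp only [Finsupp.coe_tsub, Pi.sub_apply, Finsupp.single_eq_same]
      push_cast [Nat.cast_sub h0]
      ring
  have h2 := congr_arg (coeff m) h
  rw [coeff_add, coeff_C_mul, euler, coeff_sum, coeff_zero] at h2
  simp only [h1, ← Finset.mul_sum] at h2
  have h3 : coeff m p * (c + ∑ i, (m i : ℝ)) = 0 := by linarith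
  rcases mul_eq_zero.1 h3 with h4 | h4
  · exact mem_support_iff.1 hm h4
  · have : 0 ≤ ∑ i, (m i : ℝ) := Finset.sum_nonneg fun i _ => by positivity
    linarith

theorem pderiv_comm (i j : σ) (p : MvPolynomial σ ℝ) :
    pderiv i (pderiv j p) = pderiv j (pderiv i p) := by
  classical
  ext m
  simp only [coeff_pderiv, Finsupp.add_apply]
  by_cases h : i = j
  · subst h; rfl
  · rw [add_right_comm]
    simp [h, Ne.symm h]
    ring

theorem totalDegree_euler_le [Fintype σ] (o : σ → ℝ) {p : MvPolynomial σ ℝ} {d : ℕ}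
    (hp : p.totalDegree ≤ d) : (euler o p).totalDegree ≤ d := by
  -- Degree zero is separate because 1 + (d − 1) = d fails there for truncated subtraction.
  rcases Nat.eq_zero_or_pos d with rfl | hd
  · have h0 := totalDegree_eq_zero_iff_eq_C.1 (Nat.le_zero.1 hp)
    rw [h0]
    simp [euler]
  · refine totalDegree_sum_le fun i _ => ?_
    refine totalDegree_mul_le (a := 1) (b := d - 1) ?_ ?_ (by omega)
    · exact totalDegree_sub_le (by simp) (by simp)
    · exact totalDegree_pderiv_le_of_le (by omega)

end Polynomials

/-! ### The reference simplex -/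

section RefSimplex

open MvPolynomial

/-- The reference simplex in `ℝ^d`. -/
def refSimplex (d : ℕ) : Set (Fin d → ℝ) := {x | (∀ i, 0 ≤ x i) ∧ ∑ i, x i ≤ 1}

theorem isClosed_refSimplex (d : ℕ) : IsClosed (refSimplex d) := by
  have : refSimplex d = (⋂ i, {x | 0 ≤ x i}) ∩ {x | ∑ i, x i ≤ 1} := by
    ext x; simp [refSimplex]
  rw [this]
  exact (isClosed_iInter fun i => isClosed_le continuous_const (continuous_apply i)).inter
    (isClosed_le (by fun_prop) continuous_const)

theorem isCompact_refSimplex (d : ℕ) : IsCompact (refSimplex d) := by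
  refine (isCompact_Icc (a := (0 : Fin d → ℝ)) (b := 1)).of_isClosed_subset
    (isClosed_refSimplex d) fun x hx => ⟨fun i => hx.1 i, fun i => ?_⟩
  exact (Finset.single_le_sum (fun j _ => hx.1 j) (Finset.mem_univ i)).trans hx.2

theorem measurableSet_refSimplex (d : ℕ) : MeasurableSet (refSimplex d) :=
  (isClosed_refSimplex d).measurableSet

theorem integrableOn_refSimplex {d : ℕ} {f : (Fin d → ℝ) → ℝ} (hf : Continuous f) :
    IntegrableOn f (refSimplex d) :=
  hf.continuousOn.integrableOn_compact (isCompact_refSimplex d)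

theorem isOpen_refInterior (d : ℕ) : IsOpen {x : Fin d → ℝ | (∀ i, 0 < x i) ∧ ∑ i, x i < 1} := by
  have : {x : Fin d → ℝ | (∀ i, 0 < x i) ∧ ∑ i, x i < 1} =
      (⋂ i, {x | 0 < x i}) ∩ {x | ∑ i, x i < 1} := by
    ext x; simp
  rw [this]
  exact (isOpen_iInter_of_finite fun i => isOpen_lt continuous_const (continuous_apply i)).inter
    (isOpen_lt (by fun_prop) continuous_const)

/-- The interior contains the cube (0, 1/(d+1))^d, a product of infinite sets, on which a nonzero
polynomial cannot vanish. -/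
theorem eq_zero_of_eval_refInterior {d : ℕ} {p : MvPolynomial (Fin d) ℝ}
    (h : ∀ x : Fin d → ℝ, (∀ i, 0 < x i) → ∑ i, x i < 1 → eval x p = 0) : p = 0 := by
  refine funext_set (fun _ => Set.Ioo (0 : ℝ) (1 / (d + 1)))
    (fun _ => Set.Ioo_infinite (by positivity)) fun x hx => ?_
  rw [map_zero]
  refine h x (fun i => (hx i trivial).1) ?_
  calc ∑ i, x i ≤ ∑ _i : Fin d, (1 / (d + 1) : ℝ) :=
        Finset.sum_le_sum fun i _ => (hx i trivial).2.le
    _ = d / (d + 1) := by simp; ring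
    _ < 1 := by rw [div_lt_one (by positivity)]; linarith

/-- A polynomial whose square has vanishing integral against a weight that is positive inside the
reference simplex is zero. -/
theorem eq_zero_of_integral_weight_mul_sq {d : ℕ} {w p : MvPolynomial (Fin d) ℝ}
    (hw : ∀ x ∈ refSimplex d, 0 ≤ eval x w)
    (hw' : ∀ x : Fin d → ℝ, (∀ i, 0 < x i) → ∑ i, x i < 1 → 0 < eval x w)
    (h : ∫ x in refSimplex d, eval x (w * p * p) = 0) : p = 0 := by
  -- The integrand is nonnegative, so it vanishes almost everywhere, and by continuity everywhere in
  -- the open interior, where the positive weight cancels.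
  rw [setIntegral_eq_zero_iff_of_nonneg_ae] at h
  · refine eq_zero_of_eval_refInterior fun x h1 h2 => ?_
    have hsub : {x : Fin d → ℝ | (∀ i, 0 < x i) ∧ ∑ i, x i < 1} ⊆ refSimplex d :=
      fun y hy => ⟨fun i => (hy.1 i).le, hy.2.le⟩
    have h3 : Set.EqOn (fun x => eval x (w * p * p)) 0
        {x : Fin d → ℝ | (∀ i, 0 < x i) ∧ ∑ i, x i < 1} :=
      Measure.eqOn_open_of_ae_eq
        (ae_restrict_of_ae_restrict_of_subset hsub h)
        (isOpen_refInterior d) (continuous_eval _).continuousOn continuousOn_const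
    have h4 : eval x (w * p * p) = 0 := h3 ⟨h1, h2⟩
    rw [map_mul, map_mul, mul_assoc] at h4
    rcases mul_eq_zero.1 h4 with h5 | h5
    · exact absurd h5 (hw' x h1 h2).ne'
    · exact mul_self_eq_zero.1 h5
  · refine ae_restrict_of_forall_mem (measurableSet_refSimplex d) fun x hx => ?_
    simp only [Pi.zero_apply, map_mul, mul_assoc]
    exact mul_nonneg (hw x hx) (mul_self_nonneg _)
  · exact integrableOn_refSimplex (continuous_eval _)

theorem insertNth_mem_refSimplex_iff {d : ℕ} (i : Fin (d + 1)) (t : ℝ) (y : Fin d → ℝ) :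
    i.insertNth t y ∈ refSimplex (d + 1) ↔
      y ∈ refSimplex d ∧ t ∈ Set.Icc 0 (1 - ∑ j, y j) := by
  have h : ∑ j, (i.insertNth t y : Fin (d + 1) → ℝ) j = t + ∑ j, y j := by
    simp [Fin.sum_univ_succAbove _ i]
  simp only [refSimplex, Set.mem_ofPred_eq, h, Fin.forall_iff_succAbove i,
    Fin.insertNth_apply_same, Fin.insertNth_apply_succAbove, Set.mem_Icc]
  constructor
  · rintro ⟨⟨h1, h2⟩, h3⟩
    exact ⟨⟨h2, by linarith⟩, h1, by linarith⟩
  · rintro ⟨⟨h1, _⟩, h2, h3⟩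
    exact ⟨⟨h2, h1⟩, by linarith⟩

/-- Fubini: the slice over y in the i-th coordinate direction is the interval [0, 1 − ∑ y]. -/
theorem integral_refSimplex_succ {d : ℕ} (i : Fin (d + 1)) {g : (Fin (d + 1) → ℝ) → ℝ}
    (hg : Continuous g) :
    ∫ x in refSimplex (d + 1), g x =
      ∫ y in refSimplex d, ∫ t in (0 : ℝ)..(1 - ∑ j, y j), g (i.insertNth t y) := by
  classical
  have he := (volume_preserving_piFinSuccAbove (fun _ : Fin (d + 1) => ℝ) i).symm
  rw [← integral_indicator (measurableSet_refSimplex _), ← he.integral_comp', Measure.volume_eq_prod,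
    integral_prod_symm, ← integral_indicator (measurableSet_refSimplex _)]
  · congr 1
    ext y
    by_cases hy : y ∈ refSimplex d
    · rw [Set.indicator_of_mem hy, intervalIntegral.integral_of_le (by linarith [hy.2]),
        ← integral_Icc_eq_integral_Ioc, ← integral_indicator measurableSet_Icc]
      congr 1
      ext t
      simp only [Set.indicator_apply]
      refine if_congr ?_ rfl rfl
      exact (insertNth_mem_refSimplex_iff i t y).trans (by simp [hy])
    · rw [Set.indicator_of_notMem hy, ← integral_zero ℝ ℝ (μ := volume)]
      congr 1
      ext t
      rw [Set.indicator_of_notMem]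
      exact fun h => hy ((insertNth_mem_refSimplex_iff i t y).1 h).1
  · rw [← Measure.volume_eq_prod]
    refine (he.integrable_comp_emb (g := (refSimplex (d + 1)).indicator g)
      (MeasurableEquiv.measurableEmbedding _)).2 ?_
    exact (integrable_indicator_iff (measurableSet_refSimplex _)).2 (integrableOn_refSimplex hg)

/-- The integral of a partial derivative over the reference simplex. -/
theorem integral_refSimplex_fderiv {d : ℕ} (i : Fin (d + 1)) {f : (Fin (d + 1) → ℝ) → ℝ}
    (hf : ContDiff ℝ 1 f) :
    ∫ x in refSimplex (d + 1), fderiv ℝ f x (Pi.single i 1) =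
      (∫ y in refSimplex d, f (i.insertNth (1 - ∑ j, y j) y)) -
        ∫ y in refSimplex d, f (i.insertNth 0 y) := by
  have hc : ∀ u : (Fin d → ℝ) → ℝ, Continuous u → Continuous fun y => f (i.insertNth (u y) y) :=
    fun u hu => hf.continuous.comp (hu.finInsertNth i continuous_id)
  rw [integral_refSimplex_succ i ((hf.continuous_fderiv one_ne_zero).clm_apply continuous_const),
    ← integral_sub (integrableOn_refSimplex (hc _ (by fun_prop)))
      (integrableOn_refSimplex (hc _ continuous_const))]
  congr 1
  ext y
  have hd : ∀ t, HasDerivAt (fun t => f (i.insertNth t y))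
      (fderiv ℝ f (i.insertNth t y) (Pi.single i 1)) t := by
    intro t
    refine ((hf.differentiable one_ne_zero) _).hasFDerivAt.comp_hasDerivAt t ?_
    rw [hasDerivAt_pi]
    intro j
    rcases Fin.eq_self_or_eq_succAbove i j with rfl | ⟨k, rfl⟩
    · simpa using hasDerivAt_id' t
    · simpa [Pi.single_apply, Fin.succAbove_ne] using hasDerivAt_const t (y k)
  rw [intervalIntegral.integral_eq_sub_of_hasDerivAt fun t _ => hd t]
  refine Continuous.intervalIntegrable ?_ _ _
  exact ((hf.continuous_fderiv one_ne_zero).comp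
    (continuous_id.finInsertNth i continuous_const)).clm_apply continuous_const

theorem contDiff_eval {d : ℕ} (p : MvPolynomial (Fin d) ℝ) :
    ContDiff ℝ ∞ fun x : Fin d → ℝ => eval x p := by
  induction p using MvPolynomial.induction_on with
  | C a => simpa using contDiff_const
  | add p q hp hq => simpa using hp.add hq
  | mul_X p i hp => simpa using hp.mul (contDiff_apply ℝ ℝ i)

theorem hasFDerivAt_eval {d : ℕ} (p : MvPolynomial (Fin d) ℝ) (x : Fin d → ℝ) :
    HasFDerivAt (fun x => eval x p)
      (∑ i, eval x (pderiv i p) • (ContinuousLinearMap.proj i : (Fin d → ℝ) →L[ℝ] ℝ)) x := by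
  classical
  induction p using MvPolynomial.induction_on with
  | C a => simpa using hasFDerivAt_const a x
  | add p q hp hq =>
    simp only [map_add, add_smul, Finset.sum_add_distrib]
    exact hp.add hq
  | mul_X p i hp =>
    have h := hp.mul (ContinuousLinearMap.proj (R := ℝ) (φ := fun _ : Fin d => ℝ) i).hasFDerivAt (x := x)
    simp only [map_mul, eval_X]
    refine h.congr_fderiv ?_
    ext v
    simp only [ContinuousLinearMap.proj_apply, _root_.add_apply,
      _root_.smul_apply, smul_eq_mul, _root_.sum_apply, pderiv_mul,
      pderiv_X, map_add, map_mul, eval_X, add_mul, Finset.sum_add_distrib, Finset.mul_sum]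
    rw [add_comm]
    congr 1
    · exact Finset.sum_congr rfl fun j _ => by ring
    · rw [Finset.sum_eq_single i]
      · simp
      · intro b _ hb
        simp [Pi.single_eq_of_ne hb.symm]
      · simp

theorem fderiv_eval_single {d : ℕ} (p : MvPolynomial (Fin d) ℝ) (x : Fin d → ℝ) (i : Fin d) :
    fderiv ℝ (fun x => eval x p) x (Pi.single i 1) = eval x (pderiv i p) := by
  rw [(hasFDerivAt_eval p x).fderiv]
  simp [Pi.single_apply]

theorem integral_refSimplex_one (g : (Fin 1 → ℝ) → ℝ) :
    ∫ x in refSimplex 1, g x = ∫ t in (0 : ℝ)..1, g ![t] := by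
  rw [intervalIntegral.integral_of_le zero_le_one, ← integral_Icc_eq_integral_Ioc]
  have he : MeasurePreserving (MeasurableEquiv.funUnique (Fin 1) ℝ).symm volume volume := by
    convert (volume_preserving_funUnique (Fin 1) ℝ).symm
  rw [← he.setIntegral_preimage_emb (MeasurableEquiv.measurableEmbedding _) g]
  have : ⇑(MeasurableEquiv.funUnique (Fin 1) ℝ).symm ⁻¹' refSimplex 1 = Set.Icc 0 1 := by
    ext t
    simp [refSimplex, MeasurableEquiv.funUnique]
  rw [this]
  refine setIntegral_congr_fun measurableSet_Icc fun t _ => ?_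
  congr 1
  ext j
  fin_cases j
  rfl

theorem integral_pderiv_zero (p : MvPolynomial (Fin 2) ℝ) :
    ∫ x in refSimplex 2, eval x (pderiv 0 p) =
      (∫ t in (0 : ℝ)..1, eval ![1 - t, t] p) - ∫ t in (0 : ℝ)..1, eval ![0, t] p := by
  have h := integral_refSimplex_fderiv (0 : Fin 2) ((contDiff_eval p).of_le (by simp))
  simp only [fderiv_eval_single, integral_refSimplex_one] at h
  rw [h]
  congr 1 <;>
  · congr 1
    ext t
    congr 2
    ext j
    fin_cases j <;> simp

theorem integral_pderiv_one (p : MvPolynomial (Fin 2) ℝ) :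
    ∫ x in refSimplex 2, eval x (pderiv 1 p) =
      (∫ t in (0 : ℝ)..1, eval ![1 - t, t] p) - ∫ t in (0 : ℝ)..1, eval ![t, 0] p := by
  have h := integral_refSimplex_fderiv (1 : Fin 2) ((contDiff_eval p).of_le (by simp))
  simp only [fderiv_eval_single, integral_refSimplex_one] at h
  rw [h]
  congr 1
  -- Slicing in the second coordinate traverses the hypotenuse in the opposite direction.
  · rw [show (∫ t in (0 : ℝ)..1, eval ![1 - t, t] p) = ∫ t in (0 : ℝ)..1, eval ![t, 1 - t] p by
      have := intervalIntegral.integral_comp_sub_left (a := 0) (b := 1)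
        (fun t => eval ![t, 1 - t] p) 1
      simpa using this]
    congr 1
    ext t
    congr 2
    ext j
    fin_cases j <;> simp [Fin.insertNth, Fin.succAboveCases]
  · congr 1
    ext t
    congr 2
    ext j
    fin_cases j <;> simp [Fin.insertNth, Fin.succAboveCases]

end RefSimplex

/-! ### Polynomial fields on the reference triangle -/

section RefTriangle

open MvPolynomial

/-- A factor `q` of a product that vanishes on a hyperplane is divisible by the affine form of the
hyperplane if the other factor does not vanish identically there. -/
theorem exists_eq_affForm_mul_of_mul {σ : Type*} [Fintype σ] {w : σ → ℝ} (hw : w ≠ 0) (c : ℝ)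
    {g q : MvPolynomial σ ℝ} (h : ∀ x, w ⬝ᵥ x + c = 0 → eval x (g * q) = 0)
    {x₀ : σ → ℝ} (hx₀ : w ⬝ᵥ x₀ + c = 0) (hg : eval x₀ g ≠ 0) :
    ∃ r, q = affForm w c * r := by
  classical
  obtain ⟨i, hi⟩ := Function.ne_iff.1 hw
  set s : σ → MvPolynomial σ ℝ :=
    fun j => X j - C ((Pi.single i (w i)⁻¹ : σ → ℝ) j) * affForm w c
  have hs : ∀ x, (fun j => eval x (s j)) = x - (w ⬝ᵥ x + c) • Pi.single i (w i)⁻¹ := by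
    intro x
    ext j
    simp [s, eval_affForm, mul_comm]
  -- After projecting onto the hyperplane the product is zero, and polynomials form a domain; the
  -- factor g survives because it is nonzero at x₀, so q is the one that vanishes.
  have h0 : aeval s (g * q) = 0 := by
    refine MvPolynomial.funext fun x => ?_
    rw [eval_aeval, map_zero, hs]
    apply h
    rw [dotProduct_sub, dotProduct_smul, dotProduct_single, mul_inv_cancel₀ hi]
    simp
  rw [map_mul] at h0
  rcases mul_eq_zero.1 h0 with h1 | h1
  · refine absurd ?_ hg
    have h2 := congr_arg (eval x₀) h1
    rw [eval_aeval, hs, hx₀] at h2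
    simpa using h2
  · obtain ⟨r, hr⟩ := affForm_dvd_sub_aeval w c (Pi.single i (w i)⁻¹) q
    exact ⟨r, by rw [← hr]; exact (sub_eq_self.2 h1).symm⟩

/-- Integration over the reference simplex as a linear functional on polynomials. -/
noncomputable def refInt (d : ℕ) : MvPolynomial (Fin d) ℝ →ₗ[ℝ] ℝ where
  toFun p := ∫ x in refSimplex d, eval x p
  map_add' p q := by
    simp only [map_add]
    exact integral_add (integrableOn_refSimplex (continuous_eval _))
      (integrableOn_refSimplex (continuous_eval _))
  map_smul' c p := by
    simp only [smul_eval, RingHom.id_apply, smul_eq_mul]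
    exact integral_const_mul _ _

theorem refInt_apply {d : ℕ} (p : MvPolynomial (Fin d) ℝ) :
    refInt d p = ∫ x in refSimplex d, eval x p := rfl

theorem eq_zero_of_refInt_mul {d k : ℕ} {p : MvPolynomial (Fin d) ℝ} (hp : p.totalDegree ≤ k)
    (h : ∀ q : MvPolynomial (Fin d) ℝ, q.totalDegree ≤ k → refInt d (p * q) = 0) : p = 0 := by
  refine eq_zero_of_integral_weight_mul_sq (w := 1) (by simp) (by simp) ?_
  rw [one_mul]
  exact h p hp

theorem exists_eq_intervalBubble_mul {p : MvPolynomial (Fin 1) ℝ} (h0 : eval ![0] p = 0)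
    (h1 : eval ![1] p = 0) {k : ℕ} (hp : p.totalDegree ≤ k + 2) :
    ∃ q, p = X 0 * (1 - X 0) * q ∧ q.totalDegree ≤ k := by
  have e0 : affForm ![(1 : ℝ)] 0 = X 0 := by simp [affForm]
  have e1 : affForm ![(-1 : ℝ)] 1 = 1 - X 0 := by simp [affForm]; ring
  have w0 : ![(1 : ℝ)] ≠ 0 := by simp
  have w1 : ![(-1 : ℝ)] ≠ 0 := by simp
  obtain ⟨q, rfl⟩ := exists_eq_affForm_mul w0 0 (p := p) fun x hx => by
    have : x = ![0] := by ext i; fin_cases i; simpa [dotProduct] using hx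
    rw [this, h0]
  obtain ⟨r, rfl⟩ := exists_eq_affForm_mul_of_mul w1 1 (g := affForm ![(1 : ℝ)] 0) (q := q)
    (x₀ := ![1]) (fun x hx => by
      have : x = ![1] := by
        ext i; fin_cases i; simp [dotProduct] at hx ⊢; linarith
      rw [this, h1]) (by simp) (by simp [eval_affForm])
  refine ⟨r, by rw [e0, e1, mul_assoc], ?_⟩
  exact totalDegree_le_of_mul_affForm w1 (totalDegree_le_of_mul_affForm w0 hp)

/-- The endpoint values give p = x(1 − x)q with deg q ≤ k, and testing with q produces x(1 − x)q².
This is why edge moments may stop two degrees below the integrand when vertex values are available.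
-/
theorem eq_zero_of_endpoints_of_refInt_mul {k : ℕ} {p : MvPolynomial (Fin 1) ℝ}
    (hp : p.totalDegree ≤ k + 2) (h0 : eval ![0] p = 0) (h1 : eval ![1] p = 0)
    (h : ∀ q : MvPolynomial (Fin 1) ℝ, q.totalDegree ≤ k → refInt 1 (p * q) = 0) : p = 0 := by
  obtain ⟨q, rfl, hq⟩ := exists_eq_intervalBubble_mul h0 h1 hp
  rw [eq_zero_of_integral_weight_mul_sq (w := X 0 * (1 - X 0)) (p := q), mul_zero]
  · intro x hx
    have h1 : x 0 ≤ 1 := by simpa using hx.2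
    simpa using mul_nonneg (hx.1 0) (by linarith)
  · intro x hx hx'
    have h1 : x 0 < 1 := by simpa using hx'
    simpa using mul_pos (hx 0) (by linarith)
  · exact h q hq

/-- Integration over a segment as a linear functional on polynomials. -/
noncomputable def segInt (a b : Fin 2 → ℝ) : MvPolynomial (Fin 2) ℝ →ₗ[ℝ] ℝ where
  toFun p := ∫ t in (0 : ℝ)..1, eval (a + t • b) p
  map_add' p q := by
    simp only [map_add]
    refine intervalIntegral.integral_add ?_ ?_ <;>
    exact ((continuous_eval _).comp (by fun_prop)).intervalIntegrable _ _
  map_smul' c p := by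
    simp only [smul_eval, RingHom.id_apply, smul_eq_mul]
    exact intervalIntegral.integral_const_mul _ _

theorem segInt_congr {a b : Fin 2 → ℝ} {p q : MvPolynomial (Fin 2) ℝ}
    (h : ∀ t : ℝ, eval (a + t • b) p = eval (a + t • b) q) : segInt a b p = segInt a b q := by
  change (∫ t in (0 : ℝ)..1, _) = ∫ t in (0 : ℝ)..1, _
  simp only [h]

theorem hasDerivAt_eval_line {d : ℕ} (a b : Fin d → ℝ) (p : MvPolynomial (Fin d) ℝ) (t : ℝ) :
    HasDerivAt (fun t : ℝ => eval (a + t • b) p) (∑ i, b i * eval (a + t • b) (pderiv i p)) t := by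
  have h1 : HasDerivAt (fun t : ℝ => a + t • b) b t := by
    simpa using ((hasDerivAt_id t).smul_const b).const_add a
  have h := (hasFDerivAt_eval p (a + t • b)).comp_hasDerivAt t h1
  refine h.congr_deriv ?_
  simp [mul_comm]

theorem segInt_deriv (a b : Fin 2 → ℝ) (p : MvPolynomial (Fin 2) ℝ) :
    segInt a b (C (b 0) * pderiv 0 p + C (b 1) * pderiv 1 p) = eval (a + b) p - eval a p := by
  have h := intervalIntegral.integral_eq_sub_of_hasDerivAt (a := 0) (b := 1)
    (fun t _ => hasDerivAt_eval_line a b p t) (Continuous.intervalIntegrable (by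
      refine continuous_finsetSum _ fun i _ => continuous_const.mul ?_
      exact (continuous_eval _).comp (by fun_prop)) _ _)
  simpa [segInt, Fin.sum_univ_two] using h

theorem eval_line_eq_of_deriv_eq_zero {a b : Fin 2 → ℝ} {p : MvPolynomial (Fin 2) ℝ}
    (h : ∀ t : ℝ, eval (a + t • b) (C (b 0) * pderiv 0 p + C (b 1) * pderiv 1 p) = 0) (t : ℝ) :
    eval (a + t • b) p = eval a p := by
  have h1 := is_const_of_deriv_eq_zero (f := fun t : ℝ => eval (a + t • b) p)
    (fun t => (hasDerivAt_eval_line a b p t).differentiableAt) (fun t => by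
      rw [(hasDerivAt_eval_line a b p t).deriv]
      simpa [Fin.sum_univ_two] using h t) t 0
  simpa using h1

/-- The three edges of the reference triangle as a starting point and a direction. -/
def edgeStart : Fin 3 → Fin 2 → ℝ := ![![0, 0], ![0, 0], ![1, 0]]

/-- The directions of the edges of the reference triangle. -/
def edgeDir : Fin 3 → Fin 2 → ℝ := ![![1, 0], ![0, 1], ![-1, 1]]

/-- The polynomial `p` vanishes on the line through the edge `e` of the reference triangle. -/
def VanishesOnEdge (e : Fin 3) (p : MvPolynomial (Fin 2) ℝ) : Prop :=
  ∀ t : ℝ, eval (edgeStart e + t • edgeDir e) p = 0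

theorem refInt_pderiv_zero (p : MvPolynomial (Fin 2) ℝ) :
    refInt 2 (pderiv 0 p) =
      segInt (edgeStart 2) (edgeDir 2) p - segInt (edgeStart 1) (edgeDir 1) p := by
  rw [refInt_apply, integral_pderiv_zero]
  simp [segInt, edgeStart, edgeDir, sub_eq_add_neg]

theorem refInt_pderiv_one (p : MvPolynomial (Fin 2) ℝ) :
    refInt 2 (pderiv 1 p) =
      segInt (edgeStart 2) (edgeDir 2) p - segInt (edgeStart 0) (edgeDir 0) p := by
  rw [refInt_apply, integral_pderiv_one]
  simp [segInt, edgeStart, edgeDir, sub_eq_add_neg]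

theorem segInt_eq_zero {e : Fin 3} {p : MvPolynomial (Fin 2) ℝ} (h : VanishesOnEdge e p) :
    segInt (edgeStart e) (edgeDir e) p = 0 := by
  rw [← map_zero (segInt (edgeStart e) (edgeDir e))]
  exact segInt_congr fun t => by rw [h t, map_zero]

theorem VanishesOnEdge.mul_right {e : Fin 3} {p : MvPolynomial (Fin 2) ℝ} (h : VanishesOnEdge e p)
    (q : MvPolynomial (Fin 2) ℝ) : VanishesOnEdge e (p * q) := fun t => by
  rw [map_mul, h t, zero_mul]

theorem refInt_pderiv_eq_zero {p : MvPolynomial (Fin 2) ℝ} (h : ∀ e, VanishesOnEdge e p)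
    (i : Fin 2) : refInt 2 (pderiv i p) = 0 := by
  fin_cases i
  · exact (refInt_pderiv_zero p).trans (by rw [segInt_eq_zero (h 2), segInt_eq_zero (h 1), sub_zero])
  · exact (refInt_pderiv_one p).trans (by rw [segInt_eq_zero (h 2), segInt_eq_zero (h 0), sub_zero])

/-- The cubic bubble of the reference triangle. -/
noncomputable def triBubble : MvPolynomial (Fin 2) ℝ := X 0 * X 1 * (1 - X 0 - X 1)

/-- The three edge lines are divided out in turn. The witnesses (0, 1) and (1/2, 1/2) are points of
the next line at which the factors already removed are nonzero. -/
theorem exists_eq_triBubble_mul {p : MvPolynomial (Fin 2) ℝ} (h : ∀ e, VanishesOnEdge e p) {k : ℕ}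
    (hp : p.totalDegree ≤ k + 3) : ∃ q, p = triBubble * q ∧ q.totalDegree ≤ k := by
  have e0 : affForm ![(0 : ℝ), 1] 0 = X 1 := by simp [affForm]
  have e1 : affForm ![(1 : ℝ), 0] 0 = X 0 := by simp [affForm]
  have e2 : affForm ![(-1 : ℝ), -1] 1 = 1 - X 0 - X 1 := by simp [affForm]; ring
  have w0 : ![(0 : ℝ), 1] ≠ 0 := by simp
  have w1 : ![(1 : ℝ), 0] ≠ 0 := by simp
  have w2 : ![(-1 : ℝ), -1] ≠ 0 := by simp
  obtain ⟨q, rfl⟩ := exists_eq_affForm_mul w0 0 (p := p) fun x hx => by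
    have hx' : x = edgeStart 0 + x 0 • edgeDir 0 := by
      simp only [dotProduct, Fin.sum_univ_two] at hx
      ext i; fin_cases i
      · simp [edgeStart, edgeDir]
      · simpa [edgeStart, edgeDir] using hx
    rw [hx', h 0]
  obtain ⟨r, rfl⟩ := exists_eq_affForm_mul_of_mul w1 0 (g := affForm ![(0 : ℝ), 1] 0) (q := q)
    (x₀ := ![0, 1]) (fun x hx => by
      have hx' : x = edgeStart 1 + x 1 • edgeDir 1 := by
        simp only [dotProduct, Fin.sum_univ_two] at hx
        ext i; fin_cases i
        · simpa [edgeStart, edgeDir] using hx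
        · simp [edgeStart, edgeDir]
      rw [hx', h 1]) (by simp) (by simp [eval_affForm])
  obtain ⟨s, rfl⟩ := exists_eq_affForm_mul_of_mul w2 1
    (g := affForm ![(0 : ℝ), 1] 0 * affForm ![(1 : ℝ), 0] 0) (q := r)
    (x₀ := ![1 / 2, 1 / 2]) (fun x hx => by
      have hx' : x = edgeStart 2 + x 1 • edgeDir 2 := by
        simp only [dotProduct, Fin.sum_univ_two] at hx
        ext i; fin_cases i
        · simp [edgeStart, edgeDir] at hx ⊢
          linarith
        · simp [edgeStart, edgeDir]
      rw [mul_assoc, hx', h 2]) (by simp [dotProduct]; norm_num) (by simp [eval_affForm])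
  refine ⟨s, by rw [e0, e1, e2, triBubble]; ring, ?_⟩
  exact totalDegree_le_of_mul_affForm w2 (totalDegree_le_of_mul_affForm w1
    (totalDegree_le_of_mul_affForm w0 hp))

theorem eq_zero_of_refInt_triBubble {p : MvPolynomial (Fin 2) ℝ}
    (h : refInt 2 (triBubble * p * p) = 0) : p = 0 := by
  refine eq_zero_of_integral_weight_mul_sq (w := triBubble) (fun x hx => ?_) (fun x hx hx' => ?_) h
  · have h1 := hx.2
    rw [Fin.sum_univ_two] at h1
    simpa [triBubble] using mul_nonneg (mul_nonneg (hx.1 0) (hx.1 1))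
      (show 0 ≤ 1 - x 0 - x 1 by linarith)
  · rw [Fin.sum_univ_two] at hx'
    simpa [triBubble] using mul_pos (mul_pos (hx 0) (hx 1)) (show 0 < 1 - x 0 - x 1 by linarith)

/-- An injective linear operator preserving a finite-dimensional subspace is onto there. -/
theorem exists_preimage_of_injOn {M : Type*} [AddCommGroup M] [Module ℝ M] (W : Submodule ℝ M)
    [FiniteDimensional ℝ W] (L : M →ₗ[ℝ] M) (hW : ∀ x ∈ W, L x ∈ W)
    (hL : ∀ x ∈ W, L x = 0 → x = 0) {y : M} (hy : y ∈ W) : ∃ x ∈ W, L x = y := by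
  have h1 : Function.Injective (L.restrict hW) := by
    rw [← LinearMap.ker_eq_bot, LinearMap.ker_eq_bot']
    rintro ⟨x, hx⟩ h
    exact Subtype.ext (hL x hx (congr_arg Subtype.val h))
  obtain ⟨⟨x, hx⟩, h⟩ := LinearMap.injective_iff_surjective.1 h1 ⟨y, hy⟩
  exact ⟨x, hx, congr_arg Subtype.val h⟩

theorem euler_add {σ : Type*} [Fintype σ] (o : σ → ℝ) (p q : MvPolynomial σ ℝ) :
    euler o (p + q) = euler o p + euler o q := by
  simp [euler, mul_add, Finset.sum_add_distrib]

theorem euler_smul {σ : Type*} [Fintype σ] (o : σ → ℝ) (c : ℝ) (p : MvPolynomial σ ℝ) :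
    euler o (c • p) = c • euler o p := by
  simp [euler, Finset.smul_sum]

/-- The operator `q ↦ div (x q)` is onto on the polynomials of degree at most `k` in two
variables. -/
theorem exists_two_mul_add_euler_eq (o : Fin 2 → ℝ) {k : ℕ} {p : MvPolynomial (Fin 2) ℝ}
    (hp : p.totalDegree ≤ k) : ∃ q, q.totalDegree ≤ k ∧ C 2 * q + euler o q = p := by
  obtain ⟨q, hq, h⟩ := exists_preimage_of_injOn (restrictTotalDegree (Fin 2) ℝ k)
    { toFun := fun q => C 2 * q + euler o q
      map_add' := fun p q => by rw [euler_add]; ring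
      map_smul' := fun c q => by
        rw [euler_smul, RingHom.id_apply, smul_add, mul_smul_comm] }
    (fun q hq => by
      rw [mem_restrictTotalDegree] at hq ⊢
      exact totalDegree_add_le (totalDegree_C_mul_le _ hq) (totalDegree_euler_le o hq))
    (fun q _ h => eq_zero_of_euler_eq two_pos h) ((mem_restrictTotalDegree _ _ _).2 hp)
  exact ⟨q, (mem_restrictTotalDegree _ _ _).1 hq, h⟩

/-- A field on the reference triangle (in covariant components) with vanishing tangential components
and vanishing rotation on the boundary is determined by its moments. -/
theorem vector_eq_zero_of_moments {ℓ : ℕ} (hℓ : 3 ≤ ℓ) {v₀ v₁ : MvPolynomial (Fin 2) ℝ}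
    (d₀ : v₀.totalDegree ≤ ℓ + 1) (d₁ : v₁.totalDegree ≤ ℓ + 1)
    (ht : ∀ e, VanishesOnEdge e (C (edgeDir e 0) * v₀ + C (edgeDir e 1) * v₁))
    (hr : ∀ e, VanishesOnEdge e (pderiv 0 v₁ - pderiv 1 v₀))
    (hgrad : ∀ q : MvPolynomial (Fin 2) ℝ, q.totalDegree ≤ ℓ - 3 →
      refInt 2 (v₁ * pderiv 0 q - v₀ * pderiv 1 q) = 0) (o : Fin 2 → ℝ)
    (hx : ∀ q : MvPolynomial (Fin 2) ℝ, q.totalDegree ≤ ℓ - 1 →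
      refInt 2 (((X 0 - C (o 0)) * v₀ + (X 1 - C (o 1)) * v₁) * q) = 0) :
    v₀ = 0 ∧ v₁ = 0 := by
  -- The rotation has degree at most ℓ and vanishes on the boundary, so it is the cubic bubble times
  -- some r of degree at most ℓ − 3. Integrating rot v · r by parts leaves no boundary term, as the
  -- tangential component of v is zero, and the interior term is one of the given moments.
  have hrot : pderiv 0 v₁ - pderiv 1 v₀ = 0 := by
    obtain ⟨r, hr1, hr2⟩ := exists_eq_triBubble_mul hr (k := ℓ - 3)
      (totalDegree_sub_le (totalDegree_pderiv_le_of_le (by omega))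
        (totalDegree_pderiv_le_of_le (by omega)))
    have e0 := refInt_pderiv_zero (v₁ * r)
    have e1 := refInt_pderiv_one (v₀ * r)
    have b0 : VanishesOnEdge 0 v₀ := fun t => by simpa [edgeDir] using ht 0 t
    have b1 : VanishesOnEdge 1 v₁ := fun t => by simpa [edgeDir] using ht 1 t
    have b2 : segInt (edgeStart 2) (edgeDir 2) (v₁ * r) =
        segInt (edgeStart 2) (edgeDir 2) (v₀ * r) := segInt_congr fun t => by
      have := ht 2 t
      simp [edgeDir] at this
      rw [map_mul, map_mul]
      simp only [edgeDir]
      simp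
      left
      linarith
    rw [segInt_eq_zero (b1.mul_right r)] at e0
    rw [segInt_eq_zero (b0.mul_right r)] at e1
    have h1 : triBubble * r * r =
        pderiv 0 (v₁ * r) - pderiv 1 (v₀ * r) - (v₁ * pderiv 0 r - v₀ * pderiv 1 r) := by
      rw [← hr1]; simp only [pderiv_mul]; ring
    have h2 : refInt 2 (triBubble * r * r) = 0 := by
      rw [h1, map_sub, map_sub, hgrad r hr2, e0, e1, b2]; ring
    rw [hr1, eq_zero_of_refInt_triBubble h2, mul_zero]
  -- A potential of the closed field: since the rotation is zero, the correction under the second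
  -- antiderivative does not depend on the first variable.
  set φ := antideriv 0 v₀ + antideriv 1 (v₁ - pderiv 1 (antideriv 0 v₀)) with hφ
  have hφ0 : pderiv 0 φ = v₀ := by
    rw [hφ, map_add, pderiv_antideriv, pderiv_antideriv_of_ne (by decide), map_sub, pderiv_comm,
      pderiv_antideriv, hrot, map_zero, add_zero]
  have hφ1 : pderiv 1 φ = v₁ := by
    rw [hφ, map_add, pderiv_antideriv]; ring
  have dφ : φ.totalDegree ≤ ℓ + 2 := by
    refine totalDegree_add_le ((totalDegree_antideriv_le _ _).trans (by omega)) ?_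
    refine (totalDegree_antideriv_le _ _).trans (Nat.succ_le_succ (totalDegree_sub_le d₁ ?_))
    exact totalDegree_pderiv_le_of_le ((totalDegree_antideriv_le _ _).trans (by omega))
  have hconst : ∀ e t, eval (edgeStart e + t • edgeDir e) φ = eval (edgeStart e) φ := fun e t =>
    eval_line_eq_of_deriv_eq_zero (fun t => by rw [hφ0, hφ1]; exact ht e t) t
  have h00 : eval ![0, 0] φ = 0 := by
    rw [hφ, map_add, eval_antideriv_of_eq_zero _ _ (by simp),
      eval_antideriv_of_eq_zero _ _ (by simp), add_zero]
  have h10 : eval ![1, 0] φ = 0 := by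
    have := hconst 0 1
    simp only [edgeStart, edgeDir] at this
    simpa [h00] using this
  have hb : ∀ e, VanishesOnEdge e φ := fun e t => by
    rw [hconst e t]
    fin_cases e
    exacts [h00, h00, h10]
  obtain ⟨ψ, hψ, dψ⟩ := exists_eq_triBubble_mul hb (k := ℓ - 1) (by omega)
  -- With div((x − o)q) = ψ, the integral of bubble · ψ² is that of φ div((x − o)q), which by parts
  -- is minus the given moment of ∇φ · (x − o)q.
  obtain ⟨q, dq, hq⟩ := exists_two_mul_add_euler_eq o dψ
  have h1 : triBubble * ψ * ψ = pderiv 0 (φ * ((X 0 - C (o 0)) * q)) +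
      pderiv 1 (φ * ((X 1 - C (o 1)) * q)) -
      ((X 0 - C (o 0)) * v₀ + (X 1 - C (o 1)) * v₁) * q := by
    rw [← hψ]
    conv_lhs => rw [← hq]
    have hC : (C 2 : MvPolynomial (Fin 2) ℝ) = 2 := map_ofNat C 2
    simp only [euler, Fin.sum_univ_two, pderiv_mul, map_sub, pderiv_C, pderiv_X_self, hφ0, hφ1, hC]
    ring
  have h2 : refInt 2 (triBubble * ψ * ψ) = 0 := by
    rw [h1, map_sub, map_add, refInt_pderiv_eq_zero fun e => (hb e).mul_right _,
      refInt_pderiv_eq_zero fun e => (hb e).mul_right _, hx q dq]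
    ring
  have hφz : φ = 0 := by rw [hψ, eq_zero_of_refInt_triBubble h2, mul_zero]
  rw [← hφ0, ← hφ1, hφz]
  simp

end RefTriangle

/-! ### Symmetric tensor fields on the reference triangle and the Saint-Venant operator -/

section RefTriangleTensor

open MvPolynomial

theorem pderiv_euler {σ : Type*} [Fintype σ] (o : σ → ℝ) (j : σ)
    (p : MvPolynomial σ ℝ) : pderiv j (euler o p) = pderiv j p + euler o (pderiv j p) := by
  classical
  simp only [euler, map_sum, pderiv_mul, map_sub, pderiv_X, pderiv_C, sub_zero,
    Finset.sum_add_distrib]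
  congr 1
  · rw [Finset.sum_eq_single j]
    · simp
    · intro b _ hb
      simp [Pi.single_eq_of_ne hb]
    · simp
  · exact Finset.sum_congr rfl fun i _ => by rw [pderiv_comm]

/-- The operator `y ↦ div sym (x ⊗ y)` is onto on the polynomial fields of degree at most `k` in two
variables. -/
theorem exists_div_sym_eq (o : Fin 2 → ℝ) {k : ℕ} {p₀ p₁ : MvPolynomial (Fin 2) ℝ}
    (h₀ : p₀.totalDegree ≤ k) (h₁ : p₁.totalDegree ≤ k) :
    ∃ y₀ y₁ : MvPolynomial (Fin 2) ℝ, y₀.totalDegree ≤ k ∧ y₁.totalDegree ≤ k ∧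
      C 3 * y₀ + euler o y₀ + (X 0 - C (o 0)) * (pderiv 0 y₀ + pderiv 1 y₁) = p₀ ∧
      C 3 * y₁ + euler o y₁ + (X 1 - C (o 1)) * (pderiv 0 y₀ + pderiv 1 y₁) = p₁ := by
  set R := restrictTotalDegree (Fin 2) ℝ k with hR
  set W := LinearMap.range (R.subtype.prodMap R.subtype) with hWdef
  have hW : ∀ y, y ∈ W ↔ y.1.totalDegree ≤ k ∧ y.2.totalDegree ≤ k := by
    intro y
    rw [hWdef, LinearMap.mem_range]
    constructor
    · rintro ⟨⟨⟨a, ha⟩, ⟨b, hb⟩⟩, rfl⟩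
      exact ⟨(mem_restrictTotalDegree _ _ _).1 ha, (mem_restrictTotalDegree _ _ _).1 hb⟩
    · rintro ⟨ha, hb⟩
      exact ⟨⟨⟨_, (mem_restrictTotalDegree _ _ _).2 ha⟩, ⟨_, (mem_restrictTotalDegree _ _ _).2 hb⟩⟩,
        rfl⟩
  have hdeg : ∀ (i : Fin 2) {y₀ y₁ : MvPolynomial (Fin 2) ℝ}, y₀.totalDegree ≤ k →
      y₁.totalDegree ≤ k → ((X i - C (o i)) * (pderiv 0 y₀ + pderiv 1 y₁)).totalDegree ≤ k := by
    intro i y₀ y₁ d₀ d₁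
    rcases Nat.eq_zero_or_pos k with rfl | hk
    · rw [totalDegree_eq_zero_iff_eq_C.1 (Nat.le_zero.1 d₀),
        totalDegree_eq_zero_iff_eq_C.1 (Nat.le_zero.1 d₁)]
      simp
    · refine totalDegree_mul_le (a := 1) (b := k - 1)
        (totalDegree_sub_le (by simp) (by simp)) (totalDegree_add_le ?_ ?_) (by omega) <;>
      exact totalDegree_pderiv_le_of_le (by omega)
  obtain ⟨y, hy, h⟩ := exists_preimage_of_injOn W
    { toFun := fun y =>
        (C 3 * y.1 + euler o y.1 + (X 0 - C (o 0)) * (pderiv 0 y.1 + pderiv 1 y.2),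
          C 3 * y.2 + euler o y.2 + (X 1 - C (o 1)) * (pderiv 0 y.1 + pderiv 1 y.2))
      map_add' := fun y z => by
        ext1 <;> simp only [Prod.fst_add, Prod.snd_add, euler_add, map_add] <;> ring
      map_smul' := fun c y => by
        ext1 <;>
        simp only [Prod.smul_fst, Prod.smul_snd, euler_smul, Derivation.map_smul, RingHom.id_apply,
          smul_add, mul_smul_comm, mul_add] }
    (fun y hy => by
      rw [hW] at hy ⊢
      exact ⟨totalDegree_add_le (totalDegree_add_le (totalDegree_C_mul_le _ hy.1)
          (totalDegree_euler_le o hy.1)) (hdeg 0 hy.1 hy.2),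
        totalDegree_add_le (totalDegree_add_le (totalDegree_C_mul_le _ hy.2)
          (totalDegree_euler_le o hy.2)) (hdeg 1 hy.1 hy.2)⟩)
    (fun y _ h => by
      obtain ⟨e₀, e₁⟩ := Prod.mk.inj h
      have hC : (C 3 : MvPolynomial (Fin 2) ℝ) = 3 := map_ofNat C 3
      -- With D = div y and E the Euler operator, taking the divergence of the two equations gives
      -- 6D + 2E D = 0, so D = 0. What remains is 3y + E y = 0 in each component.
      have hD : pderiv 0 y.1 + pderiv 1 y.2 = 0 := by
        have h0 := congr_arg (pderiv (R := ℝ) 0) e₀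
        have h1 := congr_arg (pderiv (R := ℝ) 1) e₁
        refine eq_zero_of_euler_eq (o := o) (c := 3) (by norm_num) ?_
        have h2 : (2 : MvPolynomial (Fin 2) ℝ) ≠ 0 := two_ne_zero
        refine mul_left_cancel₀ h2 ?_
        simp only [map_add, pderiv_mul, pderiv_C, pderiv_euler, map_sub, pderiv_X_self, map_zero,
          zero_mul] at h0 h1
        rw [hC] at h0 h1
        rw [euler_add, hC, mul_zero]
        have h3 : (X 0 - C (o 0)) * (pderiv 0 (pderiv 0 y.1) + pderiv 0 (pderiv 1 y.2)) +
            (X 1 - C (o 1)) * (pderiv 1 (pderiv 0 y.1) + pderiv 1 (pderiv 1 y.2)) =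
            euler o (pderiv 0 y.1) + euler o (pderiv 1 y.2) := by
          simp only [euler, Fin.sum_univ_two]; ring
        linear_combination h0 + h1 - h3
      rw [hD, mul_zero, add_zero] at e₀ e₁
      exact Prod.ext (eq_zero_of_euler_eq (by norm_num) e₀) (eq_zero_of_euler_eq (by norm_num) e₁))
    (y := (p₀, p₁)) ((hW _).2 ⟨h₀, h₁⟩)
  obtain ⟨e₀, e₁⟩ := Prod.mk.inj h
  exact ⟨y.1, y.2, ((hW y).1 hy).1, ((hW y).1 hy).2, e₀, e₁⟩

/-- The Saint-Venant operator of a symmetric tensor field on the reference triangle. -/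
noncomputable def rotRot (a b c : MvPolynomial (Fin 2) ℝ) : MvPolynomial (Fin 2) ℝ :=
  pderiv 1 (pderiv 1 a) - 2 * pderiv 0 (pderiv 1 b) + pderiv 0 (pderiv 0 c)

/-- Boundary conditions for a symmetric tensor field with components `T₀₀ = a`, `T₀₁ = b`,
`T₁₁ = c` on the reference triangle. -/
structure TensorBoundary (a b c : MvPolynomial (Fin 2) ℝ) : Prop where
  tt0 : VanishesOnEdge 0 a
  tt1 : VanishesOnEdge 1 c
  tt2 : VanishesOnEdge 2 (a - 2 * b + c)
  g0 : VanishesOnEdge 0 (2 * pderiv 0 b - pderiv 1 a)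
  g1 : VanishesOnEdge 1 (2 * pderiv 1 b - pderiv 0 c)
  g2 : VanishesOnEdge 2 (pderiv 1 c - 2 * pderiv 0 c - pderiv 1 a + 2 * pderiv 0 b)
  v00 : eval ![0, 0] b = 0
  v10 : eval ![1, 0] b = 0 ∧ eval ![1, 0] c = 0
  v01 : eval ![0, 1] b = 0 ∧ eval ![0, 1] c = 0

/-- Two integrations by parts. On each edge the conditions `tt` and `g` turn the boundary integrand
into the tangential derivative of −q times the mixed component of the tensor, which integrates to
endpoint values; these are zero by the vertex conditions. -/
theorem TensorBoundary.refInt_hess {a b c : MvPolynomial (Fin 2) ℝ} (h : TensorBoundary a b c)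
    (q : MvPolynomial (Fin 2) ℝ) :
    refInt 2 (a * pderiv 1 (pderiv 1 q) - 2 * b * pderiv 0 (pderiv 1 q) +
      c * pderiv 0 (pderiv 0 q)) = refInt 2 (rotRot a b c * q) := by
  -- The pair (B, A) is the flux whose divergence is the difference of the two integrands.
  set A := a * pderiv 1 q - q * pderiv 1 a - b * pderiv 0 q + q * pderiv 0 b with hA
  set B := c * pderiv 0 q - q * pderiv 0 c - b * pderiv 1 q + q * pderiv 1 b with hB
  have h1 : a * pderiv 1 (pderiv 1 q) - 2 * b * pderiv 0 (pderiv 1 q) +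
      c * pderiv 0 (pderiv 0 q) = rotRot a b c * q + (pderiv 1 A + pderiv 0 B) := by
    simp only [hA, hB, rotRot, map_sub, map_add, pderiv_mul]
    rw [pderiv_comm 1 0 q, pderiv_comm 1 0 b]
    ring
  have E0 : segInt (edgeStart 0) (edgeDir 0) A = 0 := by
    have e := segInt_deriv (edgeStart 0) (edgeDir 0) (-(q * b))
    have e2 : segInt (edgeStart 0) (edgeDir 0) A =
        segInt (edgeStart 0) (edgeDir 0) (C (edgeDir 0 0) * pderiv 0 (-(q * b)) +
          C (edgeDir 0 1) * pderiv 1 (-(q * b))) := by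
      refine segInt_congr fun t => ?_
      have t1 := h.tt0 t
      have t2 := h.g0 t
      generalize edgeStart 0 + t • edgeDir 0 = x at t1 t2 ⊢
      rw [show edgeDir 0 0 = 1 from rfl, show edgeDir 0 1 = 0 from rfl]
      simp only [hA, map_sub, map_add, map_mul, map_neg, pderiv_mul, map_ofNat, eval_C] at t1 t2 ⊢
      linear_combination (eval _ (pderiv 1 q)) * t1 + eval _ q * t2
    have p1 : edgeStart 0 + edgeDir 0 = ![1, 0] := by simp [edgeStart, edgeDir]
    rw [e2, e, p1]
    simp [edgeStart, h.v00, h.v10.1]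
  have E1 : segInt (edgeStart 1) (edgeDir 1) B = 0 := by
    have e := segInt_deriv (edgeStart 1) (edgeDir 1) (-(q * b))
    have e2 : segInt (edgeStart 1) (edgeDir 1) B =
        segInt (edgeStart 1) (edgeDir 1) (C (edgeDir 1 0) * pderiv 0 (-(q * b)) +
          C (edgeDir 1 1) * pderiv 1 (-(q * b))) := by
      refine segInt_congr fun t => ?_
      have t1 := h.tt1 t
      have t2 := h.g1 t
      generalize edgeStart 1 + t • edgeDir 1 = x at t1 t2 ⊢
      rw [show edgeDir 1 0 = 0 from rfl, show edgeDir 1 1 = 1 from rfl]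
      simp only [hB, map_sub, map_add, map_mul, map_neg, pderiv_mul, map_ofNat, eval_C] at t1 t2 ⊢
      linear_combination (eval _ (pderiv 0 q)) * t1 + eval _ q * t2
    have p1 : edgeStart 1 + edgeDir 1 = ![0, 1] := by simp [edgeStart, edgeDir]
    rw [e2, e, p1]
    simp [edgeStart, h.v00, h.v01.1]
  have E2 : segInt (edgeStart 2) (edgeDir 2) (A + B) = 0 := by
    -- On the hypotenuse c − b is the mixed component of the tensor for the edge direction (−1, 1)
    -- and the transversal direction (0, 1).
    have e := segInt_deriv (edgeStart 2) (edgeDir 2) (-(q * (c - b)))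
    have e2 : segInt (edgeStart 2) (edgeDir 2) (A + B) =
        segInt (edgeStart 2) (edgeDir 2) (C (edgeDir 2 0) * pderiv 0 (-(q * (c - b))) +
          C (edgeDir 2 1) * pderiv 1 (-(q * (c - b)))) := by
      refine segInt_congr fun t => ?_
      have t1 := h.tt2 t
      have t2 := h.g2 t
      generalize edgeStart 2 + t • edgeDir 2 = x at t1 t2 ⊢
      rw [show edgeDir 2 0 = -1 from rfl, show edgeDir 2 1 = 1 from rfl]
      simp only [hA, hB, map_sub, map_add, map_mul, map_neg, pderiv_mul, map_ofNat, eval_C]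
        at t1 t2 ⊢
      linear_combination (eval _ (pderiv 1 q)) * t1 + eval _ q * t2
    have p1 : edgeStart 2 + edgeDir 2 = ![0, 1] := by simp [edgeStart, edgeDir]
    rw [e2, e, p1]
    simp [edgeStart, h.v10, h.v01]
  rw [map_add] at E2
  rw [h1, map_add, map_add, refInt_pderiv_zero, refInt_pderiv_one, E0, E1]
  linear_combination E2

/-- A symmetric tensor field with vanishing Saint-Venant operator is a symmetric gradient. -/
theorem exists_sym_grad_eq {a b c : MvPolynomial (Fin 2) ℝ} {k : ℕ} (da : a.totalDegree ≤ k)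
    (db : b.totalDegree ≤ k) (dc : c.totalDegree ≤ k) (h : rotRot a b c = 0) :
    ∃ u v : MvPolynomial (Fin 2) ℝ, u.totalDegree ≤ k + 1 ∧ v.totalDegree ≤ k + 1 ∧
      pderiv 0 u = a ∧ pderiv 1 v = c ∧ pderiv 1 u + pderiv 0 v = 2 * b := by
  -- R is the shear left over after integrating a and c. The Saint-Venant equation says ∂₀∂₁R = 0,
  -- so R is the sum of a function F of the second variable and a function R − F of the first; these
  -- are absorbed into u and v.
  set R := 2 * b - pderiv 1 (antideriv 0 a) - pderiv 0 (antideriv 1 c) with hR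
  have dR : R.totalDegree ≤ k := by
    refine totalDegree_sub_le (totalDegree_sub_le ?_ ?_) ?_
    · rw [show (2 : MvPolynomial (Fin 2) ℝ) = C 2 from (map_ofNat C 2).symm]
      exact totalDegree_C_mul_le _ db
    · exact totalDegree_pderiv_le_of_le ((totalDegree_antideriv_le _ _).trans (by omega))
    · exact totalDegree_pderiv_le_of_le ((totalDegree_antideriv_le _ _).trans (by omega))
  have hR2 : pderiv 0 (pderiv 1 R) = 0 := by
    have e1 : pderiv 0 (pderiv 1 (pderiv 1 (antideriv 0 a))) = pderiv 1 (pderiv 1 a) := by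
      rw [pderiv_comm 0 1, pderiv_comm 0 1, pderiv_antideriv]
    have e2 : pderiv 0 (pderiv 1 (pderiv 0 (antideriv 1 c))) = pderiv 0 (pderiv 0 c) := by
      rw [pderiv_comm 1 0, pderiv_antideriv]
    have hC : ∀ i : Fin 2, pderiv (R := ℝ) i 2 = 0 := fun i => by
      rw [show (2 : MvPolynomial (Fin 2) ℝ) = C 2 from (map_ofNat C 2).symm, pderiv_C]
    simp only [hR, map_sub, e1, e2, pderiv_mul, hC, zero_mul, zero_add]
    rw [rotRot] at h
    linear_combination -h
  set F := antideriv 1 (pderiv 1 R) with hF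
  have dF : F.totalDegree ≤ k := by
    rcases Nat.eq_zero_or_pos k with rfl | hk
    · rw [hF, totalDegree_eq_zero_iff_eq_C.1 (Nat.le_zero.1 dR)]
      simp
    · exact (totalDegree_antideriv_le _ _).trans
        (by have := totalDegree_pderiv_le (1 : Fin 2) R; omega)
  have hF0 : pderiv 0 F = 0 := by
    rw [hF, pderiv_antideriv_of_ne (by decide), hR2, map_zero]
  have hF1 : pderiv 1 (R - F) = 0 := by rw [map_sub, hF, pderiv_antideriv, sub_self]
  refine ⟨antideriv 0 a + antideriv 1 F, antideriv 1 c + antideriv 0 (R - F), ?_, ?_, ?_, ?_, ?_⟩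
  · exact totalDegree_add_le ((totalDegree_antideriv_le _ _).trans (by omega))
      ((totalDegree_antideriv_le _ _).trans (by omega))
  · exact totalDegree_add_le ((totalDegree_antideriv_le _ _).trans (by omega))
      ((totalDegree_antideriv_le _ _).trans (by have := totalDegree_sub_le dR dF; omega))
  · rw [map_add, pderiv_antideriv, pderiv_antideriv_of_ne (by decide), hF0, map_zero, add_zero]
  · rw [map_add, pderiv_antideriv, pderiv_antideriv_of_ne (by decide), hF1, map_zero, add_zero]
  · simp only [map_add, pderiv_antideriv, hR]
    ring

end RefTriangleTensor

/-! ### Symmetric gradients and unisolvent moments for symmetric tensors -/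

section RefTriangleMoments

open MvPolynomial

/-- Integration by parts for a displacement vanishing on the boundary: the brackets on the right are
the rows of div(2 sym(x ⊗ y)) with x taken relative to o. -/
theorem refInt_sym_grad {u v y₀ y₁ : MvPolynomial (Fin 2) ℝ} (o : Fin 2 → ℝ)
    (hu : ∀ e, VanishesOnEdge e u) (hv : ∀ e, VanishesOnEdge e v) :
    refInt 2 (2 * pderiv 0 u * ((X 0 - C (o 0)) * y₀) +
      (pderiv 1 u + pderiv 0 v) * ((X 0 - C (o 0)) * y₁ + (X 1 - C (o 1)) * y₀) +
      2 * pderiv 1 v * ((X 1 - C (o 1)) * y₁)) =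
    -refInt 2 (u * (C 3 * y₀ + euler o y₀ + (X 0 - C (o 0)) * (pderiv 0 y₀ + pderiv 1 y₁)) +
      v * (C 3 * y₁ + euler o y₁ + (X 1 - C (o 1)) * (pderiv 0 y₀ + pderiv 1 y₁))) := by
  set s := (X 0 - C (o 0)) * y₁ + (X 1 - C (o 1)) * y₀ with hs
  have hC : (C 3 : MvPolynomial (Fin 2) ℝ) = 3 := map_ofNat C 3
  have h2 : ∀ i : Fin 2, pderiv (R := ℝ) i 2 = 0 := fun i => by
    rw [show (2 : MvPolynomial (Fin 2) ℝ) = C 2 from (map_ofNat C 2).symm, pderiv_C]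
  have h : 2 * pderiv 0 u * ((X 0 - C (o 0)) * y₀) + (pderiv 1 u + pderiv 0 v) * s +
      2 * pderiv 1 v * ((X 1 - C (o 1)) * y₁) =
      pderiv 0 (u * (2 * ((X 0 - C (o 0)) * y₀))) + pderiv 1 (u * s) + pderiv 0 (v * s) +
        pderiv 1 (v * (2 * ((X 1 - C (o 1)) * y₁))) -
      (u * (C 3 * y₀ + euler o y₀ + (X 0 - C (o 0)) * (pderiv 0 y₀ + pderiv 1 y₁)) +
        v * (C 3 * y₁ + euler o y₁ + (X 1 - C (o 1)) * (pderiv 0 y₀ + pderiv 1 y₁))) := by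
    simp only [hs, hC, euler, Fin.sum_univ_two, pderiv_mul, map_add, map_sub, pderiv_C, h2,
      pderiv_X_self, pderiv_X_of_ne (show (1 : Fin 2) ≠ 0 by decide),
      pderiv_X_of_ne (show (0 : Fin 2) ≠ 1 by decide)]
    ring
  rw [h, map_sub, map_add, map_add, map_add, refInt_pderiv_eq_zero fun e => (hu e).mul_right _,
    refInt_pderiv_eq_zero fun e => (hu e).mul_right _,
    refInt_pderiv_eq_zero fun e => (hv e).mul_right _,
    refInt_pderiv_eq_zero fun e => (hv e).mul_right _]
  ring

/-- The potential of a symmetric tensor field with the boundary conditions of `TensorBoundary` can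
be chosen to vanish on the boundary. -/
theorem TensorBoundary.exists_potential {a b c : MvPolynomial (Fin 2) ℝ}
    (h : TensorBoundary a b c) {k : ℕ} (da : a.totalDegree ≤ k) (db : b.totalDegree ≤ k)
    (dc : c.totalDegree ≤ k) (hr : rotRot a b c = 0) :
    ∃ u v : MvPolynomial (Fin 2) ℝ, u.totalDegree ≤ k + 1 ∧ v.totalDegree ≤ k + 1 ∧
      (∀ e, VanishesOnEdge e u) ∧ (∀ e, VanishesOnEdge e v) ∧
      pderiv 0 u = a ∧ pderiv 1 v = c ∧ pderiv 1 u + pderiv 0 v = 2 * b := by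
  obtain ⟨u₁, v₁, du₁, dv₁, hu₁, hv₁, huv₁⟩ := exists_sym_grad_eq da db dc hr
  set r₀ := eval ![0, 0] (pderiv 1 u₁) with hr₀
  have hr₀' : eval ![0, 0] (pderiv 0 v₁) = -r₀ := by
    have := congr_arg (eval ![0, 0]) huv₁
    rw [map_add, map_mul, h.v00, mul_zero] at this
    linarith
  -- Subtracting a rigid motion does not change the symmetric gradient. The translation makes u and
  -- v vanish at the origin; the rotation makes ∂₁u and ∂₀v vanish there, since their sum 2b already
  -- does.
  set u := u₁ - C (eval ![0, 0] u₁) - C r₀ * X 1 with hu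
  set v := v₁ - C (eval ![0, 0] v₁) + C r₀ * X 0 with hv
  have x01 : pderiv 0 (X 1 : MvPolynomial (Fin 2) ℝ) = 0 := pderiv_X_of_ne (by decide)
  have x10 : pderiv 1 (X 0 : MvPolynomial (Fin 2) ℝ) = 0 := pderiv_X_of_ne (by decide)
  have u0 : pderiv 0 u = a := by simp [hu, hu₁, x01]
  have v1 : pderiv 1 v = c := by simp [hv, hv₁, x10]
  have u1 : pderiv 1 u = pderiv 1 u₁ - C r₀ := by simp [hu]
  have v0 : pderiv 0 v = pderiv 0 v₁ + C r₀ := by simp [hv]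
  have huv : pderiv 1 u + pderiv 0 v = 2 * b := by rw [u1, v0, ← huv₁]; ring
  have u00 : eval ![0, 0] u = 0 := by simp [hu]
  have v00 : eval ![0, 0] v = 0 := by simp [hv]
  have du00 : eval ![0, 0] (pderiv 1 u) = 0 := by simp [u1, hr₀]
  have dv00 : eval ![0, 0] (pderiv 0 v) = 0 := by simp [v0, hr₀']
  have du : u.totalDegree ≤ k + 1 := totalDegree_sub_le (totalDegree_sub_le du₁ (by simp))
    (totalDegree_C_mul_le _ (by simp))
  have dv : v.totalDegree ≤ k + 1 := totalDegree_add_le (totalDegree_sub_le dv₁ (by simp))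
    (totalDegree_C_mul_le _ (by simp))
  clear_value u v
  have h2 : ∀ (i : Fin 2) (p : MvPolynomial (Fin 2) ℝ), pderiv i (2 * p) = 2 * pderiv i p :=
    fun i p => by
      rw [show (2 : MvPolynomial (Fin 2) ℝ) = C 2 from (map_ofNat C 2).symm, pderiv_C_mul]
  have line : ∀ (e : Fin 3) (p : MvPolynomial (Fin 2) ℝ),
      VanishesOnEdge e (C (edgeDir e 0) * pderiv 0 p + C (edgeDir e 1) * pderiv 1 p) →
      eval (edgeStart e) p = 0 → VanishesOnEdge e p := fun e p h1 h2 t => by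
    rw [eval_line_eq_of_deriv_eq_zero h1, h2]
  have U0 : VanishesOnEdge 0 u := line 0 u (fun t => by
    simpa [edgeDir, u0] using h.tt0 t) u00
  -- The component normal to the edge needs two integrations: ∂₀²v = 2∂₀b − ∂₁a vanishes by `g0`,
  -- and both v and ∂₀v are zero at the origin.
  have V0 : VanishesOnEdge 0 v := by
    have e1 : VanishesOnEdge 0 (pderiv 0 v) := line 0 _ (fun t => by
      have e2 : pderiv 0 (pderiv 0 v) = 2 * pderiv 0 b - pderiv 1 a := by
        rw [← h2, ← huv, ← u0, map_add, pderiv_comm 1 0]; ring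
      simpa [edgeDir, e2] using h.g0 t) dv00
    exact line 0 v (fun t => by simpa [edgeDir] using e1 t) v00
  have V1 : VanishesOnEdge 1 v := line 1 v (fun t => by
    simpa [edgeDir, v1] using h.tt1 t) v00
  have U1 : VanishesOnEdge 1 u := by
    have e1 : VanishesOnEdge 1 (pderiv 1 u) := line 1 _ (fun t => by
      have e2 : pderiv 1 (pderiv 1 u) = 2 * pderiv 1 b - pderiv 0 c := by
        rw [← h2, ← huv, ← v1, map_add, pderiv_comm 1 0 v]; ring
      simpa [edgeDir, e2] using h.g1 t) du00
    exact line 1 u (fun t => by simpa [edgeDir] using e1 t) u00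
  have p10 : edgeStart 0 + (1 : ℝ) • edgeDir 0 = ![1, 0] := by simp [edgeStart, edgeDir]
  have p01 : edgeStart 1 + (1 : ℝ) • edgeDir 1 = ![0, 1] := by simp [edgeStart, edgeDir]
  have p01' : edgeStart 2 + edgeDir 2 = ![0, 1] := by simp [edgeStart, edgeDir]
  have u10 : eval ![1, 0] u = 0 := by rw [← p10]; exact U0 1
  have v10 : eval ![1, 0] v = 0 := by rw [← p10]; exact V0 1
  have v01 : eval ![0, 1] v = 0 := by rw [← p01]; exact V1 1
  -- The hypotenuse does not start at the origin, so no derivative is known at its endpoints. By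
  -- `g2` the tangential derivative of v is constant along it, and the constant equals v(0, 1) −
  -- v(1, 0) = 0.
  have V2 : VanishesOnEdge 2 v := by
    set s := C (edgeDir 2 0) * pderiv 0 v + C (edgeDir 2 1) * pderiv 1 v with hs
    have e1 : ∀ t, eval (edgeStart 2 + t • edgeDir 2) s = eval (edgeStart 2) s := fun t =>
      eval_line_eq_of_deriv_eq_zero (fun t => by
        have e2 : C (edgeDir 2 0) * pderiv 0 s + C (edgeDir 2 1) * pderiv 1 s =
            pderiv 1 c - 2 * pderiv 0 c - pderiv 1 a + 2 * pderiv 0 b := by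
          have e3 : 2 * pderiv 0 b = pderiv 0 (pderiv 1 u) + pderiv 0 (pderiv 0 v) := by
            rw [← h2, ← huv, map_add]
          rw [e3, ← v1, ← u0, hs, show edgeDir 2 0 = -1 from rfl, show edgeDir 2 1 = 1 from rfl]
          simp only [map_add, map_neg, C_1, pderiv_mul, pderiv_one]
          rw [pderiv_comm 1 0 u, pderiv_comm 1 0 v]
          ring
        rw [e2]
        exact h.g2 t) t
    have e4 : segInt (edgeStart 2) (edgeDir 2) s = eval (edgeStart 2) s := by
      rw [segInt_congr (q := C (eval (edgeStart 2) s)) fun t => by rw [e1, eval_C]]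
      simp [segInt]
    refine line 2 v (fun t => ?_) v10
    rw [e1, ← e4, hs, segInt_deriv, p01', v01]
    exact (zero_sub _).trans (by rw [show edgeStart 2 = ![1, 0] from rfl, v10, neg_zero])
  have U2 : VanishesOnEdge 2 u := by
    have e1 : VanishesOnEdge 2 (v - u) := line 2 _ (fun t => by
      have e2 : C (edgeDir 2 0) * pderiv 0 (v - u) + C (edgeDir 2 1) * pderiv 1 (v - u) =
          a - 2 * b + c := by
        rw [← huv, ← v1, ← u0, show edgeDir 2 0 = -1 from rfl, show edgeDir 2 1 = 1 from rfl]
        simp only [map_sub, map_neg, C_1]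
        ring
      rw [e2]
      exact h.tt2 t) (by rw [show edgeStart 2 = ![1, 0] from rfl, map_sub, u10, v10, sub_zero])
    intro t
    have := e1 t
    rw [map_sub, V2 t] at this
    linarith
  refine ⟨u, v, du, dv, fun e => ?_, fun e => ?_, u0, v1, huv⟩
  · fin_cases e
    exacts [U0, U1, U2]
  · fin_cases e
    exacts [V0, V1, V2]

/-- A symmetric tensor field on the reference triangle with the boundary conditions of
`TensorBoundary` is determined by its moments. -/
theorem tensor_eq_zero_of_moments {ℓ : ℕ} (hℓ : 1 ≤ ℓ) {a b c : MvPolynomial (Fin 2) ℝ}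
    (da : a.totalDegree ≤ ℓ + 1) (db : b.totalDegree ≤ ℓ + 1) (dc : c.totalDegree ≤ ℓ + 1)
    (h : TensorBoundary a b c)
    (hH : ∀ q : MvPolynomial (Fin 2) ℝ, q.totalDegree ≤ ℓ - 1 →
      refInt 2 (a * pderiv 1 (pderiv 1 q) - 2 * b * pderiv 0 (pderiv 1 q) +
        c * pderiv 0 (pderiv 0 q)) = 0) (o : Fin 2 → ℝ)
    (hx : ∀ y₀ y₁ : MvPolynomial (Fin 2) ℝ, y₀.totalDegree ≤ ℓ - 1 → y₁.totalDegree ≤ ℓ - 1 →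
      refInt 2 (2 * a * ((X 0 - C (o 0)) * y₀) +
        2 * b * ((X 0 - C (o 0)) * y₁ + (X 1 - C (o 1)) * y₀) +
        2 * c * ((X 1 - C (o 1)) * y₁)) = 0) : a = 0 ∧ b = 0 ∧ c = 0 := by
  have hr : rotRot a b c = 0 := by
    -- Two derivatives bring the degree down to ℓ − 1, the degree of the test functions, so no
    -- bubble factor is needed here.
    refine eq_zero_of_refInt_mul (k := ℓ - 1) ?_ fun q hq => by rw [← h.refInt_hess, hH q hq]
    have e1 : ∀ (i j : Fin 2) {p : MvPolynomial (Fin 2) ℝ}, p.totalDegree ≤ ℓ + 1 →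
        (pderiv i (pderiv j p)).totalDegree ≤ ℓ - 1 := fun i j p hp =>
      totalDegree_pderiv_le_of_le (totalDegree_pderiv_le_of_le (by omega))
    refine totalDegree_add_le (totalDegree_sub_le (e1 _ _ da) ?_) (e1 _ _ dc)
    rw [show (2 : MvPolynomial (Fin 2) ℝ) = C 2 from (map_ofNat C 2).symm]
    exact totalDegree_C_mul_le _ (e1 _ _ db)
  obtain ⟨u, v, du, dv, hu, hv, u0, v1, huv⟩ := h.exists_potential da db dc hr
  have key : ∀ p₀ p₁ : MvPolynomial (Fin 2) ℝ, p₀.totalDegree ≤ ℓ - 1 → p₁.totalDegree ≤ ℓ - 1 →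
      refInt 2 (u * p₀ + v * p₁) = 0 := by
    intro p₀ p₁ h₀ h₁
    obtain ⟨y₀, y₁, d₀, d₁, e₀, e₁⟩ := exists_div_sym_eq o h₀ h₁
    have := refInt_sym_grad o hu hv (y₀ := y₀) (y₁ := y₁)
    rw [u0, v1, huv, hx y₀ y₁ d₀ d₁, e₀, e₁] at this
    linarith
  -- The displacement has degree at most ℓ + 2 = (ℓ − 1) + 3, so its quotient by the cubic bubble is
  -- an admissible test polynomial in `key`.
  obtain ⟨p, hp, dp⟩ := exists_eq_triBubble_mul hu (k := ℓ - 1) (by omega)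
  obtain ⟨q, hq, dq⟩ := exists_eq_triBubble_mul hv (k := ℓ - 1) (by omega)
  have hp0 : p = 0 := eq_zero_of_refInt_triBubble (by
    simpa [← hp] using key p 0 dp (by simp))
  have hq0 : q = 0 := eq_zero_of_refInt_triBubble (by
    simpa [← hq] using key 0 q (by simp) dq)
  rw [hp0, mul_zero] at hp
  rw [hq0, mul_zero] at hq
  rw [hp, map_zero] at u0 huv
  rw [hq, map_zero] at v1 huv
  refine ⟨u0.symm, ?_, v1.symm⟩
  rw [add_zero, eq_comm] at huv
  exact (mul_eq_zero.1 huv).resolve_left two_ne_zero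

end RefTriangleMoments

/-! ### Affine charts of simplices -/

section Charts

open MvPolynomial

theorem mem_convexHull_range_iff {ι E : Type*} [Fintype ι] [AddCommGroup E] [Module ℝ E]
    {a : ι → E} {x : E} : x ∈ convexHull ℝ (Set.range a) ↔
      ∃ w : ι → ℝ, (∀ i, 0 ≤ w i) ∧ ∑ i, w i = 1 ∧ ∑ i, w i • a i = x := by
  classical
  have h : Set.range a = (∑ i, (LinearMap.proj (R := ℝ) (φ := fun _ : ι => ℝ) i).smulRight (a i) :
      (ι → ℝ) →ₗ[ℝ] E) '' Set.range fun i : ι => (Pi.single i 1 : ι → ℝ) := by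
    rw [← Set.range_comp]
    congr 1
    ext i
    simp [Pi.single_apply]
  rw [h, ← LinearMap.image_convexHull, convexHull_rangle_single_eq_stdSimplex]
  constructor
  · rintro ⟨w, hw, rfl⟩
    exact ⟨w, hw.1, hw.2, by simp⟩
  · rintro ⟨w, h1, h2, rfl⟩
    exact ⟨w, ⟨h1, h2⟩, by simp⟩

variable {d : ℕ}

/-- The edge vectors of the simplex with vertices `a` at its first vertex. -/
def edgeVec (a : Fin (d + 1) → E3) (j : Fin d) : V3 := (a j.succ - a 0).ofLp

/-- The affine parametrization of the simplex with vertices `a`. -/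
noncomputable def chart (a : Fin (d + 1) → E3) (x : Fin d → ℝ) : E3 :=
  a 0 + ∑ j, x j • (a j.succ - a 0)

theorem continuous_chart (a : Fin (d + 1) → E3) : Continuous (chart a) := by
  unfold chart; fun_prop

theorem chart_ofLp (a : Fin (d + 1) → E3) (x : Fin d → ℝ) :
    (chart a x).ofLp = (a 0).ofLp + ∑ j, x j • edgeVec a j := by
  simp [chart, edgeVec]

theorem chart_eq_sum (a : Fin (d + 1) → E3) (x : Fin d → ℝ) :
    chart a x = (1 - ∑ j, x j) • a 0 + ∑ j, x j • a j.succ := by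
  simp only [chart, smul_sub, Finset.sum_sub_distrib, sub_smul, one_smul, Finset.sum_smul]
  abel

theorem image_chart_refSimplex (a : Fin (d + 1) → E3) :
    chart a '' refSimplex d = convexHull ℝ (Set.range a) := by
  ext x
  rw [mem_convexHull_range_iff]
  constructor
  · rintro ⟨y, hy, rfl⟩
    refine ⟨Fin.cons (1 - ∑ j, y j) y, fun i => ?_, ?_, ?_⟩
    · refine Fin.cases ?_ (fun j => ?_) i
      · simpa using hy.2
      · simpa using hy.1 j
    · simp [Fin.sum_univ_succ]
    · rw [Fin.sum_univ_succ, chart_eq_sum]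
      simp
  · rintro ⟨w, h0, h1, rfl⟩
    rw [Fin.sum_univ_succ] at h1
    refine ⟨fun j => w j.succ, ⟨fun j => h0 _, ?_⟩, ?_⟩
    · have := h0 0
      linarith
    · rw [chart_eq_sum, Fin.sum_univ_succ, ← h1, add_sub_cancel_right]

/-- Pulling back a polynomial by the parametrization of a simplex. -/
noncomputable def pull (a : Fin (d + 1) → E3) : Pol →ₐ[ℝ] MvPolynomial (Fin d) ℝ :=
  aeval fun i => affForm (fun j => edgeVec a j i) ((a 0).ofLp i)

theorem eval_pull (a : Fin (d + 1) → E3) (x : Fin d → ℝ) (p : Pol) :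
    eval x (pull a p) = eval (chart a x).ofLp p := by
  rw [pull, eval_aeval]
  congr 2
  ext i
  rw [eval_affForm, chart_ofLp]
  simp [dotProduct, mul_comm, add_comm]

theorem totalDegree_pull_le (a : Fin (d + 1) → E3) (p : Pol) :
    (pull a p).totalDegree ≤ p.totalDegree :=
  totalDegree_aeval_le _ (fun _ => totalDegree_affForm_le _ _) p

/-- The derivative of a polynomial in a constant direction. -/
noncomputable def dirPol (v : V3) (p : Pol) : Pol := ∑ i, C (v i) * pderiv i p

theorem pderiv_pull (a : Fin (d + 1) → E3) (j : Fin d) (p : Pol) :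
    pderiv j (pull a p) = pull a (dirPol (edgeVec a j) p) := by
  rw [pull, pderiv_aeval, dirPol, map_sum]
  refine Finset.sum_congr rfl fun i _ => ?_
  rw [pderiv_affForm, map_mul, mul_comm, aeval_C, algebraMap_eq]

theorem linearIndependent_edgeVec {a : Fin (d + 1) → E3} (ha : AffineIndependent ℝ a) :
    LinearIndependent ℝ (edgeVec a) := by
  rw [affineIndependent_iff_linearIndependent_vsub ℝ a 0] at ha
  have h1 := ha.comp (fun j : Fin d => (⟨j.succ, Fin.succ_ne_zero j⟩ : {x : Fin (d + 1) // x ≠ 0}))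
    (fun i j h => Fin.succ_injective _ (congr_arg Subtype.val h))
  exact h1.map' (WithLp.linearEquiv 2 ℝ (Fin 3 → ℝ)).toLinearMap (LinearEquiv.ker _)

/-- Vectors dual to the edge vectors of a nondegenerate simplex. -/
theorem exists_dual_edgeVec {a : Fin (d + 1) → E3} (ha : AffineIndependent ℝ a) :
    ∃ w : Fin d → V3, ∀ i j, w i ⬝ᵥ edgeVec a j = if i = j then 1 else 0 := by
  classical
  have h := linearIndependent_edgeVec ha
  obtain ⟨g, hg⟩ := LinearMap.exists_leftInverse_of_injective
    (Fintype.linearCombination ℝ (edgeVec a)) (LinearMap.ker_eq_bot.2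
      (linearIndependent_iff_injective_fintypeLinearCombination.1 h))
  refine ⟨fun i k => g (Pi.single k 1) i, fun i j => ?_⟩
  have h1 := congr_fun (LinearMap.congr_fun hg (Pi.single j 1)) i
  simp only [LinearMap.comp_apply, Fintype.linearCombination_apply_single, one_smul,
    LinearMap.id_apply, Pi.single_apply] at h1
  rw [← h1, LinearMap.pi_apply_eq_sum_univ g (edgeVec a j)]
  simp only [dotProduct, Finset.sum_apply, Pi.smul_apply, smul_eq_mul]
  refine Finset.sum_congr rfl fun k _ => ?_
  have h2 : (fun j => if k = j then 1 else 0 : Fin 3 → ℝ) = Pi.single k 1 := by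
    ext l; simp [Pi.single_apply, eq_comm]
  rw [h2, mul_comm]

theorem chart_injective {a : Fin (d + 1) → E3} (ha : AffineIndependent ℝ a) :
    Function.Injective (chart a) := by
  intro x y h
  have h1 := congr_arg WithLp.ofLp h
  rw [chart_ofLp, chart_ofLp, add_right_inj] at h1
  exact linearIndependent_iff_injective_fintypeLinearCombination.1 (linearIndependent_edgeVec ha)
    (by simpa [Fintype.linearCombination_apply] using h1)

/-- A linear extension of polynomials on the reference simplex to polynomials on the space. -/
theorem exists_liftHom {a : Fin (d + 1) → E3} (ha : AffineIndependent ℝ a) :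
    ∃ L : MvPolynomial (Fin d) ℝ →ₐ[ℝ] Pol,
      ∀ q, (L q).totalDegree ≤ q.totalDegree ∧ pull a (L q) = q := by
  obtain ⟨w, hw⟩ := exists_dual_edgeVec ha
  -- The affine functions wᵢ · (x − a₀) extend the chart coordinates from the simplex to the whole
  -- space.
  refine ⟨aeval fun i => affForm (w i) (-(w i ⬝ᵥ (a 0).ofLp)), fun q =>
    ⟨totalDegree_aeval_le _ (fun _ => totalDegree_affForm_le _ _) q, ?_⟩⟩
  refine MvPolynomial.funext fun x => ?_
  rw [eval_pull, eval_aeval]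
  congr 2
  ext i
  rw [eval_affForm, chart_ofLp, dotProduct_add, dotProduct_sum]
  simp [hw]

theorem exists_lift {a : Fin (d + 1) → E3} (ha : AffineIndependent ℝ a)
    (q : MvPolynomial (Fin d) ℝ) :
    ∃ p : Pol, p.totalDegree ≤ q.totalDegree ∧ pull a p = q := by
  obtain ⟨L, hL⟩ := exists_liftHom ha
  exact ⟨L q, hL q⟩

/-- The volume factor of the parametrization of a simplex. -/
noncomputable def chartVol (a : Fin (d + 1) → E3) : ℝ :=
  Real.sqrt (Matrix.of fun i j => edgeVec a i ⬝ᵥ edgeVec a j).det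

/-- The chart is a translate of a linear map, which scales d-dimensional measure by the square root
of its Gram determinant. -/
theorem euclideanHausdorffMeasure_image_chart (a : Fin (d + 1) → E3) (s : Set (Fin d → ℝ)) :
    (μHE[d] : Measure E3) (chart a '' s) = ENNReal.ofReal (chartVol a) * volume s := by
  set f : EuclideanSpace ℝ (Fin d) →ₗ[ℝ] E3 :=
    (Fintype.linearCombination ℝ fun j => a j.succ - a 0) ∘ₗ
      (WithLp.linearEquiv 2 ℝ (Fin d → ℝ)).toLinearMap with hf
  have h1 : chart a '' s = (fun v => a 0 + v) '' (f '' (WithLp.toLp 2 '' s)) := by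
    rw [Set.image_image, Set.image_image]
    refine Set.image_congr fun x _ => ?_
    simp [chart, hf, Fintype.linearCombination_apply]
  have h2 : f.normDet = chartVol a := by
    have h3 := f.normDet_sq_eq_det_gram (EuclideanSpace.basisFun (Fin d) ℝ)
    have h4 : (Matrix.of fun i j => edgeVec a i ⬝ᵥ edgeVec a j).det = f.normDet ^ 2 := by
      simp only [RCLike.ofReal_real_eq_id, id_eq] at h3
      rw [h3]
      congr 1
      ext i j
      simp [Matrix.gram, hf, edgeVec, EuclideanSpace.inner_eq_star_dotProduct, dotProduct_comm]
    rw [chartVol, h4, Real.sqrt_sq f.normDet_nonneg]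
  have h4 := f.euclideanHausdorffMeasure_image_eq_normDet_mul_volume (WithLp.toLp 2 '' s)
  rw [finrank_euclideanSpace_fin] at h4
  rw [h1, (isometry_add_left (a 0)).euclideanHausdorffMeasure_image, h4, h2]
  congr 1
  have h5 := (EuclideanSpace.volume_preserving_symm_measurableEquiv_toLp (Fin d)).symm
  rw [← h5.measure_preimage_equiv]
  congr 1
  exact Set.preimage_image_eq _ (WithLp.toLp_injective 2)

end Charts

/-! ### Pointwise algebra of the traces -/

section PointwiseAlgebra

theorem cross_eq (u v : V3) :
    u ⨯₃ v = ![u 1 * v 2 - u 2 * v 1, u 2 * v 0 - u 0 * v 2, u 0 * v 1 - u 1 * v 0] :=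
  cross_apply u v

theorem dot_eq (u v : V3) : u ⬝ᵥ v = u 0 * v 0 + u 1 * v 1 + u 2 * v 2 := by
  simp [dotProduct, Fin.sum_univ_three]

theorem dot_mulVec_eq (u v : V3) (A : M3) : u ⬝ᵥ (A *ᵥ v) =
    u 0 * (A 0 0 * v 0 + A 0 1 * v 1 + A 0 2 * v 2) +
    u 1 * (A 1 0 * v 0 + A 1 1 * v 1 + A 1 2 * v 2) +
    u 2 * (A 2 0 * v 0 + A 2 1 * v 1 + A 2 2 * v 2) := by
  simp [mulVec, dotProduct, Fin.sum_univ_three]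

theorem cross_cross_left (n u x : V3) : (u ⨯₃ n) ⨯₃ x = (u ⬝ᵥ x) • n - (n ⬝ᵥ x) • u := by
  ext i
  fin_cases i <;> simp [cross_eq, dot_eq] <;> ring

theorem cross_cross_unit {n u : V3} (hn : n ⬝ᵥ n = 1) (hu : n ⬝ᵥ u = 0) :
    n ⨯₃ (n ⨯₃ u) = -u := by
  have h : n ⨯₃ (n ⨯₃ u) = (n ⬝ᵥ u) • n - (n ⬝ᵥ n) • u := by
    ext i
    fin_cases i <;> simp [cross_eq, dot_eq] <;> ring
  rw [h, hn, hu]; simp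

theorem dot_crossRight_crossLeft (n u v : V3) (A : M3) :
    u ⬝ᵥ (crossRight (crossLeft n A) n *ᵥ v) = -((n ⨯₃ u) ⬝ᵥ (A *ᵥ (n ⨯₃ v))) := by
  simp only [dot_mulVec_eq, crossRight, crossLeft, cross_eq, of_apply]
  simp
  ring

theorem dot_sym_crossRight (n u v : V3) (M : M3) :
    u ⬝ᵥ (sym (crossRight M n) *ᵥ v) =
      1 / 2 * (u ⬝ᵥ (M *ᵥ (n ⨯₃ v)) + v ⬝ᵥ (M *ᵥ (n ⨯₃ u))) := by
  simp only [dot_mulVec_eq, crossRight, sym, cross_eq]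
  simp
  ring

/-- On tangent vectors a double rotation by n is −1, so the outer products in the trace undo one
another and only a symmetrised tangential form of M remains. This gives the planar tensor components
in any tangent basis. -/
theorem dot_tr₁perp {n u v : V3} (hn : n ⬝ᵥ n = 1) (hu : n ⬝ᵥ u = 0) (hv : n ⬝ᵥ v = 0) (M : M3) :
    u ⬝ᵥ (tr₁perp n M *ᵥ v) =
      1 / 2 * ((n ⨯₃ u) ⬝ᵥ (M *ᵥ v) + (n ⨯₃ v) ⬝ᵥ (M *ᵥ u)) := by
  rw [tr₁perp, dot_crossRight_crossLeft, dot_sym_crossRight, cross_cross_unit hn hu,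
    cross_cross_unit hn hv]
  simp [mulVec_neg]
  ring

theorem tr₁perp_isSymm (n : V3) (M : M3) : (tr₁perp n M).IsSymm := by
  ext i j
  fin_cases i <;> fin_cases j <;>
    simp [tr₁perp, crossRight, crossLeft, sym, cross_eq] <;> ring

theorem frob_vecMulVec (A : M3) (u v : V3) : frob A (vecMulVec u v) = u ⬝ᵥ (A *ᵥ v) := by
  simp [frob, dot_mulVec_eq, vecMulVec, Fin.sum_univ_three]
  ring

theorem frob_add (A B C : M3) : frob A (B + C) = frob A B + frob A C := by
  simp [frob, Fin.sum_univ_three]; ring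

theorem frob_smul (A B : M3) (c : ℝ) : frob A (c • B) = c * frob A B := by
  simp [frob, Fin.sum_univ_three]; ring

theorem frob_add_left (A B C : M3) : frob (A + B) C = frob A C + frob B C := by
  simp [frob, Fin.sum_univ_three]; ring

theorem frob_smul_left (A B : M3) (c : ℝ) : frob (c • A) B = c * frob A B := by
  simp [frob, Fin.sum_univ_three]; ring

theorem dot_mulVec_comm_of_isSymm {A : M3} (hA : A.IsSymm) (u v : V3) :
    u ⬝ᵥ (A *ᵥ v) = v ⬝ᵥ (A *ᵥ u) := by
  rw [dotProduct_mulVec, ← mulVec_transpose, hA.eq, dotProduct_comm]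

theorem frob_tr₁perp_sym_vecMulVec (n x v : V3) (M : M3) :
    frob (tr₁perp n M) (sym (vecMulVec x v)) = x ⬝ᵥ (tr₁perp n M *ᵥ v) := by
  rw [sym, frob_smul, frob_add, transpose_vecMulVec, frob_vecMulVec, frob_vecMulVec,
    dot_mulVec_comm_of_isSymm (tr₁perp_isSymm n M) v x]
  ring

/-- The second order surface operator `(n × ∇)(n × ∇)ᵀ` applied to a Hessian. -/
def surfHess (n : V3) (H : M3) : M3 :=
  Matrix.of fun i j => (n ⨯₃ fun k => (n ⨯₃ fun l => H k l) j) i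

/-- The identity (u × w) × g = (u · g)w − (w · g)u is applied in each index. -/
theorem surfHess_cross (u w : V3) (H : M3) :
    surfHess (u ⨯₃ w) H = (u ⬝ᵥ (H *ᵥ u)) • vecMulVec w w - (u ⬝ᵥ (H *ᵥ w)) • vecMulVec w u -
      (w ⬝ᵥ (H *ᵥ u)) • vecMulVec u w + (w ⬝ᵥ (H *ᵥ w)) • vecMulVec u u := by
  ext i j
  simp only [surfHess, dot_mulVec_eq, cross_eq, of_apply]
  fin_cases i <;> fin_cases j <;> simp [vecMulVec] <;> ring

theorem surfHess_smul (c : ℝ) (n : V3) (H : M3) :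
    surfHess (c • n) H = (c * c) • surfHess n H := by
  ext i j
  simp only [surfHess, cross_eq, of_apply]
  fin_cases i <;> fin_cases j <;> simp <;> ring

/-- The factor c² appears because the operator is quadratic in the normal and c n = u × w. The right
side is the integrand of `TensorBoundary.refInt_hess` in the basis u, w. -/
theorem frob_tr₁perp_surfHess {n u w : V3} {c : ℝ} (huw : u ⨯₃ w = c • n) {H : M3} (hH : H.IsSymm)
    (M : M3) : c * c * frob (tr₁perp n M) (surfHess n H) =
      u ⬝ᵥ (tr₁perp n M *ᵥ u) * (w ⬝ᵥ (H *ᵥ w)) -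
      2 * (u ⬝ᵥ (tr₁perp n M *ᵥ w)) * (u ⬝ᵥ (H *ᵥ w)) +
      w ⬝ᵥ (tr₁perp n M *ᵥ w) * (u ⬝ᵥ (H *ᵥ u)) := by
  rw [← frob_smul, ← surfHess_smul, ← huw, surfHess_cross, sub_eq_add_neg, sub_eq_add_neg,
    ← neg_smul, ← neg_smul, frob_add, frob_add, frob_add, frob_smul, frob_smul, frob_smul,
    frob_smul, frob_vecMulVec, frob_vecMulVec, frob_vecMulVec, frob_vecMulVec,
    dot_mulVec_comm_of_isSymm (tr₁perp_isSymm n M) w u, dot_mulVec_comm_of_isSymm hH w u]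
  ring

theorem tr₂_dot_cross {n x : V3} (hn : n ⬝ᵥ n = 1) (hx : n ⬝ᵥ x = 0) (M : M3) :
    tr₂ n M ⬝ᵥ (x ⨯₃ n) = n ⬝ᵥ (M *ᵥ x) := by
  rw [tr₂, cross_dot_cross, hn, dotProduct_mulVec, hx]
  ring

/-- Both vectors on the left are rotated by n; undoing the rotation pairs the row n · M with n × g,
and c(n × g) = (u × w) × g expands in the basis u, w. -/
theorem tr₂_dot_surfGrad {n u w : V3} {c : ℝ} (hn : n ⬝ᵥ n = 1) (huw : u ⨯₃ w = c • n) (M : M3)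
    (g : V3) : c * (tr₂ n M ⬝ᵥ ((n ⨯₃ g) ⨯₃ n)) =
      n ⬝ᵥ (M *ᵥ w) * (u ⬝ᵥ g) - n ⬝ᵥ (M *ᵥ u) * (w ⬝ᵥ g) := by
  have h : c • (n ⨯₃ g) = (u ⬝ᵥ g) • w - (w ⬝ᵥ g) • u := by
    rw [← cross_cross_left, huw]; simp
  rw [tr₂_dot_cross hn (by simp), ← smul_eq_mul, ← dotProduct_smul, ← mulVec_smul, h, mulVec_sub,
    dotProduct_sub, mulVec_smul, mulVec_smul, dotProduct_smul, dotProduct_smul, smul_eq_mul,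
    smul_eq_mul]
  ring

theorem tr₂_eq_zero {n u w : V3} {c : ℝ} (hc : c ≠ 0) (huw : u ⨯₃ w = c • n) {M : M3}
    (hu : n ⬝ᵥ (M *ᵥ u) = 0) (hw : n ⬝ᵥ (M *ᵥ w) = 0) : tr₂ n M = 0 := by
  rw [dotProduct_mulVec] at hu hw
  have h : c • tr₂ n M = (n ᵥ* M ⬝ᵥ w) • u - (n ᵥ* M ⬝ᵥ u) • w := by
    have h1 : ∀ r : V3, r ⨯₃ (u ⨯₃ w) = (r ⬝ᵥ w) • u - (r ⬝ᵥ u) • w := fun r => by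
      ext i
      fin_cases i <;> simp [cross_eq, dot_eq] <;> ring
    rw [tr₂, ← h1, huw]; simp
  rw [hu, hw, zero_smul, zero_smul, sub_zero] at h
  exact (smul_eq_zero.1 h).resolve_left hc

theorem eq_zero_of_dot_mulVec {A : M3} (h : ∀ u v : V3, u ⬝ᵥ (A *ᵥ v) = 0) : A = 0 := by
  ext i j
  have := h (Pi.single i 1) (Pi.single j 1)
  simpa using this

/-- The trace sees vectors only through their projection −n × (n × y) onto the tangent plane, which
u and w span. -/
theorem tr₁perp_eq_zero {n u w : V3} {c : ℝ} (hn : n ⬝ᵥ n = 1) (hc : c ≠ 0)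
    (huw : u ⨯₃ w = c • n) {M : M3} (huu : u ⬝ᵥ (tr₁perp n M *ᵥ u) = 0)
    (h_uw : u ⬝ᵥ (tr₁perp n M *ᵥ w) = 0) (hww : w ⬝ᵥ (tr₁perp n M *ᵥ w) = 0) :
    tr₁perp n M = 0 := by
  have hwu : w ⬝ᵥ (tr₁perp n M *ᵥ u) = 0 := by
    rw [dot_mulVec_comm_of_isSymm (tr₁perp_isSymm n M), h_uw]
  have h1 : ∀ y, c • (n ⨯₃ (n ⨯₃ y)) = (u ⬝ᵥ (n ⨯₃ y)) • w - (w ⬝ᵥ (n ⨯₃ y)) • u := fun y => by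
    rw [← cross_cross_left, huw]; simp
  refine eq_zero_of_dot_mulVec fun y z => ?_
  have h2 : y ⬝ᵥ (tr₁perp n M *ᵥ z) =
      (n ⨯₃ (n ⨯₃ y)) ⬝ᵥ (tr₁perp n M *ᵥ (n ⨯₃ (n ⨯₃ z))) := by
    rw [tr₁perp, dot_crossRight_crossLeft, dot_crossRight_crossLeft,
      cross_cross_unit hn (u := n ⨯₃ y) (by simp), cross_cross_unit hn (u := n ⨯₃ z) (by simp)]
    simp only [mulVec_neg, neg_dotProduct, dotProduct_neg, neg_neg]
  have h3 : (c • (n ⨯₃ (n ⨯₃ y))) ⬝ᵥ (tr₁perp n M *ᵥ (c • (n ⨯₃ (n ⨯₃ z)))) = 0 := by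
    rw [h1, h1]
    simp only [mulVec_sub, mulVec_smul, dotProduct_sub, sub_dotProduct, smul_dotProduct,
      dotProduct_smul, huu, h_uw, hww, hwu]
    simp
  rw [h2]
  rw [mulVec_smul, smul_dotProduct, dotProduct_smul, smul_smul] at h3
  exact (smul_eq_zero.1 h3).resolve_left (mul_ne_zero hc hc)

/-- The curl of a tensor field in terms of its partial derivatives `D k`. -/
def curlOf (D : Fin 3 → M3) : M3 :=
  Matrix.of fun i => ![D 1 i 2 - D 2 i 1, D 2 i 0 - D 0 i 2, D 0 i 1 - D 1 i 0]

/-- Contracted with u × w, the curl is an antisymmetrised directional derivative. This makes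
arbitrary edge vectors usable in place of orthonormal frames. -/
theorem dot_curlOf_cross (D : Fin 3 → M3) (a u w : V3) :
    a ⬝ᵥ (curlOf D *ᵥ (u ⨯₃ w)) =
      a ⬝ᵥ ((∑ k, u k • D k) *ᵥ w) - a ⬝ᵥ ((∑ k, w k • D k) *ᵥ u) := by
  simp only [dot_mulVec_eq, curlOf, cross_eq, of_apply, Fin.sum_univ_three]
  simp
  ring

theorem dot_sym (A : M3) (u v : V3) :
    u ⬝ᵥ (sym A *ᵥ v) = 1 / 2 * (u ⬝ᵥ (A *ᵥ v) + v ⬝ᵥ (A *ᵥ u)) := by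
  simp only [dot_mulVec_eq, sym]
  simp
  ring

theorem eq_add_of_orthonormal {t n₁ n₂ w : V3} (ht : t ⬝ᵥ t = 1) (h₁ : n₁ ⬝ᵥ n₁ = 1)
    (h₁t : n₁ ⬝ᵥ t = 0) (h₂ : n₂ = t ⨯₃ n₁) (hw : w ⬝ᵥ t = 0) :
    w = (w ⬝ᵥ n₁) • n₁ + (w ⬝ᵥ n₂) • n₂ := by
  have h : n₁ ⨯₃ n₂ = t := by
    have : n₁ ⨯₃ (t ⨯₃ n₁) = (n₁ ⬝ᵥ n₁) • t - (n₁ ⬝ᵥ t) • n₁ := by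
      ext i
      fin_cases i <;> simp [cross_eq, dot_eq] <;> ring
    rw [h₂, this, h₁, h₁t]; simp
  have h3 : n₂ ⨯₃ t = n₁ := by
    have : (t ⨯₃ n₁) ⨯₃ t = (t ⬝ᵥ t) • n₁ - (n₁ ⬝ᵥ t) • t := by
      ext i
      fin_cases i <;> simp [cross_eq, dot_eq] <;> ring
    rw [h₂, this, ht, h₁t]; simp
  have h4 : (t ⬝ᵥ (n₁ ⨯₃ n₂)) • w = (w ⬝ᵥ t) • (n₁ ⨯₃ n₂) + (w ⬝ᵥ n₁) • (n₂ ⨯₃ t) +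
      (w ⬝ᵥ n₂) • (t ⨯₃ n₁) := by
    ext i
    simp only [dot_eq, cross_eq]
    fin_cases i <;> simp <;> ring
  rw [h, h3, ← h₂, ht, hw] at h4
  simpa using h4

end PointwiseAlgebra

/-! ### Ordered simplices and integration over them -/

section Simplices

open MvPolynomial

variable {d : ℕ}

/-- `a` lists the vertices of the nondegenerate simplex with vertex set `s`. -/
def Orders (a : Fin (d + 1) → E3) (s : Finset E3) : Prop :=
  AffineIndependent ℝ a ∧ (s : Set E3) = Set.range a

theorem exists_orders {s : Finset E3} (hs : s.card = d + 1)
    (h : AffineIndependent ℝ ((↑) : s → E3)) : ∃ a : Fin (d + 1) → E3, Orders a s := by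
  set e : Fin (d + 1) ≃ s := (Fintype.equivFinOfCardEq (by simpa using hs)).symm
  refine ⟨fun i => e i, h.comp_embedding e.toEmbedding, ?_⟩
  ext x
  constructor
  · intro hx
    exact ⟨e.symm ⟨x, hx⟩, by simp⟩
  · rintro ⟨i, rfl⟩
    exact (e i).2

theorem affineIndependent_subset {s t : Finset E3} (h : AffineIndependent ℝ ((↑) : s → E3))
    (hts : t ⊆ s) : AffineIndependent ℝ ((↑) : t → E3) :=
  h.comp_embedding (Function.Embedding.subtypeMap (Function.Embedding.refl E3) hts)

variable {a : Fin (d + 1) → E3} {s : Finset E3}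

theorem Orders.hull_eq (h : Orders a s) : hull s = chart a '' refSimplex d := by
  rw [image_chart_refSimplex, ← h.2]

theorem Orders.mem (h : Orders a s) (i : Fin (d + 1)) : a i ∈ s := by
  rw [← Finset.mem_coe, h.2]
  exact ⟨i, rfl⟩

theorem isCompact_hull (s : Finset E3) : IsCompact (hull s) := s.finite_toSet.isCompact_convexHull ℝ

theorem measurableSet_hull (s : Finset E3) : MeasurableSet (hull s) :=
  (isCompact_hull s).isClosed.measurableSet

theorem chartVol_nonneg (a : Fin (d + 1) → E3) : 0 ≤ chartVol a := Real.sqrt_nonneg _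

/-- A kernel vector of the Gram matrix would be a vanishing combination of the independent edge
vectors. -/
theorem chartVol_pos (ha : AffineIndependent ℝ a) : 0 < chartVol a := by
  refine Real.sqrt_pos.2 (lt_of_le_of_ne ?_ ?_)
  · have h : (Matrix.of fun i j => edgeVec a i ⬝ᵥ edgeVec a j) =
        (Matrix.of fun i k => edgeVec a i k) * (Matrix.of fun i k => edgeVec a i k)ᴴ := by
      ext i j
      simp [Matrix.mul_apply, dotProduct]
    rw [h]
    exact (Matrix.posSemidef_self_mul_conjTranspose _).det_nonneg
  · intro h0
    obtain ⟨v, hv, hv2⟩ := Matrix.exists_mulVec_eq_zero_iff.2 h0.symm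
    have h1 : (∑ j, v j • edgeVec a j) ⬝ᵥ (∑ j, v j • edgeVec a j) = 0 := by
      have h2 : v ⬝ᵥ ((Matrix.of fun i j => edgeVec a i ⬝ᵥ edgeVec a j) *ᵥ v) = 0 := by
        rw [hv2, dotProduct_zero]
      rw [← h2, sum_dotProduct]
      simp only [dotProduct_sum, smul_dotProduct, dotProduct_smul, smul_eq_mul]
      refine Finset.sum_congr rfl fun i _ => ?_
      rw [mulVec, dotProduct, Finset.mul_sum]
      exact Finset.sum_congr rfl fun j _ => by rw [of_apply]; ring
    have h3 := dotProduct_self_eq_zero.1 h1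
    exact hv (funext (Fintype.linearIndependent_iff.1 (linearIndependent_edgeVec ha) v h3))

/-- Integrals over a simplex in terms of its parametrization. -/
theorem Orders.integral_eq (h : Orders a s) (f : E3 → ℝ) :
    ∫ x in hull s, f x ∂(μHE[d] : Measure E3) =
      chartVol a * ∫ y in refSimplex d, f (chart a y) := by
  have he : MeasurableEmbedding (chart a) :=
    (continuous_chart a).measurableEmbedding (chart_injective h.1)
  have h1 : (μHE[d] : Measure E3).comap (chart a) = ENNReal.ofReal (chartVol a) • volume := by
    ext s _
    rw [he.comap_apply, euclideanHausdorffMeasure_image_chart]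
    rfl
  have h2 : (μHE[d] : Measure E3).restrict (hull s) =
      (((μHE[d] : Measure E3).comap (chart a)).map (chart a)).restrict (hull s) := by
    rw [he.map_comap, Measure.restrict_restrict (measurableSet_hull s), Set.inter_eq_left.2]
    rw [h.hull_eq]
    exact Set.image_subset_range _ _
  rw [h2, he.setIntegral_map, h1, h.hull_eq, Set.preimage_image_eq _ (chart_injective h.1),
    Measure.restrict_smul, integral_smul_measure, ENNReal.toReal_ofReal (chartVol_nonneg a),
    smul_eq_mul]

theorem Orders.integral_pol (h : Orders a s) (p : Pol) :
    ∫ x in hull s, eval x.ofLp p ∂(μHE[d] : Measure E3) = chartVol a * refInt d (pull a p) := by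
  rw [h.integral_eq, refInt_apply]
  simp only [eval_pull]

theorem integral_lengthOn (e : Finset E3) (f : E3 → ℝ) :
    ∫ x, f x.1 ∂(lengthOn e) = ∫ x in hull e, f x ∂(μHE[1] : Measure E3) :=
  integral_subtype_comap (measurableSet_hull e) f

theorem integral_areaOn (F : Finset E3) (f : E3 → ℝ) :
    ∫ x, f x.1 ∂(areaOn F) = ∫ x in hull F, f x ∂(μHE[2] : Measure E3) :=
  integral_subtype_comap (measurableSet_hull F) f

/-- The generators already form a subspace, so taking the span adds nothing. -/
theorem mem_polyOn_iff {k : ℕ} {s : Finset E3} {q : hull s → ℝ} :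
    q ∈ polyOn k s ↔ ∃ p : Pol, p.totalDegree ≤ k ∧ q = fun x => eval x.1.ofLp p := by
  constructor
  · intro h
    induction h using Submodule.span_induction with
    | mem q hq =>
      obtain ⟨p, hp, rfl⟩ := hq
      exact ⟨p, (mem_restrictTotalDegree _ _ _).1 hp, rfl⟩
    | zero => exact ⟨0, by simp, by ext; simp⟩
    | add q r _ _ hq hr =>
      obtain ⟨p, hp, rfl⟩ := hq
      obtain ⟨p', hp', rfl⟩ := hr
      exact ⟨p + p', totalDegree_add_le hp hp', by ext; simp⟩
    | smul c q _ hq =>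
      obtain ⟨p, hp, rfl⟩ := hq
      exact ⟨c • p, totalDegree_smul_le_of_le c hp, by ext; simp⟩
  · rintro ⟨p, hp, rfl⟩
    exact Submodule.subset_span ⟨p, (mem_restrictTotalDegree _ _ _).2 hp, rfl⟩

end Simplices

/-! ### Derivatives and degrees of tensor-valued polynomials -/

section TensorPolynomials

open MvPolynomial

/-- The polynomial `aᵀ A b` for constant vectors `a`, `b`. -/
noncomputable def bil (a b : V3) (A : PolM) : Pol := ∑ i, ∑ j, C (a i * b j) * A i j

theorem eval_bil (a b : V3) (A : PolM) (x : E3) :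
    eval x.ofLp (bil a b A) = a ⬝ᵥ (val A x *ᵥ b) := by
  simp only [bil, map_sum, map_mul, eval_C, dotProduct, mulVec, val, map_apply, Finset.mul_sum]
  exact Finset.sum_congr rfl fun i _ => Finset.sum_congr rfl fun j _ => by ring

theorem totalDegree_bil_le (a b : V3) {A : PolM} {k : ℕ} (hA : ∀ i j, (A i j).totalDegree ≤ k) :
    (bil a b A).totalDegree ≤ k :=
  totalDegree_sum_le fun i _ => totalDegree_sum_le fun j _ => totalDegree_C_mul_le _ (hA i j)

/-- The partial derivative of a tensor-valued polynomial. -/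
noncomputable def pd (k : Fin 3) (A : PolM) : PolM := A.map (pderiv k)

theorem val_polCurl (A : PolM) (x : E3) : val (polCurl A) x = curlOf fun k => val (pd k A) x := by
  ext i j
  fin_cases j <;> simp [val, polCurl, curl, curlOf, pd]

theorem val_dirDeriv (t : V3) (A : PolM) (x : E3) :
    val (dirDeriv t A) x = ∑ k, t k • val (pd k A) x := by
  ext i j
  simp [val, dirDeriv, pd, Matrix.sum_apply]

theorem val_symCurl (A : PolM) (x : E3) : val (symCurl A) x = sym (val (polCurl A) x) := by
  ext i j
  simp [val, symCurl, sym]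
  ring

theorem dirPol_bil (u a b : V3) (A : PolM) : dirPol u (bil a b A) = bil a b (dirDeriv u A) := by
  simp only [dirPol, bil, dirDeriv, map_sum, pderiv_C_mul, of_apply, Finset.mul_sum, smul_eq_C_mul]
  rw [Finset.sum_comm]
  refine Finset.sum_congr rfl fun i _ => ?_
  rw [Finset.sum_comm]
  exact Finset.sum_congr rfl fun j _ => Finset.sum_congr rfl fun k _ => by ring

theorem mem_polyT_iff {k : ℕ} {A : PolM} :
    A ∈ polyT k ↔ A.trace = 0 ∧ ∀ i j, (A i j).totalDegree ≤ k := by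
  simp only [← mem_restrictTotalDegree]
  rfl

theorem totalDegree_polCurl_le {A : PolM} {k : ℕ} (hA : ∀ i j, (A i j).totalDegree ≤ k + 1)
    (i j : Fin 3) : (polCurl A i j).totalDegree ≤ k := by
  fin_cases j <;> exact totalDegree_sub_le (totalDegree_pderiv_le_of_le (hA _ _))
    (totalDegree_pderiv_le_of_le (hA _ _))

theorem totalDegree_symCurl_le {A : PolM} {k : ℕ} (hA : ∀ i j, (A i j).totalDegree ≤ k + 1)
    (i j : Fin 3) : (symCurl A i j).totalDegree ≤ k :=
  totalDegree_smul_le_of_le _ (totalDegree_add_le (totalDegree_polCurl_le hA i j)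
    (totalDegree_polCurl_le hA j i))

theorem totalDegree_dirDeriv_le (t : V3) {A : PolM} {k : ℕ}
    (hA : ∀ i j, (A i j).totalDegree ≤ k + 1) (i j : Fin 3) :
    (dirDeriv t A i j).totalDegree ≤ k := by
  rw [dirDeriv, of_apply]
  exact totalDegree_sum_le fun l _ =>
    totalDegree_smul_le_of_le _ (totalDegree_pderiv_le_of_le (hA i j))

theorem val_sub (A B : PolM) (x : E3) : val (A - B) x = val A x - val B x := by
  ext i j; simp [val]

theorem polCurl_sub (A B : PolM) : polCurl (A - B) = polCurl A - polCurl B := by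
  ext1 i j
  fin_cases j <;> simp [polCurl, curl] <;> ring

theorem symCurl_sub (A B : PolM) : symCurl (A - B) = symCurl A - symCurl B := by
  rw [symCurl, polCurl_sub, symCurl, symCurl, sym, sym, sym, transpose_sub, ← smul_sub]
  congr 1
  abel

end TensorPolynomials

/-! ### Vanishing of traces along an edge -/

section EdgeTraces

open MvPolynomial

/-- The moments of `τ` on the edge `e` vanish. -/
structure EdgeMomentsVanish (fr : Frame) (ℓ : ℕ) (τ : PolM) (e : Finset E3) : Prop where
  nn : ∀ i j, ∀ q ∈ polyOn (ℓ - 2) e, edgeDofNN fr τ e i j q = 0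
  nt : ∀ i, ∀ q ∈ polyOn (ℓ - 1) e, edgeDofNT fr τ e i q = 0
  curl : ∀ q ∈ polyOn ℓ e, edgeDofCurl fr τ e q = 0

/-- The conditions on the traces of `τ` on the line through the edge with endpoints `b`. -/
structure EdgeTracesVanish (τ : PolM) (b : Fin 2 → E3) : Prop where
  nt : ∀ y w, w ⬝ᵥ edgeVec b 0 = 0 → w ⬝ᵥ (val τ (chart b y) *ᵥ edgeVec b 0) = 0
  nn : ∀ y w, w ⬝ᵥ edgeVec b 0 = 0 → w ⬝ᵥ (val (polCurl τ) (chart b y) *ᵥ w) = 0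
  curl : ∀ y w, w ⬝ᵥ edgeVec b 0 = 0 →
    (edgeVec b 0 ⨯₃ w) ⬝ᵥ (val (polCurl τ) (chart b y) *ᵥ w) * (edgeVec b 0 ⬝ᵥ edgeVec b 0) +
      (w ⬝ᵥ w) * edgeVec b 0 ⬝ᵥ (val (dirDeriv (edgeVec b 0) τ) (chart b y) *ᵥ edgeVec b 0) = 0
  nt_deriv : ∀ y w, w ⬝ᵥ edgeVec b 0 = 0 →
    w ⬝ᵥ (val (dirDeriv (edgeVec b 0) τ) (chart b y) *ᵥ edgeVec b 0) = 0

variable {b : Fin 2 → E3} {e : Finset E3}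

theorem chart_zero (b : Fin 2 → E3) : chart b ![0] = b 0 := by simp [chart]

theorem chart_one (b : Fin 2 → E3) : chart b ![1] = b 1 := by simp [chart]

theorem Orders.refInt_eq_zero (h : Orders b e) {k : ℕ} {p : Pol}
    (hm : ∀ q ∈ polyOn k e, ∫ x, eval x.1.ofLp p * q x ∂(lengthOn e) = 0)
    (q : MvPolynomial (Fin 1) ℝ) (hq : q.totalDegree ≤ k) : refInt 1 (pull b p * q) = 0 := by
  obtain ⟨q', hq', rfl⟩ := exists_lift h.1 q
  have h1 := hm _ (mem_polyOn_iff.2 ⟨q', hq'.trans hq, rfl⟩)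
  have h2 := integral_lengthOn e fun x => eval x.ofLp p * eval x.ofLp q'
  rw [h2] at h1
  have h3 := h.integral_pol (p * q')
  simp only [map_mul] at h3
  rw [h1] at h3
  exact ((mul_eq_zero.1 h3.symm).resolve_left (chartVol_pos h.1).ne')

theorem Orders.pull_eq_zero (h : Orders b e) {k : ℕ} {p : Pol} (hp : p.totalDegree ≤ k)
    (hm : ∀ q ∈ polyOn k e, ∫ x, eval x.1.ofLp p * q x ∂(lengthOn e) = 0) : pull b p = 0 :=
  eq_zero_of_refInt_mul ((totalDegree_pull_le b p).trans hp) (h.refInt_eq_zero hm)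

theorem Orders.pull_eq_zero_of_endpoints (h : Orders b e) {k : ℕ} {p : Pol}
    (hp : p.totalDegree ≤ k + 2) (h0 : eval (b 0).ofLp p = 0) (h1 : eval (b 1).ofLp p = 0)
    (hm : ∀ q ∈ polyOn k e, ∫ x, eval x.1.ofLp p * q x ∂(lengthOn e) = 0) : pull b p = 0 :=
  eq_zero_of_endpoints_of_refInt_mul ((totalDegree_pull_le b p).trans hp)
    (by rw [eval_pull, chart_zero, h0]) (by rw [eval_pull, chart_one, h1]) (h.refInt_eq_zero hm)

theorem Orders.exists_edgeVec_eq {fr : Frame} (hfr : fr.GoodEdge e) (h : Orders b e) :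
    ∃ c : ℝ, c ≠ 0 ∧ edgeVec b 0 = c • fr.t e := by
  obtain ⟨c, hc⟩ := hfr.2.1 _ (h.mem 0) _ (h.mem 1)
  refine ⟨c, ?_, hc⟩
  rintro rfl
  exact (linearIndependent_edgeVec h.1).ne_zero 0 (by rw [edgeVec]; simpa using hc)

theorem dirDeriv_smul (c : ℝ) (t : V3) (A : PolM) : dirDeriv (c • t) A = c • dirDeriv t A := by
  ext1 i j
  simp [dirDeriv, Finset.smul_sum, smul_smul]

/-- Each integrand is matched with its data. On the edge n_iᵀ(sym curl τ)n_j has degree at most ℓ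
and zero endpoint values, against moments of degree ℓ − 2; n_iᵀτt has degree at most ℓ + 1 and zero
endpoint values, against ℓ − 1. The curl combination has no vertex data, but its degree ℓ is tested
in full. -/
theorem EdgeMomentsVanish.traces {fr : Frame} {ℓ : ℕ} {τ : PolM} (hℓ : 2 ≤ ℓ)
    (hfr : fr.GoodEdge e) (hb : Orders b e) (hτ : ∀ i j, (τ i j).totalDegree ≤ ℓ + 1)
    (h : EdgeMomentsVanish fr ℓ τ e) (h0 : ∀ δ ∈ e, val τ δ = 0)
    (hc : ∀ δ ∈ e, val (symCurl τ) δ = 0) : EdgeTracesVanish τ b := by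
  obtain ⟨c, hc0, hcd⟩ := hb.exists_edgeVec_eq hfr
  obtain ⟨ht, -, hn₁, hn₁t, hn₂⟩ := hfr
  have e0 := h0 _ (hb.mem 0)
  have e1 := h0 _ (hb.mem 1)
  have c0 := hc _ (hb.mem 0)
  have c1 := hc _ (hb.mem 1)
  have hNN : ∀ i j y, fr.nE e i ⬝ᵥ (val (symCurl τ) (chart b y) *ᵥ fr.nE e j) = 0 := by
    intro i j y
    have h1 : pull b (bil (fr.nE e i) (fr.nE e j) (symCurl τ)) = 0 := by
      refine hb.pull_eq_zero_of_endpoints (k := ℓ - 2)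
        (totalDegree_bil_le _ _ fun i j => (totalDegree_symCurl_le hτ i j).trans (by omega)) ?_ ?_ ?_
      · rw [eval_bil, c0]; simp
      · rw [eval_bil, c1]; simp
      · intro q hq
        simp only [eval_bil]
        exact h.nn i j q hq
    rw [← eval_bil, ← eval_pull, h1, map_zero]
  have hNT : ∀ i y, fr.nE e i ⬝ᵥ (val τ (chart b y) *ᵥ fr.t e) = 0 := by
    intro i y
    have h1 : pull b (bil (fr.nE e i) (fr.t e) τ) = 0 := by
      refine hb.pull_eq_zero_of_endpoints (k := ℓ - 1)
        (totalDegree_bil_le _ _ fun i j => (hτ i j).trans (by omega)) ?_ ?_ ?_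
      · rw [eval_bil, e0]; simp
      · rw [eval_bil, e1]; simp
      · intro q hq
        simp only [eval_bil]
        exact h.nt i q hq
    rw [← eval_bil, ← eval_pull, h1, map_zero]
  have hCurl : ∀ y, fr.n₂ e ⬝ᵥ (val (polCurl τ) (chart b y) *ᵥ fr.n₁ e) +
      fr.t e ⬝ᵥ (val (dirDeriv (fr.t e) τ) (chart b y) *ᵥ fr.t e) = 0 := by
    intro y
    have h1 : pull b (bil (fr.n₂ e) (fr.n₁ e) (polCurl τ) +
        bil (fr.t e) (fr.t e) (dirDeriv (fr.t e) τ)) = 0 := by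
      refine hb.pull_eq_zero (k := ℓ) (totalDegree_add_le
        (totalDegree_bil_le _ _ (totalDegree_polCurl_le hτ))
        (totalDegree_bil_le _ _ (totalDegree_dirDeriv_le _ hτ))) ?_
      intro q hq
      simp only [map_add, eval_bil]
      exact h.curl q hq
    rw [← eval_bil, ← eval_bil, ← map_add, ← eval_pull, h1, map_zero]
  have hw : ∀ w : V3, w ⬝ᵥ edgeVec b 0 = 0 → ∃ α β : ℝ, w = α • fr.n₁ e + β • fr.n₂ e := by
    intro w hw
    rw [hcd, dotProduct_smul, smul_eq_mul] at hw
    exact ⟨_, _, eq_add_of_orthonormal ht hn₁ hn₁t hn₂ ((mul_eq_zero.1 hw).resolve_left hc0)⟩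
  have hnt : ∀ y w, w ⬝ᵥ edgeVec b 0 = 0 → w ⬝ᵥ (val τ (chart b y) *ᵥ edgeVec b 0) = 0 := by
    intro y w h
    obtain ⟨α, β, rfl⟩ := hw w h
    have h1 : fr.n₁ e ⬝ᵥ (val τ (chart b y) *ᵥ fr.t e) = 0 := hNT 0 y
    have h2 : fr.n₂ e ⬝ᵥ (val τ (chart b y) *ᵥ fr.t e) = 0 := hNT 1 y
    rw [hcd, mulVec_smul, dotProduct_smul, add_dotProduct, smul_dotProduct, smul_dotProduct, h1, h2]
    simp
  have q11 : ∀ y, fr.n₁ e ⬝ᵥ (val (polCurl τ) (chart b y) *ᵥ fr.n₁ e) = 0 := fun y => by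
    have : fr.n₁ e ⬝ᵥ (val (symCurl τ) (chart b y) *ᵥ fr.n₁ e) = 0 := hNN 0 0 y
    rw [val_symCurl, dot_sym] at this
    linarith
  have q22 : ∀ y, fr.n₂ e ⬝ᵥ (val (polCurl τ) (chart b y) *ᵥ fr.n₂ e) = 0 := fun y => by
    have : fr.n₂ e ⬝ᵥ (val (symCurl τ) (chart b y) *ᵥ fr.n₂ e) = 0 := hNN 1 1 y
    rw [val_symCurl, dot_sym] at this
    linarith
  have q12 : ∀ y, fr.n₁ e ⬝ᵥ (val (polCurl τ) (chart b y) *ᵥ fr.n₂ e) =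
      -(fr.n₂ e ⬝ᵥ (val (polCurl τ) (chart b y) *ᵥ fr.n₁ e)) := fun y => by
    have : fr.n₁ e ⬝ᵥ (val (symCurl τ) (chart b y) *ᵥ fr.n₂ e) = 0 := hNN 0 1 y
    rw [val_symCurl, dot_sym] at this
    linarith
  refine ⟨hnt, fun y w h => ?_, fun y w h => ?_, fun y w h => ?_⟩
  · obtain ⟨α, β, rfl⟩ := hw w h
    simp only [mulVec_add, mulVec_smul, dotProduct_add, add_dotProduct, dotProduct_smul,
      smul_dotProduct, smul_eq_mul, q11, q22, q12]
    ring
  · obtain ⟨α, β, rfl⟩ := hw w h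
    have h21 : fr.t e ⨯₃ fr.n₂ e = -fr.n₁ e := by
      have : fr.t e ⨯₃ (fr.t e ⨯₃ fr.n₁ e) =
          (fr.n₁ e ⬝ᵥ fr.t e) • fr.t e - (fr.t e ⬝ᵥ fr.t e) • fr.n₁ e := by
        ext i
        fin_cases i <;> simp [cross_eq, dot_eq] <;> ring
      rw [hn₂, this, ht, hn₁t]; simp
    have h22 : fr.n₂ e ⬝ᵥ fr.n₂ e = 1 := by
      rw [hn₂, cross_dot_cross, ht, hn₁, hn₁t]; ring
    have h12 : fr.n₁ e ⬝ᵥ fr.n₂ e = 0 := by rw [hn₂]; simp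
    have h12' : fr.n₂ e ⬝ᵥ fr.n₁ e = 0 := by rw [dotProduct_comm, h12]
    have h3 := hCurl y
    rw [hcd, dirDeriv_smul, val_smul]
    simp only [map_smul, LinearMap.smul_apply, map_add, ← hn₂, h21, smul_mulVec]
    simp only [mulVec_add, mulVec_smul, dotProduct_add, add_dotProduct, dotProduct_smul,
      smul_dotProduct, smul_eq_mul, q11, q22, q12, ht, h22, h12, h12', hn₁, neg_dotProduct,
      smul_neg]
    -- The symmetric part of curl τ vanishes on the normal plane, so (t × w)ᵀ(curl τ)w = |w|²
    -- n₂ᵀ(curl τ)n₁ for every normal w: the condition is independent of the frame. Replacing t by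
    -- the edge vector c t scales each term by c³.
    linear_combination c ^ 3 * (α ^ 2 + β ^ 2) * h3
  -- The condition `nt` holds along the whole line, so it may be differentiated along the edge.
  · have h1 : pull b (bil w (edgeVec b 0) τ) = 0 := by
      refine MvPolynomial.funext fun y => ?_
      rw [eval_pull, eval_bil, hnt y w h, map_zero]
    have h2 := congr_arg (pderiv 0) h1
    rw [pderiv_pull, map_zero] at h2
    rw [← eval_bil, ← dirPol_bil, ← eval_pull, h2, map_zero]

end EdgeTraces

/-! ### From edge conditions to conditions on the boundary of a face -/

section FaceTraces

open MvPolynomial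

/-- The endpoints of the edges of the triangle with vertices `a`. -/
def edgeOf (a : Fin 3 → E3) : Fin 3 → Fin 2 → E3 := ![![a 0, a 1], ![a 0, a 2], ![a 1, a 2]]

variable {a : Fin 3 → E3} {F : Finset E3}

theorem edgeVec_edgeOf (a : Fin 3 → E3) (k : Fin 3) :
    edgeVec (edgeOf a k) 0 = edgeDir k 0 • edgeVec a 0 + edgeDir k 1 • edgeVec a 1 := by
  fin_cases k <;> simp [edgeVec, edgeOf, edgeDir]

theorem chart_edgeOf (a : Fin 3 → E3) (k : Fin 3) (t : ℝ) :
    chart (edgeOf a k) ![t] = chart a (edgeStart k + t • edgeDir k) := by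
  rw [chart, chart, Fin.sum_univ_two, Fin.sum_univ_one]
  fin_cases k <;> simp [edgeOf, edgeDir, edgeStart]
  module

theorem Orders.exists_edge (h : Orders a F) (k : Fin 3) : ∃ e ∈ edges F, Orders (edgeOf a k) e := by
  classical
  set g : Fin 3 → Fin 2 → Fin 3 := ![![0, 1], ![0, 2], ![1, 2]] with hg
  have hg1 : ∀ k, Function.Injective (g k) := by decide
  have hk : edgeOf a k = a ∘ g k := by
    ext1 i; fin_cases k <;> fin_cases i <;> rfl
  have hi : Function.Injective (edgeOf a k) := by
    rw [hk]; exact h.1.injective.comp (hg1 k)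
  refine ⟨Finset.univ.image (edgeOf a k), ?_, ?_, by simp⟩
  · rw [edges, Finset.mem_powersetCard]
    refine ⟨fun x hx => ?_, ?_⟩
    · obtain ⟨i, -, rfl⟩ := Finset.mem_image.1 hx
      rw [hk]
      exact h.mem _
    · rw [Finset.card_image_of_injective _ hi]; simp
  · rw [hk]
    exact h.1.comp_embedding ⟨g k, hg1 k⟩

/-- A product of two tangent vectors is normal. The number j is the signed Jacobian of the chart and
carries the unknown orientation of n. -/
theorem exists_cross_eq_smul (ha : AffineIndependent ℝ a) {n : V3} (hn : n ⬝ᵥ n = 1)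
    (h0 : n ⬝ᵥ edgeVec a 0 = 0) (h1 : n ⬝ᵥ edgeVec a 1 = 0) :
    ∃ j : ℝ, j ≠ 0 ∧ edgeVec a 0 ⨯₃ edgeVec a 1 = j • n := by
  have h2 : ∀ u w : V3, n ⬝ᵥ u = 0 → n ⬝ᵥ w = 0 → u ⨯₃ w = (n ⬝ᵥ (u ⨯₃ w)) • n := by
    intro u w hu hw
    have h3 : (n ⬝ᵥ n) • (u ⨯₃ w) = (n ⬝ᵥ (u ⨯₃ w)) • n - (n ⬝ᵥ w) • (n ⨯₃ u) +
        (n ⬝ᵥ u) • (n ⨯₃ w) := by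
      ext i
      simp only [Pi.add_apply, Pi.sub_apply, Pi.smul_apply, smul_eq_mul, dot_eq, cross_eq]
      fin_cases i <;> simp <;> ring
    rw [hn, hu, hw] at h3
    simpa using h3
  refine ⟨_, fun h3 => ?_, h2 _ _ h0 h1⟩
  have h4 := h2 _ _ h0 h1
  rw [h3, zero_smul] at h4
  refine (crossProduct_ne_zero_iff_linearIndependent.2 ?_) h4
  have h5 := linearIndependent_edgeVec ha
  have h6 : ![edgeVec a 0, edgeVec a 1] = edgeVec a := by
    ext1 i; fin_cases i <;> rfl
  rw [h6]
  exact h5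

theorem exists_chart_eq {o : E3} (h : Orders a F) (ho : o ∈ affineSpan ℝ (F : Set E3)) :
    ∃ y, o = chart a y := by
  rw [h.2] at ho
  obtain ⟨w, hw, rfl⟩ := eq_affineCombination_of_mem_affineSpan_of_fintype ho
  refine ⟨fun j => w j.succ, ?_⟩
  rw [Finset.affineCombination_eq_linear_combination _ _ _ hw, chart_eq_sum, Fin.sum_univ_succ]
  rw [Fin.sum_univ_succ] at hw
  rw [← hw, add_sub_cancel_right]

/-- The polynomial `(uᵀ tr₁^⊥(τ) w)` on a face with normal `n` and tangents `u`, `w`. -/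
noncomputable def tangPol (n u w : V3) (τ : PolM) : Pol :=
  C (1 / 2) * (bil (n ⨯₃ u) w τ + bil (n ⨯₃ w) u τ)

theorem eval_tangPol {n u w : V3} (hn : n ⬝ᵥ n = 1) (hu : n ⬝ᵥ u = 0) (hw : n ⬝ᵥ w = 0) (τ : PolM)
    (x : E3) : eval x.ofLp (tangPol n u w τ) = u ⬝ᵥ (tr₁perp n (val τ x) *ᵥ w) := by
  rw [dot_tr₁perp hn hu hw, tangPol, map_mul, map_add, eval_C, eval_bil, eval_bil]

theorem dirPol_tangPol (v n u w : V3) (τ : PolM) :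
    dirPol v (tangPol n u w τ) = tangPol n u w (dirDeriv v τ) := by
  rw [tangPol, tangPol, ← dirPol_bil, ← dirPol_bil]
  simp only [dirPol, map_add, Derivation.leibniz, smul_eq_mul, pderiv_C, mul_zero, add_zero,
    ← Finset.sum_add_distrib, Finset.mul_sum]
  exact Finset.sum_congr rfl fun i _ => by ring

/-- In terms of T = tr₁^⊥ this says 2∂_d T_dw = ∂_w T_dd on the edge with direction d. The
derivative of τ along w is traded for a curl through d × w = c n; the curl term equals a multiple of
dᵀ(∂_d τ)d by the edge condition with the normal vector w = n, and the same multiple comes from (n ×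
w)ᵀ(∂_d τ)d. The third edge functional is designed for this cancellation. -/
theorem EdgeTracesVanish.tangential {τ : PolM} {b : Fin 2 → E3} (h : EdgeTracesVanish τ b)
    (hd0 : edgeVec b 0 ≠ 0) {n w : V3} {c : ℝ} (hn : n ⬝ᵥ n = 1) (hd : n ⬝ᵥ edgeVec b 0 = 0)
    (hc : edgeVec b 0 ⨯₃ w = c • n) (y : Fin 1 → ℝ) :
    (n ⨯₃ edgeVec b 0) ⬝ᵥ (val (dirDeriv (edgeVec b 0) τ) (chart b y) *ᵥ w) +
      (n ⨯₃ w) ⬝ᵥ (val (dirDeriv (edgeVec b 0) τ) (chart b y) *ᵥ edgeVec b 0) -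
      (n ⨯₃ edgeVec b 0) ⬝ᵥ (val (dirDeriv w τ) (chart b y) *ᵥ edgeVec b 0) = 0 := by
  have h1 := h.curl y n hd
  have h2 := h.nt_deriv y (n ⨯₃ edgeVec b 0) (by rw [dotProduct_comm]; simp)
  set d := edgeVec b 0 with hdd
  have hdd0 : d ⬝ᵥ d ≠ 0 := fun h => hd0 (dotProduct_self_eq_zero.1 h)
  -- Decomposition in the orthogonal tangent basis n × d, d; the first part is annihilated by the
  -- derivative of the `nt` condition.
  have h3 : (d ⬝ᵥ d) • (n ⨯₃ w) = (w ⬝ᵥ d) • (n ⨯₃ d) - c • d := by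
    have e1 : ∀ x : V3, (d ⬝ᵥ d) • (n ⨯₃ w) = (w ⬝ᵥ d) • (n ⨯₃ d) -
        (n ⨯₃ ((d ⨯₃ w) ⨯₃ d)) * (-1) := fun _ => by
      ext i
      simp only [dot_eq, cross_eq]
      fin_cases i <;> simp <;> ring
    have e2 : n ⨯₃ (n ⨯₃ d) = -d := cross_cross_unit hn hd
    rw [e1 0, hc, map_smul, LinearMap.smul_apply, map_smul, e2]
    ext i; simp
  have h4 := dot_curlOf_cross (fun k => val (pd k τ) (chart b y)) (n ⨯₃ d) d w
  rw [← val_polCurl, ← val_dirDeriv, ← val_dirDeriv, hc] at h4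
  have h5 : d ⨯₃ n = -(n ⨯₃ d) := (cross_anticomm _ _).symm
  have h6 := congr_arg (fun v => v ⬝ᵥ (val (dirDeriv d τ) (chart b y) *ᵥ d)) h3
  simp only [smul_dotProduct, sub_dotProduct, smul_eq_mul, h2] at h6
  rw [h5, neg_dotProduct, hn] at h1
  rw [mulVec_smul, dotProduct_smul, smul_eq_mul] at h4
  refine ((mul_eq_zero (a := d ⬝ᵥ d)).1 ?_).resolve_left hdd0
  linear_combination h6 - c * h1 - d ⬝ᵥ d * h4

end FaceTraces

/-! ### The traces on a face are determined by the data on it -/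

section FaceLemma

open MvPolynomial

variable {a : Fin 3 → E3} {F : Finset E3}

theorem edgeStart_add (k : Fin 3) (t : ℝ) (a : Fin 3 → E3) (p : Pol) :
    eval (edgeStart k + t • edgeDir k) (pull a p) = eval (chart (edgeOf a k) ![t]).ofLp p := by
  rw [eval_pull, chart_edgeOf]

theorem eval_tangPol' (n u w : V3) (τ : PolM) (x : E3) :
    eval x.ofLp (tangPol n u w τ) =
      1 / 2 * ((n ⨯₃ u) ⬝ᵥ (val τ x *ᵥ w) + (n ⨯₃ w) ⬝ᵥ (val τ x *ᵥ u)) := by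
  rw [tangPol, map_mul, map_add, eval_C, eval_bil, eval_bil]

theorem dirDeriv_add_left (u w : V3) (τ : PolM) :
    dirDeriv (u + w) τ = dirDeriv u τ + dirDeriv w τ := by
  ext1 i j
  simp [dirDeriv, add_smul, Finset.sum_add_distrib]

/-- `EdgeTracesVanish.tangential` is used with direction and transversal vector (a₀, a₁), (a₁, a₀)
and (a₁ − a₀, a₁), where a₀ and a₁ are the edge vectors of the triangle. The sign of the Jacobian
changes between edges but does not enter the conclusion. -/
theorem tensorBoundary_of_traces {τ : PolM} {n : V3} {j : ℝ} (ha : AffineIndependent ℝ a)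
    (hn : n ⬝ᵥ n = 1) (h0 : n ⬝ᵥ edgeVec a 0 = 0) (h1 : n ⬝ᵥ edgeVec a 1 = 0)
    (hj : edgeVec a 0 ⨯₃ edgeVec a 1 = j • n) (hv : ∀ i, val τ (a i) = 0)
    (h : ∀ k, EdgeTracesVanish τ (edgeOf a k)) :
    TensorBoundary (pull a (tangPol n (edgeVec a 0) (edgeVec a 0) τ))
      (pull a (tangPol n (edgeVec a 0) (edgeVec a 1) τ))
      (pull a (tangPol n (edgeVec a 1) (edgeVec a 1) τ)) := by
  have hne := fun k => (linearIndependent_edgeVec ha).ne_zero k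
  have d0 : edgeVec (edgeOf a 0) 0 = edgeVec a 0 := by simp [edgeVec_edgeOf, edgeDir]
  have d1 : edgeVec (edgeOf a 1) 0 = edgeVec a 1 := by simp [edgeVec_edgeOf, edgeDir]
  have d2 : edgeVec (edgeOf a 2) 0 = -edgeVec a 0 + edgeVec a 1 := by
    simp [edgeVec_edgeOf, edgeDir]
  have hn0 : edgeVec (edgeOf a 0) 0 ≠ 0 := by rw [d0]; exact hne 0
  have hn1 : edgeVec (edgeOf a 1) 0 ≠ 0 := by rw [d1]; exact hne 1
  have hn2 : edgeVec (edgeOf a 2) 0 ≠ 0 := by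
    rw [d2, neg_add_eq_sub, sub_ne_zero]
    exact fun h => absurd ((linearIndependent_edgeVec ha).injective h) (by decide)
  have p0 : ∀ y : Fin 2 → ℝ, ∀ i, chart a y = a i → ∀ u w : V3,
      eval y (pull a (tangPol n u w τ)) = 0 := fun y i hi u w => by
    rw [eval_pull, eval_tangPol', hi, hv]; simp
  have tt : ∀ k y, (n ⨯₃ edgeVec (edgeOf a k) 0) ⬝ᵥ (val τ (chart (edgeOf a k) y) *ᵥ
      edgeVec (edgeOf a k) 0) = 0 := fun k y => (h k).nt y _ (by rw [dotProduct_comm]; simp)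
  have j1 : edgeVec a 1 ⨯₃ edgeVec a 0 = (-j) • n := by
    rw [neg_smul, ← hj, cross_anticomm]
  have j2 : (-edgeVec a 0 + edgeVec a 1) ⨯₃ edgeVec a 1 = (-j) • n := by
    rw [neg_smul, ← hj]; simp
  refine ⟨fun t => ?_, fun t => ?_, fun t => ?_, fun t => ?_, fun t => ?_, fun t => ?_,
    p0 _ 0 ?_ _ _, ⟨p0 _ 1 ?_ _ _, p0 _ 1 ?_ _ _⟩, ⟨p0 _ 2 ?_ _ _, p0 _ 2 ?_ _ _⟩⟩
  · have h2 := tt 0 ![t]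
    rw [d0] at h2
    rw [edgeStart_add, eval_tangPol', h2]; ring
  · have h2 := tt 1 ![t]
    rw [d1] at h2
    rw [edgeStart_add, eval_tangPol', h2]; ring
  · have h2 := tt 2 ![t]
    rw [d2] at h2
    have e2 : ∀ y : Fin 2 → ℝ, eval y (2 : MvPolynomial (Fin 2) ℝ) = 2 := fun y => map_ofNat _ 2
    rw [map_add, map_sub, map_mul, e2, edgeStart_add, edgeStart_add, edgeStart_add, eval_tangPol',
      eval_tangPol', eval_tangPol']
    simp only [map_add, map_neg, mulVec_add, mulVec_neg, add_dotProduct, dotProduct_add,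
      neg_dotProduct, dotProduct_neg] at h2
    linear_combination h2
  all_goals have e2 : ∀ y : Fin 2 → ℝ, eval y (2 : MvPolynomial (Fin 2) ℝ) = 2 := fun y => map_ofNat _ 2
  · have h2 := (h 0).tangential hn0 hn (by rw [d0]; exact h0) (by rw [d0]; exact hj) ![t]
    rw [d0] at h2
    simp only [map_sub, map_mul, e2, pderiv_pull, dirPol_tangPol, edgeStart_add, eval_tangPol']
    linear_combination h2
  · have h2 := (h 1).tangential hn1 hn (by rw [d1]; exact h1) (by rw [d1]; exact j1) ![t]
    rw [d1] at h2
    simp only [map_sub, map_mul, e2, pderiv_pull, dirPol_tangPol, edgeStart_add, eval_tangPol']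
    linear_combination h2
  · have h2 := (h 2).tangential hn2 hn (by rw [d2, dotProduct_add, dotProduct_neg, h0, h1]; simp)
      (by rw [d2]; exact j2) ![t]
    rw [d2, dirDeriv_add_left, ← neg_one_smul ℝ (edgeVec a 0), dirDeriv_smul, val_add,
      val_smul] at h2
    simp only [map_add, map_sub, map_mul, e2, pderiv_pull, dirPol_tangPol, edgeStart_add,
      eval_tangPol']
    simp only [map_add, map_smul, mulVec_add, mulVec_smul, add_dotProduct, dotProduct_add,
      smul_dotProduct, dotProduct_smul, add_mulVec, smul_mulVec, smul_eq_mul] at h2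
    linear_combination h2
  all_goals simp [chart, Fin.sum_univ_two]

/-- The face normal is orthogonal to the edge, so `nt` applies with w = n. The rotation of the field
in chart coordinates is j nᵀ(curl τ)n, which is zero by `nn` with w = n. -/
theorem vector_boundary_of_traces {τ : PolM} {n : V3} {j : ℝ}
    (h0 : n ⬝ᵥ edgeVec a 0 = 0) (h1 : n ⬝ᵥ edgeVec a 1 = 0)
    (hj : edgeVec a 0 ⨯₃ edgeVec a 1 = j • n) (h : ∀ k, EdgeTracesVanish τ (edgeOf a k))
    (k : Fin 3) :
    VanishesOnEdge k (C (edgeDir k 0) * pull a (bil n (edgeVec a 0) τ) +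
      C (edgeDir k 1) * pull a (bil n (edgeVec a 1) τ)) ∧
    VanishesOnEdge k (pderiv 0 (pull a (bil n (edgeVec a 1) τ)) -
      pderiv 1 (pull a (bil n (edgeVec a 0) τ))) := by
  have hnd : n ⬝ᵥ edgeVec (edgeOf a k) 0 = 0 := by
    rw [edgeVec_edgeOf, dotProduct_add, dotProduct_smul, dotProduct_smul, h0, h1]; simp
  refine ⟨fun t => ?_, fun t => ?_⟩
  · have h2 := (h k).nt ![t] n hnd
    rw [edgeVec_edgeOf, mulVec_add, mulVec_smul, mulVec_smul, dotProduct_add, dotProduct_smul,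
      dotProduct_smul, smul_eq_mul, smul_eq_mul] at h2
    rw [map_add, map_mul, map_mul, eval_C, eval_C, edgeStart_add, edgeStart_add, eval_bil, eval_bil,
      h2]
  · have h2 := (h k).nn ![t] n hnd
    have h3 := dot_curlOf_cross (fun i => val (pd i τ) (chart (edgeOf a k) ![t])) n
      (edgeVec a 0) (edgeVec a 1)
    rw [← val_polCurl, ← val_dirDeriv, ← val_dirDeriv, hj, mulVec_smul, dotProduct_smul, h2,
      smul_zero] at h3
    rw [map_sub, pderiv_pull, pderiv_pull, dirPol_bil, dirPol_bil, edgeStart_add, edgeStart_add,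
      eval_bil, eval_bil, ← h3]

/-- The moments of `τ` on the face `F` vanish. -/
structure FaceMomentsVanish (fr : Frame) (ℓ : ℕ) (τ : PolM) (F : Finset E3) : Prop where
  tensor : ∀ ς ∈ faceTensorTest fr ℓ F, faceDofTensor fr τ F ς = 0
  vector : ∀ v ∈ faceVectorTest fr ℓ F, faceDofVector fr τ F v = 0

/-- Transfers a vanishing moment to the reference triangle; the constant c absorbs the factors
relating the integrands. -/
theorem Orders.integral_areaOn_eq (h : Orders a F) (f : E3 → ℝ) {g : MvPolynomial (Fin 2) ℝ}
    {c : ℝ} (hf : ∀ y, c * f (chart a y) = eval y g) (h0 : ∫ x, f x.1 ∂(areaOn F) = 0) :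
    refInt 2 g = 0 := by
  rw [integral_areaOn, h.integral_eq] at h0
  have h1 := (mul_eq_zero.1 h0).resolve_left (chartVol_pos h.1).ne'
  rw [refInt_apply]
  simp only [← hf]
  rw [integral_const_mul, h1, mul_zero]

theorem val_surfCurl₂ (n : V3) (p : Pol) (x : E3) : val (surfCurl₂ n p) x =
    surfHess n (Matrix.of fun k l => eval x.ofLp (pderiv k (pderiv l p))) := by
  ext i j
  simp only [val, surfCurl₂, surfHess, surfCurl, cross_apply, of_apply, map_apply]
  fin_cases i <;> fin_cases j <;> simp

theorem eval_pderiv_pderiv_pull (p : Pol) (i j : Fin 2) (y : Fin 2 → ℝ) :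
    eval y (pderiv i (pderiv j (pull a p))) = edgeVec a i ⬝ᵥ
      ((Matrix.of fun k l => eval (chart a y).ofLp (pderiv k (pderiv l p))) *ᵥ edgeVec a j) := by
  rw [pderiv_pull, pderiv_pull, eval_pull]
  simp [dirPol, dotProduct, mulVec, mul_comm]

theorem chart_sub (a : Fin 3 → E3) (y o : Fin 2 → ℝ) : (chart a y - chart a o).ofLp =
    (y 0 - o 0) • edgeVec a 0 + (y 1 - o 1) • edgeVec a 1 := by
  rw [WithLp.ofLp_sub, chart_ofLp, chart_ofLp, Fin.sum_univ_two, Fin.sum_univ_two]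
  module

/-- If the degrees of freedom on a face, its edges and its vertices vanish, then the traces vanish
on the face. -/
theorem FaceMomentsVanish.traces {fr : Frame} {ℓ : ℕ} {τ : PolM} (hℓ : 3 ≤ ℓ) (hF : F.card = 3)
    (hFi : AffineIndependent ℝ ((↑) : F → E3))
    (hfr : fr.GoodFace F) (hfe : ∀ e ∈ edges F, fr.GoodEdge e)
    (hτ : ∀ i j, (τ i j).totalDegree ≤ ℓ + 1) (hv : ∀ δ ∈ F, val τ δ = 0)
    (hc : ∀ δ ∈ F, val (symCurl τ) δ = 0) (he : ∀ e ∈ edges F, EdgeMomentsVanish fr ℓ τ e)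
    (h : FaceMomentsVanish fr ℓ τ F) (x : E3) (hx : x ∈ hull F) :
    tr₂ (fr.n F) (val τ x) = 0 ∧ tr₁perp (fr.n F) (val τ x) = 0 := by
  obtain ⟨a, ha⟩ := exists_orders (d := 2) hF hFi
  have het : ∀ k, EdgeTracesVanish τ (edgeOf a k) := fun k => by
    obtain ⟨e, he1, he2⟩ := ha.exists_edge k
    have hs : e ⊆ F := (Finset.mem_powersetCard.1 he1).1
    exact (he e he1).traces (by omega) (hfe e he1) he2 hτ (fun δ hδ => hv δ (hs hδ))
      (fun δ hδ => hc δ (hs hδ))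
  obtain ⟨hn, hnF, ho⟩ := hfr
  obtain ⟨o, ho⟩ := exists_chart_eq ha ho
  have h0 : fr.n F ⬝ᵥ edgeVec a 0 = 0 := hnF _ (ha.mem 0) _ (ha.mem 1)
  have h1 : fr.n F ⬝ᵥ edgeVec a 1 = 0 := hnF _ (ha.mem 0) _ (ha.mem 2)
  obtain ⟨j, hj0, hj⟩ := exists_cross_eq_smul ha.1 hn h0 h1
  have hT := tensorBoundary_of_traces ha.1 hn h0 h1 hj (fun i => hv _ (ha.mem i)) het
  have hV := vector_boundary_of_traces h0 h1 hj het
  have degb : ∀ u w : V3, (pull a (bil u w τ)).totalDegree ≤ ℓ + 1 := fun u w =>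
    (totalDegree_pull_le a _).trans (totalDegree_bil_le u w hτ)
  have degt : ∀ u w : V3, (pull a (tangPol (fr.n F) u w τ)).totalDegree ≤ ℓ + 1 := fun u w =>
    (totalDegree_pull_le a _).trans (totalDegree_C_mul_le _ (totalDegree_add_le
      (totalDegree_bil_le _ _ hτ) (totalDegree_bil_le _ _ hτ)))
  have e2 : ∀ y : Fin 2 → ℝ, eval y (2 : MvPolynomial (Fin 2) ℝ) = 2 := fun y => map_ofNat _ 2
  obtain ⟨v0, v1⟩ := vector_eq_zero_of_moments hℓ (degb _ _) (degb _ _) (fun k => (hV k).1)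
    (fun k => (hV k).2) (fun q hq => by
      obtain ⟨p, hp, rfl⟩ := exists_lift ha.1 q
      refine ha.integral_areaOn_eq (c := j) (fun x => tr₂ (fr.n F) (val τ x) ⬝ᵥ
        fun i => eval x.ofLp (surfGrad (fr.n F) p i)) (fun y => ?_)
        (h.vector _ (Submodule.mem_sup_left (Submodule.subset_span
          ⟨p, (mem_restrictTotalDegree _ _ _).2 (hp.trans hq), rfl⟩)))
      have hg : (fun i => eval (chart a y).ofLp (surfGrad (fr.n F) p i)) =
          (fr.n F ⨯₃ fun k => eval (chart a y).ofLp (pderiv k p)) ⨯₃ fr.n F := by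
        ext i
        fin_cases i <;> simp [surfGrad, surfCurl, cross_apply]
      rw [hg, tr₂_dot_surfGrad hn hj, map_sub, map_mul, map_mul, pderiv_pull, pderiv_pull,
        eval_pull, eval_pull, eval_pull, eval_pull, eval_bil, eval_bil]
      simp [dirPol, dotProduct]) o (fun q hq => by
      obtain ⟨p, hp, rfl⟩ := exists_lift ha.1 q
      refine ha.integral_areaOn_eq (c := 1) (fun x => tr₂ (fr.n F) (val τ x) ⬝ᵥ
        (eval x.ofLp p • ((x - fr.o F).ofLp ⨯₃ fr.n F))) (fun y => ?_)
        (h.vector _ (Submodule.mem_sup_right (Submodule.subset_span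
          ⟨_, mem_polyOn_iff.2 ⟨p, hp.trans hq, rfl⟩, rfl⟩)))
      rw [dotProduct_smul, ho, chart_sub, tr₂_dot_cross hn (by
        rw [dotProduct_add, dotProduct_smul, dotProduct_smul, h0, h1]; simp)]
      simp only [map_add, map_mul, map_sub, eval_X, eval_C, eval_pull, eval_bil, mulVec_add,
        mulVec_smul, dotProduct_add, dotProduct_smul, smul_eq_mul]
      ring)
  obtain ⟨t0, t1, t2⟩ := tensor_eq_zero_of_moments (ℓ := ℓ) (by omega) (degt _ _) (degt _ _)
    (degt _ _) hT (fun q hq => by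
      obtain ⟨p, hp, rfl⟩ := exists_lift ha.1 q
      -- The second-order surface operator is quadratic in the normal, hence the square of the
      -- Jacobian j.
      refine ha.integral_areaOn_eq (c := j * j) (fun x => frob (tr₁perp (fr.n F) (val τ x))
        (val (surfCurl₂ (fr.n F) p) x)) (fun y => ?_)
        (h.tensor _ (Submodule.mem_sup_left (Submodule.subset_span
          ⟨p, (mem_restrictTotalDegree _ _ _).2 (hp.trans hq), rfl⟩)))
      rw [val_surfCurl₂, frob_tr₁perp_surfHess hj (by
        ext k l
        simp only [transpose_apply, of_apply]
        rw [pderiv_comm])]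
      simp only [map_add, map_sub, map_mul, e2, eval_pderiv_pderiv_pull]
      rw [eval_pull, eval_pull, eval_pull, eval_tangPol hn h0 h0, eval_tangPol hn h0 h1,
        eval_tangPol hn h1 h1]) o (fun y₀ y₁ hy₀ hy₁ => by
      obtain ⟨p₀, hp₀, rfl⟩ := exists_lift ha.1 y₀
      obtain ⟨p₁, hp₁, rfl⟩ := exists_lift ha.1 y₁
      -- The reference moments in `tensor_eq_zero_of_moments` are taken against 2 sym(x ⊗ y).
      refine ha.integral_areaOn_eq (c := 2) (fun x => frob (tr₁perp (fr.n F) (val τ x))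
        (sym (vecMulVec (x - fr.o F).ofLp
          (eval x.ofLp p₀ • edgeVec a 0 + eval x.ofLp p₁ • edgeVec a 1)))) (fun y => ?_)
        (h.tensor _ (Submodule.mem_sup_right (Submodule.subset_span
          ⟨fun x => eval x.1.ofLp p₀ • edgeVec a 0 + eval x.1.ofLp p₁ • edgeVec a 1,
            ⟨fun i => ?_, fun x => ?_⟩, rfl⟩)))
      · rw [frob_tr₁perp_sym_vecMulVec, ho, chart_sub]
        simp only [map_add, map_sub, map_mul, e2, eval_X, eval_C]
        rw [eval_pull, eval_pull, eval_pull, eval_pull, eval_pull, eval_tangPol hn h0 h0,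
          eval_tangPol hn h0 h1, eval_tangPol hn h1 h1]
        simp only [mulVec_add, mulVec_smul, dotProduct_add, dotProduct_smul, add_dotProduct,
          smul_dotProduct, smul_eq_mul,
          dot_mulVec_comm_of_isSymm (tr₁perp_isSymm _ _) (edgeVec a 1) (edgeVec a 0)]
        ring
      · refine mem_polyOn_iff.2 ⟨C (edgeVec a 0 i) * p₀ + C (edgeVec a 1 i) * p₁,
          totalDegree_add_le (totalDegree_C_mul_le _ (hp₀.trans hy₀))
            (totalDegree_C_mul_le _ (hp₁.trans hy₁)), ?_⟩
        ext x
        simp [mul_comm]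
      · rw [dotProduct_add, dotProduct_smul, dotProduct_smul, h0, h1]; simp)
  rw [ha.hull_eq] at hx
  obtain ⟨y, -, rfl⟩ := hx
  refine ⟨tr₂_eq_zero hj0 hj ?_ ?_, tr₁perp_eq_zero hn hj0 hj ?_ ?_ ?_⟩
  · rw [← eval_bil, ← eval_pull, v0, map_zero]
  · rw [← eval_bil, ← eval_pull, v1, map_zero]
  · rw [← eval_tangPol hn h0 h0, ← eval_pull, t0, map_zero]
  · rw [← eval_tangPol hn h0 h1, ← eval_pull, t1, map_zero]
  · rw [← eval_tangPol hn h1 h1, ← eval_pull, t2, map_zero]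

end FaceLemma

/-! ### The dimension of the bubble space -/

section BubbleFactorization

open MvPolynomial

/-- On the graph of l the polynomial q becomes one in two variables, which vanishes identically if
it vanishes on the reference triangle. Vanishing thus spreads from a face to its plane. -/
theorem eval_eq_zero_of_insertNth {q : MvPolynomial (Fin 3) ℝ} (k : Fin 3)
    (l : MvPolynomial (Fin 2) ℝ)
    (h : ∀ z ∈ refSimplex 2, eval (k.insertNth (eval z l) z : Fin 3 → ℝ) q = 0) (z : Fin 2 → ℝ) :
    eval (k.insertNth (eval z l) z : Fin 3 → ℝ) q = 0 := by
  set f : Fin 3 → MvPolynomial (Fin 2) ℝ := k.insertNth l X with hf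
  have h1 : ∀ z : Fin 2 → ℝ, (fun i => eval z (f i)) = k.insertNth (eval z l) z := fun z => by
    ext i
    rcases Fin.eq_self_or_eq_succAbove k i with rfl | ⟨j, rfl⟩ <;> simp [hf]
  have h2 : aeval f q = 0 := eq_zero_of_eval_refInterior fun z hz hz' => by
    rw [eval_aeval, h1]
    exact h z ⟨fun i => (hz i).le, hz'.le⟩
  rw [← h1, ← eval_aeval, h2, map_zero]

/-- The two barycentric coordinates 1 − ∑ Xᵢ and Xₖ divide q one after the other; the second does
not share a factor with the first, as the origin witnesses. -/
theorem exists_eq_bubble_mul {q : MvPolynomial (Fin 3) ℝ} {D : ℕ} (hq : q.totalDegree ≤ D + 2)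
    (k : Fin 3) (h1 : ∀ y ∈ refSimplex 3, ∑ i, y i = 1 → eval y q = 0)
    (h2 : ∀ y ∈ refSimplex 3, y k = 0 → eval y q = 0) :
    ∃ r : MvPolynomial (Fin 3) ℝ, r.totalDegree ≤ D ∧ q = affForm (fun _ => -1) 1 * (X k * r) := by
  have w1 : (fun _ => -1 : Fin 3 → ℝ) ≠ 0 := fun h => by simpa using congr_fun h 0
  have w2 : (Pi.single k 1 : Fin 3 → ℝ) ≠ 0 := by simp
  have e2 : affForm (Pi.single k 1 : Fin 3 → ℝ) 0 = X k := by
    simp [affForm, Pi.single_apply, Finset.sum_ite_eq']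
  obtain ⟨q, rfl⟩ := exists_eq_affForm_mul w1 1 (p := q) (fun y hy => by
    have e : y = Fin.insertNth 0 (eval (fun j => y (Fin.succAbove 0 j)) (1 - X 0 - X 1))
        (fun j => y (Fin.succAbove 0 j)) := by
      rw [eq_comm, Fin.insertNth_eq_iff]
      refine ⟨?_, rfl⟩
      simp [dotProduct, Fin.sum_univ_three] at hy ⊢
      linarith
    rw [e]
    refine eval_eq_zero_of_insertNth 0 _ (fun z hz => h1 _ ?_ ?_) _
    · refine (insertNth_mem_refSimplex_iff _ _ _).2 ⟨hz, ?_, ?_⟩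
      · have := hz.2
        simp [Fin.sum_univ_two] at this ⊢
        linarith
      · simp [Fin.sum_univ_two]; linarith
    · rw [Fin.sum_univ_succAbove _ 0]
      simp [Fin.sum_univ_two])
  obtain ⟨r, rfl⟩ := exists_eq_affForm_mul_of_mul w2 0 (g := affForm (fun _ => -1) 1) (q := q)
    (x₀ := 0) (fun y hy => by
      have e : y = Fin.insertNth k (eval (fun j => y (Fin.succAbove k j)) 0)
          (fun j => y (Fin.succAbove k j)) := by
        rw [eq_comm, Fin.insertNth_eq_iff]
        refine ⟨?_, rfl⟩
        simpa using hy.symm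
      rw [e]
      refine eval_eq_zero_of_insertNth k _ (fun z hz => h2 _ ?_ ?_) _
      · refine (insertNth_mem_refSimplex_iff _ _ _).2 ⟨hz, ?_, ?_⟩
        · simp
        · rw [map_zero]; linarith [hz.2]
      · simp) (by simp) (by rw [eval_affForm]; simp)
  exact ⟨r, totalDegree_le_of_mul_affForm w2 (totalDegree_le_of_mul_affForm w1 hq), by rw [e2]⟩

theorem Orders.sum_mem_hull_erase {d : ℕ} [DecidableEq E3] {b : Fin (d + 1) → E3} {K : Finset E3}
    (h : Orders b K) {w : Fin (d + 1) → ℝ} (h0 : ∀ i, 0 ≤ w i) (h1 : ∑ i, w i = 1)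
    {i : Fin (d + 1)} (hi : w i = 0) : ∑ j, w j • b j ∈ hull (K.erase (b i)) := by
  classical
  have e1 : ∑ j, w j • b j = ∑ j ∈ Finset.univ.erase i, w j • b j := by
    rw [← Finset.add_sum_erase _ _ (Finset.mem_univ i), hi, zero_smul, zero_add]
  rw [e1]
  refine (convex_convexHull ℝ _).sum_mem (fun j _ => h0 j) ?_ fun j hj => subset_convexHull ℝ _ ?_
  · rw [← h1, ← Finset.add_sum_erase _ _ (Finset.mem_univ i), hi, zero_add]
  · rw [Finset.mem_coe, Finset.mem_erase]
    exact ⟨h.1.injective.ne (Finset.ne_of_mem_erase hj), h.mem j⟩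

theorem Orders.card {d : ℕ} {b : Fin (d + 1) → E3} {K : Finset E3} (h : Orders b K) :
    K.card = d + 1 := by
  classical
  have : K = Finset.univ.image b := by
    rw [← Finset.coe_inj, h.2]; simp
  rw [this, Finset.card_image_of_injective _ h.1.injective]; simp

theorem Orders.erase_mem_faces [DecidableEq E3] {b : Fin 4 → E3} {K : Finset E3} (h : Orders b K)
    (i : Fin 4) : K.erase (b i) ∈ faces K := by
  rw [faces, Finset.mem_powersetCard, Finset.card_erase_of_mem (h.mem i), h.card]
  exact ⟨Finset.erase_subset _ _, rfl⟩

/-- A vector orthogonal to t is a combination of n and n × t (for t ≠ 0). The n-part is controlled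
by tr₂, the other by the diagonal entry of tr₁^⊥ in direction t. Only t has to be tangent to the
face, so g can be kept fixed on both faces that contain t. -/
theorem dot_mulVec_eq_zero_of_traces {n g t : V3} (hn : n ⬝ᵥ n = 1) (ht : n ⬝ᵥ t = 0)
    (hg : g ⬝ᵥ t = 0) {M : M3} (h2 : tr₂ n M = 0) (h1 : tr₁perp n M = 0) :
    g ⬝ᵥ (M *ᵥ t) = 0 := by
  have e1 := tr₂_dot_cross hn ht M
  have e2 := dot_tr₁perp hn ht ht M
  rw [h2, zero_dotProduct] at e1
  rw [h1, zero_mulVec, dotProduct_zero] at e2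
  rcases eq_or_ne t 0 with rfl | ht0
  · simp
  have e3 : (n ⬝ᵥ n * (t ⬝ᵥ t) - n ⬝ᵥ t * (n ⬝ᵥ t)) • g =
      ((g ⬝ᵥ n) * (t ⬝ᵥ t) - (g ⬝ᵥ t) * (n ⬝ᵥ t)) • n +
      ((g ⬝ᵥ t) * (n ⬝ᵥ n) - (g ⬝ᵥ n) * (n ⬝ᵥ t)) • t + (g ⬝ᵥ (n ⨯₃ t)) • (n ⨯₃ t) := by
    ext i
    simp only [Pi.add_apply, Pi.smul_apply, smul_eq_mul, dot_eq, cross_eq]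
    fin_cases i <;> simp <;> ring
  have e4 := congr_arg (fun v => v ⬝ᵥ (M *ᵥ t)) e3
  simp only [hn, ht, hg, smul_dotProduct, add_dotProduct, smul_eq_mul, ← e1] at e4
  have e5 : (t ⬝ᵥ t) * (g ⬝ᵥ (M *ᵥ t)) = 0 := by
    linear_combination e4 - (g ⬝ᵥ (n ⨯₃ t)) * e2
  exact (mul_eq_zero.1 e5).resolve_left fun h => ht0 (dotProduct_self_eq_zero.1 h)

/-- The edge vector of the face opposite to `b 0` which is not at the vertex `b k.succ`. -/
def oppEdge (b : Fin 4 → E3) (k : Fin 3) : V3 := (b (k + 2).succ - b (k + 1).succ).ofLp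

theorem sum_oppEdge (b : Fin 4 → E3) : ∑ k, oppEdge b k = 0 := by
  simp only [oppEdge, Fin.sum_univ_three, ← WithLp.ofLp_add]
  have : b ((0 : Fin 3) + 2).succ - b ((0 : Fin 3) + 1).succ + (b ((1 : Fin 3) + 2).succ -
      b ((1 : Fin 3) + 1).succ) + (b ((2 : Fin 3) + 2).succ - b ((2 : Fin 3) + 1).succ) = 0 := by
    have e1 : (1 : Fin 3) + 2 = 0 + 0 := by decide
    have e2 : (2 : Fin 3) + 2 = 0 + 1 := by decide
    have e3 : (2 : Fin 3) + 1 = 0 + 0 := by decide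
    have e4 : (1 : Fin 3) + 1 = 0 + 2 := by decide
    rw [e1, e2, e3, e4]
    abel
  rw [this]; rfl

/-- The relations `∑ Xₖ rₖ = 0` between the coordinates, of degree at most `D`. -/
def relations (D : ℕ) : Submodule ℝ (Fin 3 → MvPolynomial (Fin 3) ℝ) where
  carrier := {r | (∀ k, (r k).totalDegree ≤ D) ∧ ∑ k, X k * r k = 0}
  add_mem' {r s} hr hs :=
    ⟨fun k => totalDegree_add_le (hr.1 k) (hs.1 k), by
      simp only [Pi.add_apply, mul_add, Finset.sum_add_distrib, hr.2, hs.2, add_zero]⟩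
  zero_mem' := ⟨by simp, by simp⟩
  smul_mem' c r hr :=
    ⟨fun k => totalDegree_smul_le_of_le c (hr.1 k), by
      simp only [Pi.smul_apply, mul_smul_comm, ← Finset.smul_sum, hr.2, smul_zero]⟩

theorem bil_sum_right {ι : Type*} (s : Finset ι) (g : V3) (t : ι → V3) (A : PolM) :
    bil g (∑ k ∈ s, t k) A = ∑ k ∈ s, bil g (t k) A := by
  refine MvPolynomial.funext fun x => ?_
  have h := eval_bil g
  rw [map_sum]
  have h2 : ∀ t, eval x (bil g t A) = g ⬝ᵥ (val A (WithLp.toLp 2 x) *ᵥ t) := fun t => h t A _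
  simp only [h2, Matrix.mulVec_sum, dotProduct_sum]

/-- The edge `oppEdge b k` lies in the faces opposite to b 0 and to b k.succ, so both barycentric
coordinates divide gᵀτt and the degree drops from ℓ + 1 to ℓ − 1. The three edges form a closed
triangle, which gives the relation after cancelling the common factor. -/
theorem exists_relation_of_mem_bubble {fr : Frame} {ℓ : ℕ} (hℓ : 1 ≤ ℓ) {K : Finset E3}
    {b : Fin 4 → E3} (hb : Orders b K) (hfr : fr.Good K) {g : V3}
    (hg : ∀ k, g ⬝ᵥ oppEdge b k = 0) {τ : PolM} (hτ : τ ∈ bubble fr (ℓ + 1) K) :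
    ∃ r ∈ relations (ℓ - 1), ∀ k, pull b (bil g (oppEdge b k) τ) =
      affForm (fun _ => -1) 1 * (X k * r k) := by
  classical
  have hd := (mem_polyT_iff.1 hτ.1).2
  have key : ∀ i : Fin 4, ∀ k, (k + 2).succ ≠ i → (k + 1).succ ≠ i → ∀ x ∈ hull (K.erase (b i)),
      eval x.ofLp (bil g (oppEdge b k) τ) = 0 := by
    intro i k h2 h1 x hx
    have hF := hb.erase_mem_faces i
    have hm : ∀ j, j ≠ i → b j ∈ K.erase (b i) := fun j hj =>
      Finset.mem_erase.2 ⟨hb.1.injective.ne hj, hb.mem j⟩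
    have hgF := hfr.2 _ hF
    rw [eval_bil]
    exact dot_mulVec_eq_zero_of_traces hgF.1 (hgF.2.1 _ (hm _ h1) _ (hm _ h2)) (hg k)
      (hτ.2 _ hF x hx).1 (hτ.2 _ hF x hx).2
  have key2 : ∀ i : Fin 4, ∀ y ∈ refSimplex 3,
      (Fin.cons (1 - ∑ j, y j) y : Fin 4 → ℝ) i = 0 → chart b y ∈ hull (K.erase (b i)) := by
    intro i y hy hi
    have e : chart b y = ∑ j, (Fin.cons (1 - ∑ j, y j) y : Fin 4 → ℝ) j • b j := by
      rw [chart_eq_sum, Fin.sum_univ_succ (n := 3)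
        (fun j => (Fin.cons (1 - ∑ j, y j) y : Fin 4 → ℝ) j • b j)]
      rfl
    rw [e]
    refine hb.sum_mem_hull_erase (fun j => ?_) ?_ hi
    · refine Fin.cases ?_ (fun j => ?_) j
      · simpa using hy.2
      · simpa using hy.1 j
    · rw [Fin.sum_univ_succ]; simp
  have h : ∀ k, ∃ r : MvPolynomial (Fin 3) ℝ, r.totalDegree ≤ ℓ - 1 ∧
      pull b (bil g (oppEdge b k) τ) = affForm (fun _ => -1) 1 * (X k * r) := by
    intro k
    refine exists_eq_bubble_mul ?_ k (fun y hy hy1 => ?_) fun y hy hyk => ?_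
    · refine (totalDegree_pull_le b _).trans ((totalDegree_bil_le _ _ hd).trans ?_)
      omega
    · rw [eval_pull]
      exact key 0 k (Fin.succ_ne_zero _) (Fin.succ_ne_zero _) _ (key2 0 y hy (by simp [hy1]))
    · rw [eval_pull]
      refine key k.succ k ?_ ?_ _ (key2 k.succ y hy (by simpa using hyk))
      · rw [Ne, Fin.succ_inj]; clear hyk; revert k; decide
      · rw [Ne, Fin.succ_inj]; clear hyk; revert k; decide
  choose r hr1 hr2 using h
  refine ⟨r, ⟨hr1, ?_⟩, hr2⟩
  have h3 : affForm (fun _ => -1) 1 * ∑ k, X k * r k = (0 : MvPolynomial (Fin 3) ℝ) := by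
    rw [Finset.mul_sum]
    simp only [← hr2]
    rw [← map_sum, ← bil_sum_right, sum_oppEdge]
    simp [bil]
  exact (mul_eq_zero.1 h3).resolve_left
    (affForm_ne_zero (fun h => by simpa using congr_fun h 0) _)

end BubbleFactorization

/-! ### Dimensions of the relations, the bubbles and the trace-free polynomials -/

section Dimensions

open MvPolynomial

instance finite_restrictTotalDegree (d k : ℕ) :
    Module.Finite ℝ (restrictTotalDegree (Fin d) ℝ k) := by
  refine Module.finite_of_finrank_pos ?_
  rw [finrank_restrictTotalDegree]
  exact Nat.choose_pos (by omega)

/-- Every nonconstant monomial is divisible by some variable. -/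
theorem exists_sum_X_mul {D : ℕ} {p : MvPolynomial (Fin 3) ℝ} (hp : p.totalDegree ≤ D + 1)
    (h0 : constantCoeff p = 0) :
    ∃ r : Fin 3 → restrictTotalDegree (Fin 3) ℝ D,
      ∑ k, X k * (r k : MvPolynomial (Fin 3) ℝ) = p := by
  classical
  set L : (Fin 3 → restrictTotalDegree (Fin 3) ℝ D) →ₗ[ℝ] MvPolynomial (Fin 3) ℝ :=
    ∑ k, LinearMap.mulLeft ℝ (X k) ∘ₗ (Submodule.subtype _) ∘ₗ LinearMap.proj k with hL
  have hLr : ∀ r, L r = ∑ k, X k * (r k : MvPolynomial (Fin 3) ℝ) := fun r => by simp [hL]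
  simp only [← hLr]
  change p ∈ LinearMap.range L
  rw [p.as_sum]
  refine Submodule.sum_mem _ fun s hs => ?_
  have hs0 : s ≠ 0 := fun h => by
    rw [h, mem_support_iff] at hs
    exact hs h0
  obtain ⟨i, hi⟩ := Finsupp.ne_iff.1 hs0
  have hi' : Finsupp.single i 1 ≤ s := by
    rw [Finsupp.single_le_iff]
    exact Nat.one_le_iff_ne_zero.2 hi
  refine ⟨Pi.single i ⟨monomial (s - Finsupp.single i 1) (coeff s p), ?_⟩, ?_⟩
  · rw [mem_restrictTotalDegree]
    refine (totalDegree_monomial_le _ _).trans ?_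
    have h1 := (le_totalDegree hs).trans hp
    have h2 : (s.sum fun _ e => e) =
        ((s - Finsupp.single i 1).sum fun _ e => e) + 1 := by
      conv_lhs => rw [← tsub_add_cancel_of_le hi']
      rw [Finsupp.sum_add_index' (by simp) (by simp), Finsupp.sum_single_index rfl]
    have h3 : ((s - Finsupp.single i 1).sum fun _ => id) =
        ((s - Finsupp.single i 1).sum fun _ e => e) := rfl
    omega
  · rw [hLr, Finset.sum_eq_single i]
    · rw [Pi.single_eq_same, X, monomial_mul, one_mul, add_tsub_cancel_of_le hi']
    · intro j _ hj
      rw [Pi.single_eq_of_ne hj]; simp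
    · simp

/-- Relations as triples of polynomials of bounded degree. -/
def relationsIncl (D : ℕ) :
    relations D →ₗ[ℝ] (Fin 3 → restrictTotalDegree (Fin 3) ℝ D) where
  toFun r k := ⟨r.1 k, (mem_restrictTotalDegree _ _ _).2 (r.2.1 k)⟩
  map_add' _ _ := rfl
  map_smul' _ _ := rfl

theorem relationsIncl_injective (D : ℕ) : Function.Injective (relationsIncl D) := by
  intro r s h
  refine Subtype.ext (_root_.funext fun k => ?_)
  exact congr_arg Subtype.val (congr_fun h k)

instance finite_relations (D : ℕ) : Module.Finite ℝ (relations D) :=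
  Module.Finite.of_injective (relationsIncl D) (relationsIncl_injective D)

/-- Rank-nullity for r ↦ ∑ Xₖrₖ on ℙ_D³: the range contains all polynomials of degree at most D + 1
without constant term, a subspace of codimension at most one in ℙ_{D+1}. -/
theorem finrank_relations_le (D : ℕ) :
    Module.finrank ℝ (relations D) + (D + 4).choose 3 ≤ 3 * (D + 3).choose 3 + 1 := by
  classical
  set V := restrictTotalDegree (Fin 3) ℝ D
  set W := restrictTotalDegree (Fin 3) ℝ (D + 1)
  set L : (Fin 3 → V) →ₗ[ℝ] MvPolynomial (Fin 3) ℝ :=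
    ∑ k, LinearMap.mulLeft ℝ (X k) ∘ₗ (Submodule.subtype _) ∘ₗ LinearMap.proj k with hL
  have hLr : ∀ r, L r = ∑ k, X k * (r k : MvPolynomial (Fin 3) ℝ) := fun r => by simp [hL]
  have hker : Module.finrank ℝ (relations D) ≤ Module.finrank ℝ (LinearMap.ker L) := by
    refine LinearMap.finrank_le_finrank_of_injective (f := LinearMap.codRestrict (LinearMap.ker L)
      (relationsIncl D) fun r => ?_) ?_
    · rw [LinearMap.mem_ker, hLr]
      exact r.2.2
    · intro r s h
      have h' := congr_arg Subtype.val h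
      exact relationsIncl_injective D h'
  have h1 : Module.finrank ℝ (LinearMap.range L) + Module.finrank ℝ (LinearMap.ker L) =
      Module.finrank ℝ (Fin 3 → V) := L.finrank_range_add_finrank_ker
  rw [Module.finrank_pi_fintype] at h1
  simp only [Finset.sum_const, Finset.card_univ, Fintype.card_fin, V,
    finrank_restrictTotalDegree, smul_eq_mul] at h1
  set φ : W →ₗ[ℝ] ℝ := lcoeff ℝ 0 ∘ₗ Submodule.subtype W with hφ
  have h2 := φ.finrank_range_add_finrank_ker
  have h3 : Module.finrank ℝ (LinearMap.range φ) ≤ 1 := by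
    simpa using Submodule.finrank_le (LinearMap.range φ)
  rw [show Module.finrank ℝ W = _ from finrank_restrictTotalDegree 3 (D + 1)] at h2
  have h4 : Module.finrank ℝ (LinearMap.ker φ) ≤ Module.finrank ℝ (LinearMap.range L) := by
    refine LinearMap.finrank_le_finrank_of_injective (f := LinearMap.codRestrict (LinearMap.range L)
      (Submodule.subtype W ∘ₗ Submodule.subtype (LinearMap.ker φ)) fun p => ?_) ?_
    · obtain ⟨r, hr⟩ := exists_sum_X_mul ((mem_restrictTotalDegree _ _ _).1 p.1.2)
        (show constantCoeff p.1.1 = 0 from p.2)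
      exact ⟨r, by rw [hLr, hr]; rfl⟩
    · intro p q h
      have h' := congr_arg Subtype.val h
      exact Subtype.ext (Subtype.ext h')
  have e : D + 1 + 3 = D + 4 := rfl
  rw [e] at h2
  have h6 := (Nat.add_le_add_right hker (Module.finrank ℝ (LinearMap.range L))).trans
    (le_of_eq ((Nat.add_comm _ _).trans h1))
  omega

/-- The barycentric gradients of a tetrahedron and the edge vectors. -/
theorem exists_gradients {a : Fin 4 → E3} (ha : AffineIndependent ℝ a) :
    ∃ g : Fin 4 → V3, (∀ m i j, i ≠ m → j ≠ m → g m ⬝ᵥ (a i - a j).ofLp = 0) ∧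
      ∀ M : M3, M.trace = 0 → (∀ m i j, i ≠ m → j ≠ m → g m ⬝ᵥ (M *ᵥ (a i - a j).ofLp) = 0) →
        M = 0 := by
  obtain ⟨w, hw⟩ := exists_dual_edgeVec (d := 3) ha
  have hsub : ∀ i j, (a i - a j).ofLp = (a i - a 0).ofLp - (a j - a 0).ofLp := fun i j => by
    simp
  have hdual : ∀ (k : Fin 3) (i : Fin 4), w k ⬝ᵥ (a i - a 0).ofLp = if i = k.succ then 1 else 0 := by
    intro k i
    refine Fin.cases ?_ (fun j => ?_) i
    · simp [(Fin.succ_ne_zero k).symm]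
    · rw [show (a j.succ - a 0).ofLp = edgeVec a j from rfl, hw]
      simp [eq_comm]
  refine ⟨Fin.cons (-∑ k, w k) w, fun m i j hi hj => ?_, fun M htr hM => ?_⟩
  · refine Fin.cases (fun hi hj => ?_) (fun k hi hj => ?_) m hi hj
    · rw [Fin.cons_zero, neg_dotProduct, sum_dotProduct]
      simp only [hsub i j, dotProduct_sub, hdual]
      obtain ⟨i, rfl⟩ := Fin.exists_succ_eq.2 hi
      obtain ⟨j, rfl⟩ := Fin.exists_succ_eq.2 hj
      simp
    · rw [Fin.cons_succ, hsub, dotProduct_sub, hdual, hdual, if_neg hi, if_neg hj, sub_zero]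
  · set W : M3 := Matrix.of w with hW
    set E : M3 := (Matrix.of (edgeVec a))ᵀ with hE
    have hWE : W * E = 1 := by
      ext i j
      rw [Matrix.one_apply, ← hw i j]
      rfl
    have hEW : E * W = 1 := mul_eq_one_comm.1 hWE
    have hN : ∀ i j, (W * M * E) i j = w i ⬝ᵥ (M *ᵥ edgeVec a j) := fun i j => by
      rw [Matrix.mul_assoc, Matrix.mul_apply]; rfl
    -- W M E is M in the basis of edge vectors at the first vertex. The conditions at the other
    -- vertices kill its off-diagonal entries and those at the first vertex equate the diagonal
    -- ones, leaving a multiple of the identity with trace zero.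
    have hoff : ∀ i j, i ≠ j → (W * M * E) i j = 0 := fun i j hij => by
      rw [hN]
      exact hM i.succ j.succ 0 (by simpa using hij.symm) (Fin.succ_ne_zero _).symm
    have hdiag : ∀ i j, i ≠ j → (W * M * E) i i = (W * M * E) j j := fun i j hij => by
      have h1 := hM 0 i.succ j.succ (Fin.succ_ne_zero _) (Fin.succ_ne_zero _)
      rw [hsub, Fin.cons_zero, neg_dotProduct, sum_dotProduct, neg_eq_zero] at h1
      have h2 : ∀ k, w k ⬝ᵥ (M *ᵥ ((a i.succ - a 0).ofLp - (a j.succ - a 0).ofLp)) =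
          (W * M * E) k i - (W * M * E) k j := fun k => by
        rw [hN, hN, mulVec_sub, dotProduct_sub]; rfl
      simp only [h2, Finset.sum_sub_distrib] at h1
      rwa [Finset.sum_eq_single i (fun k _ hk => hoff k i hk) (by simp),
        Finset.sum_eq_single j (fun k _ hk => hoff k j hk) (by simp), sub_eq_zero] at h1
    have htr2 : (W * M * E).trace = 0 := by
      rw [Matrix.trace_mul_comm, ← Matrix.mul_assoc, hEW, Matrix.one_mul, htr]
    have h00 : (W * M * E) 0 0 = 0 := by
      rw [Matrix.trace_fin_three, ← hdiag 0 1 (by decide), ← hdiag 0 2 (by decide)] at htr2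
      linarith
    have hz : W * M * E = 0 := by
      ext i j
      rcases eq_or_ne i j with rfl | hij
      · rcases eq_or_ne 0 i with rfl | hi
        · exact h00
        · rw [← hdiag 0 i hi, h00]; rfl
      · exact hoff i j hij
    calc M = (E * W) * M * (E * W) := by rw [hEW, Matrix.one_mul, Matrix.mul_one]
      _ = E * (W * M * E) * W := by simp only [Matrix.mul_assoc]
      _ = 0 := by rw [hz, Matrix.mul_zero, Matrix.zero_mul]

theorem bil_add (g t : V3) (A B : PolM) : bil g t (A + B) = bil g t A + bil g t B := by
  simp [bil, mul_add, Finset.sum_add_distrib]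

theorem bil_smul (g t : V3) (c : ℝ) (A : PolM) : bil g t (c • A) = c • bil g t A := by
  simp [bil, Finset.smul_sum]

/-- The vertices of a tetrahedron, listed with the vertex `m` first. -/
def vertexFirst (a : Fin 4 → E3) (m : Fin 4) : Fin 4 → E3 := Fin.cons (a m) (a ∘ m.succAbove)

theorem Orders.vertexFirst {a : Fin 4 → E3} {K : Finset E3} (h : Orders a K) (m : Fin 4) :
    Orders (vertexFirst a m) K := by
  set f : Fin 4 → Fin 4 := Fin.cons m m.succAbove with hf
  have hinj : Function.Injective f := by
    rw [hf]; revert m; decide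
  have e : SymCurlFEM.vertexFirst a m = a ∘ f := by
    ext1 i
    refine Fin.cases rfl (fun _ => rfl) i
  rw [e]
  refine ⟨h.1.comp_embedding ⟨f, hinj⟩, ?_⟩
  rw [(Finite.injective_iff_surjective.1 hinj).range_comp, h.2]

/-- The vertices of a tetrahedron span the space affinely, so the chart reaches every point. -/
theorem eq_zero_of_pull_eq_zero {a : Fin 4 → E3} (ha : AffineIndependent ℝ a) {p : Pol}
    (hp : pull a p = 0) : p = 0 := by
  refine MvPolynomial.funext fun x => ?_
  have hx : WithLp.toLp 2 x ∈ affineSpan ℝ (Set.range a) := by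
    rw [ha.affineSpan_eq_top_iff_card_eq_finrank_add_one.2 (by simp)]
    trivial
  obtain ⟨v, hv, hvx⟩ := eq_affineCombination_of_mem_affineSpan_of_fintype hx
  have h : WithLp.toLp 2 x = chart a fun j => v j.succ := by
    rw [hvx, Finset.affineCombination_eq_linear_combination _ _ _ hv, chart_eq_sum,
      Fin.sum_univ_succ]
    rw [Fin.sum_univ_succ] at hv
    rw [← hv, add_sub_cancel_right]
  have h2 : eval (WithLp.toLp 2 x).ofLp p = 0 := by rw [h, ← eval_pull, hp, map_zero]
  rw [map_zero]
  exact h2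

theorem eq_zero_of_val_eq_zero {A : PolM} (h : ∀ x, val A x = 0) : A = 0 := by
  ext1 i j
  refine MvPolynomial.funext fun x => ?_
  simpa [val] using congr_fun (congr_fun (h (WithLp.toLp 2 x)) i) j

/-- The map Ψ records gᵀτt for each vertex and each edge of the opposite face. It is injective
because these numbers determine a trace-free tensor, and its values are built by Θ from one relation
per vertex. -/
theorem finrank_bubble_le {fr : Frame} {ℓ : ℕ} (hℓ : 1 ≤ ℓ) {K : Finset E3} (hK : IsTetrahedron K)
    (hfr : fr.Good K) :
    Module.finrank ℝ (bubble fr (ℓ + 1) K) ≤ 4 * Module.finrank ℝ (relations (ℓ - 1)) := by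
  obtain ⟨a, ha⟩ := exists_orders (d := 3) hK.1 hK.2
  obtain ⟨g, hg1, hg2⟩ := exists_gradients ha.1
  have hopp : ∀ m k, oppEdge (vertexFirst a m) k =
      (a (m.succAbove (k + 2)) - a (m.succAbove (k + 1))).ofLp := fun m k => rfl
  set Θ : (Fin 4 → relations (ℓ - 1)) →ₗ[ℝ] (Fin 4 → Fin 3 → MvPolynomial (Fin 3) ℝ) :=
    LinearMap.pi fun m => LinearMap.pi fun k =>
      LinearMap.mulLeft ℝ (affForm (fun _ => -1) 1) ∘ₗ LinearMap.mulLeft ℝ (X k) ∘ₗ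
        LinearMap.proj k ∘ₗ Submodule.subtype _ ∘ₗ LinearMap.proj m with hΘ
  set Ψ : bubble fr (ℓ + 1) K →ₗ[ℝ] (Fin 4 → Fin 3 → MvPolynomial (Fin 3) ℝ) :=
    { toFun := fun τ m k => pull (vertexFirst a m) (bil (g m) (oppEdge (vertexFirst a m) k) τ.1)
      map_add' := fun τ σ => by ext1 m; ext1 k; simp [bil_add]
      map_smul' := fun c τ => by ext1 m; ext1 k; simp [bil_smul] } with hΨ
  have hrange : ∀ τ, Ψ τ ∈ LinearMap.range Θ := fun τ => by
    have h := fun m => exists_relation_of_mem_bubble hℓ (ha.vertexFirst m) hfr (g := g m)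
      (fun k => by
        rw [hopp]
        exact hg1 m _ _ (Fin.succAbove_ne _ _) (Fin.succAbove_ne _ _)) τ.2
    choose r hr1 hr2 using h
    refine ⟨fun m => ⟨r m, hr1 m⟩, ?_⟩
    ext1 m; ext1 k
    exact (hr2 m k).symm
  have hinj : Function.Injective Ψ := by
    rw [← LinearMap.ker_eq_bot, LinearMap.ker_eq_bot']
    intro τ hτ
    refine Subtype.ext (eq_zero_of_val_eq_zero fun x => hg2 _ ?_ ?_)
    · have h1 := congr_arg (eval x.ofLp) τ.2.1.1
      simpa [val, Matrix.trace] using h1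
    · have h2 : ∀ m k, g m ⬝ᵥ (val τ.1 x *ᵥ (a (m.succAbove (k + 2)) -
          a (m.succAbove (k + 1))).ofLp) = 0 := by
        intro m k
        rw [← hopp, ← eval_bil]
        rw [eq_zero_of_pull_eq_zero (ha.vertexFirst m).1 (congr_fun (congr_fun hτ m) k), map_zero]
      -- The three cyclic edges of the opposite face, with either orientation, are all pairs of
      -- distinct vertices other than m.
      have h3 : ∀ m i j : Fin 4, i ≠ m → j ≠ m → i = j ∨
          ∃ k, (i = m.succAbove (k + 2) ∧ j = m.succAbove (k + 1)) ∨
            (i = m.succAbove (k + 1) ∧ j = m.succAbove (k + 2)) := by decide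
      intro m i j hi hj
      rcases h3 m i j hi hj with rfl | ⟨k, ⟨rfl, rfl⟩ | ⟨rfl, rfl⟩⟩
      · simp
      · exact h2 m k
      · rw [← neg_sub, WithLp.ofLp_neg, mulVec_neg, dotProduct_neg, h2, neg_zero]
  calc Module.finrank ℝ (bubble fr (ℓ + 1) K) ≤ Module.finrank ℝ (LinearMap.range Θ) :=
        LinearMap.finrank_le_finrank_of_injective (f := Ψ.codRestrict _ hrange)
          fun x y h => hinj (congr_arg Subtype.val h)
    _ ≤ Module.finrank ℝ (Fin 4 → relations (ℓ - 1)) := LinearMap.finrank_range_le Θ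
    _ = _ := by rw [Module.finrank_pi_fintype]; simp

instance finite_polyT (k : ℕ) : Module.Finite ℝ (polyT k) :=
  Module.Finite.of_injective
    (LinearMap.pi fun i => LinearMap.pi fun j => LinearMap.codRestrict
      (restrictTotalDegree (Fin 3) ℝ k)
      ((LinearMap.proj j ∘ₗ LinearMap.proj i : (Fin 3 → Fin 3 → Pol) →ₗ[ℝ] Pol) ∘ₗ
        (polyT k).subtype) fun A => A.2.2 i j)
    fun A B h => Subtype.ext (by
      ext1 i j
      exact congr_arg Subtype.val (congr_fun (congr_fun h i) j))

instance finite_bubble (fr : Frame) (k : ℕ) (K : Finset E3) : Module.Finite ℝ (bubble fr k K) :=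
  Module.Finite.of_injective (Submodule.inclusion (fun _ hA => hA.1 : bubble fr k K ≤ polyT k))
    (Submodule.inclusion_injective _)

/-- Rank-nullity for the trace from nine copies of ℙ_k to one; the lower bound suffices for the
count. -/
theorem le_finrank_polyT (k : ℕ) : 8 * (k + 3).choose 3 ≤ Module.finrank ℝ (polyT k) := by
  set V := restrictTotalDegree (Fin 3) ℝ k
  set T : (Fin 3 → Fin 3 → V) →ₗ[ℝ] V := ∑ i, LinearMap.proj i ∘ₗ LinearMap.proj i with hT
  have h1 := T.finrank_range_add_finrank_ker
  have h2 := Submodule.finrank_le (LinearMap.range T)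
  have h3 : Module.finrank ℝ (Fin 3 → Fin 3 → V) = 9 * (k + 3).choose 3 := by
    rw [Module.finrank_pi_fintype]
    simp only [Module.finrank_pi_fintype, V, finrank_restrictTotalDegree]
    simp
    ring
  rw [show Module.finrank ℝ V = _ from finrank_restrictTotalDegree 3 k] at h2
  have h4 : Module.finrank ℝ (LinearMap.ker T) ≤ Module.finrank ℝ (polyT k) := by
    refine LinearMap.finrank_le_finrank_of_injective (f := LinearMap.codRestrict (polyT k)
      ({ toFun := fun A => Matrix.of fun i j => (A.1 i j).1
         map_add' := fun A B => rfl
         map_smul' := fun c A => rfl } : LinearMap.ker T →ₗ[ℝ] PolM) fun A => ⟨?_, fun i j =>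
        (A.1 i j).2⟩) ?_
    · have h5 := congr_arg Subtype.val (LinearMap.mem_ker.1 A.2)
      have h6 : ∀ A, T A = ∑ i, A i i := fun A => by simp [hT]
      rw [h6, AddSubmonoidClass.coe_finsetSum] at h5
      exact h5
    · intro A B h
      refine Subtype.ext (funext fun i => funext fun j => Subtype.ext ?_)
      exact congr_fun (congr_fun (congr_arg Subtype.val h) i) j
  omega

end Dimensions

/-! ### The dimensions of the test spaces -/

section TestSpaces

open MvPolynomial

theorem finite_of_le_range {V Y : Type*} [AddCommGroup V] [Module ℝ V] [Module.Finite ℝ V]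
    [AddCommGroup Y] [Module ℝ Y] {W : Submodule ℝ Y} {f : V →ₗ[ℝ] Y} (h : W ≤ LinearMap.range f) :
    Module.Finite ℝ W :=
  Module.Finite.of_injective (Submodule.inclusion h) (Submodule.inclusion_injective h)

theorem finrank_le_of_le_range {V Y : Type*} [AddCommGroup V] [Module ℝ V] [Module.Finite ℝ V]
    [AddCommGroup Y] [Module ℝ Y] {W : Submodule ℝ Y} {f : V →ₗ[ℝ] Y} (h : W ≤ LinearMap.range f) :
    Module.finrank ℝ W ≤ Module.finrank ℝ V :=
  (Submodule.finrank_mono h).trans f.finrank_range_le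

/-- An exhibited part of the kernel lowers the bound. It is used for the constants killed by ∇_F and
the affine functions killed by (∇_F^⊥)². -/
theorem finrank_add_le_of_le_range {V Y U : Type*} [AddCommGroup V] [Module ℝ V]
    [Module.Finite ℝ V] [AddCommGroup Y] [Module ℝ Y] [AddCommGroup U] [Module ℝ U]
    {W : Submodule ℝ Y} {f : V →ₗ[ℝ] Y} (h : W ≤ LinearMap.range f) {g : U →ₗ[ℝ] V}
    (hg : Function.Injective g) (hfg : ∀ u, f (g u) = 0) :
    Module.finrank ℝ W + Module.finrank ℝ U ≤ Module.finrank ℝ V := by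
  rw [← f.finrank_range_add_finrank_ker]
  refine add_le_add (Submodule.finrank_mono h) ?_
  exact LinearMap.finrank_le_finrank_of_injective (f := g.codRestrict (LinearMap.ker f) hfg)
    fun x y h => hg (congr_arg Subtype.val h)

section General

variable {d : ℕ} {a : Fin (d + 1) → E3} {s : Finset E3}

/-- The restriction of polynomials to a simplex. -/
noncomputable def restrictPol (s : Finset E3) : Pol →ₗ[ℝ] (hull s → ℝ) where
  toFun p x := eval x.1.ofLp p
  map_add' p q := by ext; simp
  map_smul' c p := by ext; simp

/-- A restriction to s depends only on the pullback by the chart, which has d variables instead of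
three. -/
theorem Orders.exists_polyOn_le (h : Orders a s) (k : ℕ) :
    ∃ f : restrictTotalDegree (Fin d) ℝ k →ₗ[ℝ] (hull s → ℝ), polyOn k s ≤ LinearMap.range f := by
  obtain ⟨L, hL⟩ := exists_liftHom h.1
  refine ⟨restrictPol s ∘ₗ L.toLinearMap ∘ₗ Submodule.subtype _, fun q hq => ?_⟩
  obtain ⟨p, hp, rfl⟩ := mem_polyOn_iff.1 hq
  refine ⟨⟨pull a p, (mem_restrictTotalDegree _ _ _).2 ((totalDegree_pull_le a p).trans hp)⟩, ?_⟩
  ext ⟨x, hx⟩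
  have hx' := hx
  rw [h.hull_eq] at hx'
  obtain ⟨y, -, rfl⟩ := hx'
  change eval (chart a y).ofLp (L (pull a p)) = eval (chart a y).ofLp p
  rw [← eval_pull, (hL _).2, eval_pull]

theorem Orders.finite_polyOn (h : Orders a s) (k : ℕ) : Module.Finite ℝ (polyOn k s) := by
  obtain ⟨f, hf⟩ := h.exists_polyOn_le k
  exact finite_of_le_range hf

theorem Orders.finrank_polyOn_le (h : Orders a s) (k : ℕ) :
    Module.finrank ℝ (polyOn k s) ≤ (k + d).choose d := by
  obtain ⟨f, hf⟩ := h.exists_polyOn_le k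
  exact (finrank_le_of_le_range hf).trans (finrank_restrictTotalDegree d k).le

end General

variable {a : Fin 3 → E3} {F : Finset E3} {fr : Frame}

theorem Orders.exists_cross_eq (h : Orders a F) (hfr : fr.GoodFace F) :
    ∃ j : ℝ, j ≠ 0 ∧ edgeVec a 0 ⨯₃ edgeVec a 1 = j • fr.n F :=
  exists_cross_eq_smul h.1 hfr.1 (hfr.2.1 _ (h.mem 0) _ (h.mem 1))
    (hfr.2.1 _ (h.mem 0) _ (h.mem 2))

/-- The restriction of surface gradients to a face. -/
noncomputable def restrictGrad (n : V3) (F : Finset E3) : Pol →ₗ[ℝ] (hull F → V3) where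
  toFun p x i := eval x.1.ofLp (surfGrad n p i)
  map_add' p q := by
    ext x i
    fin_cases i <;> simp [surfGrad, surfCurl, cross_apply] <;> ring
  map_smul' c p := by
    ext x i
    fin_cases i <;> simp [surfGrad, surfCurl, cross_apply] <;> ring

/-- The restriction of second surface derivatives to a face. -/
noncomputable def restrictHess (n : V3) (F : Finset E3) : Pol →ₗ[ℝ] (hull F → M3) where
  toFun p x := val (surfCurl₂ n p) x.1
  map_add' p q := by
    ext x i j
    fin_cases i <;> fin_cases j <;> simp [surfCurl₂, surfCurl, cross_apply, val] <;> ring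
  map_smul' c p := by
    ext x i j
    fin_cases i <;> fin_cases j <;> simp [surfCurl₂, surfCurl, cross_apply, val] <;> ring

/-- The edge vectors span the tangent plane, so the surface gradient on F is determined by the
derivatives of the pullback. Hence polynomials in three variables may be replaced by polynomials on
the reference triangle when dimensions are bounded. -/
theorem restrictGrad_eq_zero (h : Orders a F) (hfr : fr.GoodFace F) {p : Pol}
    (hp : ∀ i, pderiv i (pull a p) = 0) : restrictGrad (fr.n F) F p = 0 := by
  obtain ⟨j, hj0, hj⟩ := h.exists_cross_eq hfr
  ext1 ⟨x, hx⟩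
  have hx' := hx
  rw [h.hull_eq] at hx'
  obtain ⟨y, -, rfl⟩ := hx'
  have h1 : (fun i => eval (chart a y).ofLp (surfGrad (fr.n F) p i)) =
      (fr.n F ⨯₃ fun k => eval (chart a y).ofLp (pderiv k p)) ⨯₃ fr.n F := by
    ext i
    fin_cases i <;> simp [surfGrad, surfCurl, cross_apply]
  have h2 : ∀ i, edgeVec a i ⬝ᵥ (fun k => eval (chart a y).ofLp (pderiv k p)) = 0 := fun i => by
    have h3 := congr_arg (eval y) (hp i)
    rw [pderiv_pull, eval_pull, map_zero] at h3
    simpa [dirPol, dotProduct] using h3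
  have h4 : j • (fr.n F ⨯₃ fun k => eval (chart a y).ofLp (pderiv k p)) = 0 := by
    have h5 := cross_cross_left (edgeVec a 1) (edgeVec a 0)
      (fun k => eval (chart a y).ofLp (pderiv k p))
    rw [h2, h2, hj] at h5
    simpa using h5
  change (fun i => eval (chart a y).ofLp (surfGrad (fr.n F) p i)) = 0
  rw [h1, (smul_eq_zero.1 h4).resolve_left hj0]
  simp

theorem restrictHess_eq_zero (h : Orders a F) (hfr : fr.GoodFace F) {p : Pol}
    (hp : ∀ i j, pderiv i (pderiv j (pull a p)) = 0) : restrictHess (fr.n F) F p = 0 := by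
  obtain ⟨j, hj0, hj⟩ := h.exists_cross_eq hfr
  ext1 ⟨x, hx⟩
  have hx' := hx
  rw [h.hull_eq] at hx'
  obtain ⟨y, -, rfl⟩ := hx'
  change val (surfCurl₂ (fr.n F) p) (chart a y) = 0
  rw [val_surfCurl₂]
  have h1 := surfHess_smul j (fr.n F)
    (Matrix.of fun k l => eval (chart a y).ofLp (pderiv k (pderiv l p)))
  rw [← hj, surfHess_cross] at h1
  simp only [← eval_pderiv_pderiv_pull, hp, map_zero, zero_smul, sub_zero, add_zero] at h1
  exact (smul_eq_zero.1 h1.symm).resolve_left (mul_ne_zero hj0 hj0)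

/-- Multiplication of the rotated position vector by a function on a face. -/
noncomputable def rotatedPosition (fr : Frame) (k : ℕ) (F : Finset E3) :
    polyOn k F →ₗ[ℝ] (hull F → V3) where
  toFun q x := q.1 x • ((x.1 - fr.o F).ofLp ⨯₃ fr.n F)
  map_add' p q := by
    ext x i
    simp [add_mul]
  map_smul' c p := by
    ext x i
    simp [mul_assoc]

/-- Only upper bounds are needed, so directness of the sum is never required. -/
theorem faceVectorTest_parts (h : Orders a F) (hfr : fr.GoodFace F) (ℓ : ℕ) :
    ∃ W₁ W₂ : Submodule ℝ (hull F → V3), faceVectorTest fr ℓ F = W₁ ⊔ W₂ ∧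
      Module.Finite ℝ W₁ ∧ Module.Finite ℝ W₂ ∧
      Module.finrank ℝ W₁ + 1 ≤ (ℓ - 3 + 2).choose 2 ∧
      Module.finrank ℝ W₂ ≤ (ℓ - 1 + 2).choose 2 := by
  obtain ⟨L, hL⟩ := exists_liftHom h.1
  refine ⟨_, _, rfl, ?_⟩
  have h1 : Submodule.span ℝ {v : hull F → V3 | ∃ p ∈ restrictTotalDegree (Fin 3) ℝ (ℓ - 3),
      v = fun x i => eval x.1.ofLp (surfGrad (fr.n F) p i)} ≤
      LinearMap.range (restrictGrad (fr.n F) F ∘ₗ L.toLinearMap ∘ₗ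
        (restrictTotalDegree (Fin 2) ℝ (ℓ - 3)).subtype) := by
    rw [Submodule.span_le]
    rintro v ⟨p, hp, rfl⟩
    refine ⟨⟨pull a p, (mem_restrictTotalDegree _ _ _).2 ((totalDegree_pull_le a p).trans
      ((mem_restrictTotalDegree _ _ _).1 hp))⟩, ?_⟩
    change restrictGrad (fr.n F) F (L (pull a p)) = restrictGrad (fr.n F) F p
    rw [← sub_eq_zero, ← map_sub]
    refine restrictGrad_eq_zero h hfr fun i => ?_
    rw [map_sub, (hL _).2, sub_self, map_zero]
  have h2 : Submodule.span ℝ {v : hull F → V3 | ∃ q ∈ polyOn (ℓ - 1) F,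
      v = fun x => q x • ((x.1 - fr.o F).ofLp ⨯₃ fr.n F)} ≤
      LinearMap.range (rotatedPosition fr (ℓ - 1) F) := by
    rw [Submodule.span_le]
    rintro v ⟨q, hq, rfl⟩
    exact ⟨⟨q, hq⟩, rfl⟩
  have := h.finite_polyOn (ℓ - 1)
  refine ⟨finite_of_le_range h1, finite_of_le_range h2, ?_,
    (finrank_le_of_le_range h2).trans (h.finrank_polyOn_le _)⟩
  -- Constants have zero surface gradient, which accounts for the one dimension gained.
  have h3 := finrank_add_le_of_le_range h1
    (g := LinearMap.toSpanSingleton ℝ (restrictTotalDegree (Fin 2) ℝ (ℓ - 3))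
      ⟨1, (mem_restrictTotalDegree _ _ _).2 (by simp)⟩) (fun c d hcd => by
      have := congr_arg (fun p => eval 0 p.1) hcd
      simpa using this) (fun c => by
      rw [LinearMap.toSpanSingleton_apply, map_smul]
      have : restrictGrad (fr.n F) F (L 1) = 0 :=
        restrictGrad_eq_zero h hfr fun i => by rw [(hL _).2]; simp
      exact (congr_arg (c • ·) this).trans (smul_zero c))
  rwa [finrank_restrictTotalDegree, Module.finrank_self] at h3

theorem finrank_faceVectorTest_le (h : Orders a F) (hfr : fr.GoodFace F) (ℓ : ℕ) :
    Module.Finite ℝ (faceVectorTest fr ℓ F) ∧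
    Module.finrank ℝ (faceVectorTest fr ℓ F) + 1 ≤
      (ℓ - 3 + 2).choose 2 + (ℓ - 1 + 2).choose 2 := by
  obtain ⟨W₁, W₂, h0, h1, h2, h3, h4⟩ := faceVectorTest_parts h hfr ℓ
  rw [h0]
  have := Submodule.finrank_add_le_finrank_add_finrank W₁ W₂
  exact ⟨inferInstance, by omega⟩

/-- Symmetric tensors `sym (x ⊗ v)` for tangential fields `v` with given components. -/
noncomputable def symPosition (fr : Frame) (k : ℕ) (F : Finset E3) (u w : V3) :
    (polyOn k F × polyOn k F) →ₗ[ℝ] (hull F → M3) where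
  toFun q x := sym (vecMulVec (x.1 - fr.o F).ofLp (q.1.1 x • u + q.2.1 x • w))
  map_add' p q := by
    ext x i j
    simp [sym, vecMulVec]
    ring
  map_smul' c p := by
    ext x i j
    simp [sym, vecMulVec]
    ring

/-- The coefficients in the basis of edge vectors are products with the constant dual vectors (a₁ ×
n)/j and −(a₀ × n)/j, where a₀ and a₁ are the edge vectors, hence polynomials of the same degree. -/
theorem IsTangPoly.exists_components (h : Orders a F) (hfr : fr.GoodFace F) {k : ℕ}
    {v : hull F → V3} (hv : IsTangPoly fr k F v) : ∃ q₁ ∈ polyOn k F, ∃ q₂ ∈ polyOn k F,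
      v = fun x => q₁ x • edgeVec a 0 + q₂ x • edgeVec a 1 := by
  obtain ⟨j, hj0, hj⟩ := h.exists_cross_eq hfr
  have hc : ∀ c : V3, (fun x => c ⬝ᵥ v x) ∈ polyOn k F := fun c => by
    have : (fun x => c ⬝ᵥ v x) = ∑ i, c i • fun x => v x i := by
      ext x; simp [dotProduct]
    rw [this]
    exact Submodule.sum_mem _ fun i _ => Submodule.smul_mem _ _ (hv.1 i)
  refine ⟨_, hc (j⁻¹ • (edgeVec a 1 ⨯₃ fr.n F)), _, hc (-(j⁻¹ • (edgeVec a 0 ⨯₃ fr.n F))), ?_⟩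
  ext1 x
  have h1 := cross_cross_left (edgeVec a 1) (edgeVec a 0) (fr.n F ⨯₃ v x)
  rw [hj, map_smul, LinearMap.smul_apply, cross_cross_unit hfr.1 (hv.2 x)] at h1
  have h2 : v x = j⁻¹ • (j • v x) := by rw [smul_smul, inv_mul_cancel₀ hj0, one_smul]
  have h3 : ∀ u : V3, u ⬝ᵥ (fr.n F ⨯₃ v x) = (u ⨯₃ fr.n F) ⬝ᵥ v x := fun u => by
    simp only [dot_eq, cross_eq]; simp; ring
  rw [h3, h3, smul_neg, neg_eq_iff_eq_neg] at h1
  refine h2.trans ?_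
  rw [h1]
  simp only [neg_dotProduct, smul_dotProduct, smul_eq_mul, smul_sub, smul_smul, neg_sub, neg_smul]
  abel

theorem faceTensorTest_parts (h : Orders a F) (hfr : fr.GoodFace F) {ℓ : ℕ} (hℓ : 2 ≤ ℓ) :
    ∃ W₁ W₂ : Submodule ℝ (hull F → M3), faceTensorTest fr ℓ F = W₁ ⊔ W₂ ∧
      Module.Finite ℝ W₁ ∧ Module.Finite ℝ W₂ ∧
      Module.finrank ℝ W₁ + 3 ≤ (ℓ - 1 + 2).choose 2 ∧
      Module.finrank ℝ W₂ ≤ 2 * (ℓ - 1 + 2).choose 2 := by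
  obtain ⟨L, hL⟩ := exists_liftHom h.1
  refine ⟨_, _, rfl, ?_⟩
  have h1 : Submodule.span ℝ {ς : hull F → M3 | ∃ p ∈ restrictTotalDegree (Fin 3) ℝ (ℓ - 1),
      ς = fun x => val (surfCurl₂ (fr.n F) p) x.1} ≤
      LinearMap.range (restrictHess (fr.n F) F ∘ₗ L.toLinearMap ∘ₗ
        (restrictTotalDegree (Fin 2) ℝ (ℓ - 1)).subtype) := by
    rw [Submodule.span_le]
    rintro v ⟨p, hp, rfl⟩
    refine ⟨⟨pull a p, (mem_restrictTotalDegree _ _ _).2 ((totalDegree_pull_le a p).trans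
      ((mem_restrictTotalDegree _ _ _).1 hp))⟩, ?_⟩
    change restrictHess (fr.n F) F (L (pull a p)) = restrictHess (fr.n F) F p
    rw [← sub_eq_zero, ← map_sub]
    refine restrictHess_eq_zero h hfr fun i j => ?_
    rw [map_sub, (hL _).2, sub_self, map_zero, map_zero]
  have h2 : Submodule.span ℝ {ς : hull F → M3 | ∃ v, IsTangPoly fr (ℓ - 1) F v ∧
      ς = fun x => sym (vecMulVec (x.1 - fr.o F).ofLp (v x))} ≤
      LinearMap.range (symPosition fr (ℓ - 1) F (edgeVec a 0) (edgeVec a 1)) := by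
    rw [Submodule.span_le]
    rintro v ⟨v, hv, rfl⟩
    obtain ⟨q₁, hq₁, q₂, hq₂, rfl⟩ := hv.exists_components h hfr
    exact ⟨(⟨q₁, hq₁⟩, ⟨q₂, hq₂⟩), rfl⟩
  have := h.finite_polyOn (ℓ - 1)
  refine ⟨finite_of_le_range h1, finite_of_le_range h2, ?_, ?_⟩
  -- The three-dimensional space of affine functions has zero second derivatives, and it lies in the
  -- test degree because ℓ − 1 ≥ 1.
  · have h3 := finrank_add_le_of_le_range h1 (U := restrictTotalDegree (Fin 2) ℝ 1)
      (g := Submodule.inclusion fun p hp => (mem_restrictTotalDegree _ _ _).2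
        (((mem_restrictTotalDegree _ _ _).1 hp).trans (by omega))) (Submodule.inclusion_injective _)
      (fun q => restrictHess_eq_zero h hfr fun i j => by
        have hq := (mem_restrictTotalDegree _ _ _).1 q.2
        have h4 : (pderiv j q.1).totalDegree ≤ 0 := totalDegree_pderiv_le_of_le hq
        have h5 := totalDegree_eq_zero_iff_eq_C.1 (Nat.le_zero.1 h4)
        change pderiv i (pderiv j (pull a (L q.1))) = 0
        rw [(hL _).2, h5, pderiv_C])
    rwa [finrank_restrictTotalDegree, finrank_restrictTotalDegree] at h3
  · refine (finrank_le_of_le_range h2).trans ?_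
    rw [Module.finrank_prod]
    have := h.finrank_polyOn_le (ℓ - 1)
    omega

theorem finrank_faceTensorTest_le (h : Orders a F) (hfr : fr.GoodFace F) {ℓ : ℕ} (hℓ : 2 ≤ ℓ) :
    Module.Finite ℝ (faceTensorTest fr ℓ F) ∧
    Module.finrank ℝ (faceTensorTest fr ℓ F) + 3 ≤ 3 * (ℓ - 1 + 2).choose 2 := by
  obtain ⟨W₁, W₂, h0, h1, h2, h3, h4⟩ := faceTensorTest_parts h hfr hℓ
  rw [h0]
  have := Submodule.finrank_add_le_finrank_add_finrank W₁ W₂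
  exact ⟨inferInstance, by omega⟩

end TestSpaces

/-! ### Moments as linear functionals -/

section Moments

open MvPolynomial

/-- The integrand `B` defines a bilinear pairing of tensor polynomials with the space `W`. -/
structure IsMoment {X M : Type*} [MeasurableSpace X] [AddCommGroup M] [Module ℝ M] (μ : Measure X)
    (W : Submodule ℝ M) (B : PolM → M → X → ℝ) : Prop where
  add_left : ∀ τ σ q x, B (τ + σ) q x = B τ q x + B σ q x
  smul_left : ∀ (c : ℝ) τ q x, B (c • τ) q x = c * B τ q x
  add_right : ∀ τ q r x, B τ (q + r) x = B τ q x + B τ r x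
  smul_right : ∀ (c : ℝ) τ q x, B τ (c • q) x = c * B τ q x
  integrable : ∀ τ, ∀ q ∈ W, Integrable (B τ q) μ

/-- The moments of a tensor polynomial as a linear functional on the test space. -/
noncomputable def IsMoment.map {X M : Type*} [MeasurableSpace X] [AddCommGroup M] [Module ℝ M]
    {μ : Measure X} {W : Submodule ℝ M} {B : PolM → M → X → ℝ} (h : IsMoment μ W B) :
    PolM →ₗ[ℝ] Module.Dual ℝ W :=
  LinearMap.mk₂ ℝ (fun τ q => ∫ x, B τ q x ∂μ)
    (fun τ σ q => by
      simp only [h.add_left]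
      exact integral_add (h.integrable τ q q.2) (h.integrable σ q q.2))
    (fun c τ q => by
      simp only [h.smul_left]
      exact integral_const_mul _ _)
    (fun τ q r => by
      simp only [Submodule.coe_add, h.add_right]
      exact integral_add (h.integrable τ q q.2) (h.integrable τ r r.2))
    (fun c τ q => by
      simp only [Submodule.coe_smul, h.smul_right]
      exact integral_const_mul _ _)

theorem IsMoment.map_apply {X M : Type*} [MeasurableSpace X] [AddCommGroup M] [Module ℝ M]
    {μ : Measure X} {W : Submodule ℝ M} {B : PolM → M → X → ℝ} (h : IsMoment μ W B) (τ : PolM)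
    (q : W) : h.map τ q = ∫ x, B τ q x ∂μ := rfl

variable {d : ℕ} {a : Fin (d + 1) → E3} {s : Finset E3}

instance compactSpace_hull (s : Finset E3) : CompactSpace (hull s) :=
  isCompact_iff_compactSpace.1 (isCompact_hull s)

theorem Orders.isFiniteMeasure (h : Orders a s) :
    IsFiniteMeasure ((μHE[d] : Measure E3).comap (Subtype.val : hull s → E3)) := by
  refine ⟨?_⟩
  rw [(MeasurableEmbedding.subtype_coe (measurableSet_hull s)).comap_apply, Set.image_univ,
    Subtype.range_coe, h.hull_eq, euclideanHausdorffMeasure_image_chart]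
  exact ENNReal.mul_lt_top ENNReal.ofReal_lt_top (isCompact_refSimplex d).measure_lt_top

theorem Orders.integrable (h : Orders a s) {f : hull s → ℝ} (hf : Continuous f) :
    Integrable f ((μHE[d] : Measure E3).comap (Subtype.val : hull s → E3)) := by
  have := h.isFiniteMeasure
  exact hf.integrable_of_hasCompactSupport (HasCompactSupport.of_compactSpace f)

theorem continuous_eval_hull (p : Pol) : Continuous fun x : hull s => eval x.1.ofLp p :=
  (continuous_eval p).comp ((PiLp.continuous_ofLp 2 _).comp continuous_subtype_val)

theorem continuous_val (τ : PolM) : Continuous (val τ) :=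
  continuous_matrix fun i j => (continuous_eval (τ i j)).comp (PiLp.continuous_ofLp 2 _)

theorem continuous_of_mem_polyOn {k : ℕ} {q : hull s → ℝ} (hq : q ∈ polyOn k s) :
    Continuous q := by
  obtain ⟨p, -, rfl⟩ := mem_polyOn_iff.1 hq
  exact continuous_eval_hull p

theorem continuous_of_mem_span {X Y : Type*} [TopologicalSpace X] [TopologicalSpace Y]
    [AddCommGroup Y] [Module ℝ Y] [ContinuousAdd Y] [ContinuousConstSMul ℝ Y] {S : Set (X → Y)}
    (hS : ∀ f ∈ S, Continuous f) {f : X → Y} (hf : f ∈ Submodule.span ℝ S) : Continuous f := by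
  induction hf using Submodule.span_induction with
  | mem f hf => exact hS f hf
  | zero => exact continuous_const
  | add f g _ _ hf hg => exact hf.add hg
  | smul c f _ hf => exact hf.const_smul c

theorem continuous_ofLp_sub (o : E3) : Continuous fun x : hull s => (x.1 - o).ofLp :=
  (PiLp.continuous_ofLp 2 _).comp (continuous_subtype_val.sub continuous_const)

theorem continuous_of_mem_faceTensorTest {fr : Frame} {ℓ : ℕ} {ς : hull s → M3}
    (h : ς ∈ faceTensorTest fr ℓ s) : Continuous ς := by
  obtain ⟨ς₁, h1, ς₂, h2, rfl⟩ := Submodule.mem_sup.1 h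
  refine (continuous_of_mem_span ?_ h1).add (continuous_of_mem_span ?_ h2)
  · rintro _ ⟨p, -, rfl⟩
    exact (continuous_val _).comp continuous_subtype_val
  · rintro _ ⟨v, hv, rfl⟩
    have hv' : Continuous v := continuous_pi fun i => continuous_of_mem_polyOn (hv.1 i)
    have hx := continuous_ofLp_sub (s := s) (fr.o s)
    have h3 : Continuous fun x => vecMulVec (x.1 - fr.o s).ofLp (v x) :=
      continuous_matrix fun i j => ((continuous_apply i).comp hx).mul ((continuous_apply j).comp hv')
    exact (h3.add h3.matrix_transpose).const_smul (1 / 2 : ℝ)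

theorem continuous_of_mem_faceVectorTest {fr : Frame} {ℓ : ℕ} {v : hull s → V3}
    (h : v ∈ faceVectorTest fr ℓ s) : Continuous v := by
  obtain ⟨v₁, h1, v₂, h2, rfl⟩ := Submodule.mem_sup.1 h
  refine (continuous_of_mem_span ?_ h1).add (continuous_of_mem_span ?_ h2)
  · rintro _ ⟨p, -, rfl⟩
    exact continuous_pi fun i => continuous_eval_hull _
  · rintro _ ⟨q, hq, rfl⟩
    have hx := continuous_ofLp_sub (s := s) (fr.o s)
    refine (continuous_of_mem_polyOn hq).smul (continuous_pi fun i => ?_)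
    have h3 : ∀ j, Continuous fun x : hull s => (x.1 - fr.o s).ofLp j := fun j =>
      (continuous_apply j).comp hx
    simp only [cross_eq]
    fin_cases i
    · exact ((h3 1).mul_const _).sub ((h3 2).mul_const _)
    · exact ((h3 2).mul_const _).sub ((h3 0).mul_const _)
    · exact ((h3 0).mul_const _).sub ((h3 1).mul_const _)

theorem continuous_frob {X : Type*} [TopologicalSpace X] {A B : X → M3} (hA : Continuous A)
    (hB : Continuous B) : Continuous fun x => frob (A x) (B x) :=
  continuous_finsetSum _ fun i _ => continuous_finsetSum _ fun j _ =>
    (hA.matrix_elem i j).mul (hB.matrix_elem i j)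

theorem continuous_tr₁perp (n : V3) : Continuous (tr₁perp n) :=
  LinearMap.continuous_of_finiteDimensional
    (IsLinearMap.mk' (tr₁perp n) ⟨tr₁perp_add n, tr₁perp_smul n⟩)

theorem continuous_tr₂ (n : V3) : Continuous (tr₂ n) :=
  LinearMap.continuous_of_finiteDimensional (IsLinearMap.mk' (tr₂ n) ⟨tr₂_add n, tr₂_smul n⟩)

theorem Orders.isMoment_edge {b : Fin 2 → E3} {e : Finset E3} (h : Orders b e)
    (ψ : PolM →ₗ[ℝ] Pol) (k : ℕ) :
    IsMoment (lengthOn e) (polyOn k e) fun τ q x => eval x.1.ofLp (ψ τ) * q x where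
  add_left τ σ q x := by rw [map_add, map_add, add_mul]
  smul_left c τ q x := by rw [map_smul, smul_eval, mul_assoc]
  add_right τ q r x := by rw [Pi.add_apply, mul_add]
  smul_right c τ q x := by rw [Pi.smul_apply, smul_eq_mul]; ring
  integrable τ q hq := h.integrable ((continuous_eval_hull _).mul (continuous_of_mem_polyOn hq))

theorem Orders.isMoment_tensor {a : Fin 3 → E3} {F : Finset E3} (h : Orders a F) (fr : Frame)
    (ℓ : ℕ) : IsMoment (areaOn F) (faceTensorTest fr ℓ F)
      fun τ ς x => frob (tr₁perp (fr.n F) (val τ x.1)) (ς x) where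
  add_left τ σ q x := by rw [val_add, tr₁perp_add, frob_add_left]
  smul_left c τ q x := by rw [val_smul, tr₁perp_smul, frob_smul_left]
  add_right τ q r x := by rw [Pi.add_apply, frob_add]
  smul_right c τ q x := by rw [Pi.smul_apply, frob_smul]
  integrable τ q hq := h.integrable (continuous_frob ((continuous_tr₁perp _).comp
    ((continuous_val τ).comp continuous_subtype_val)) (continuous_of_mem_faceTensorTest hq))

theorem Orders.isMoment_vector {a : Fin 3 → E3} {F : Finset E3} (h : Orders a F) (fr : Frame)
    (ℓ : ℕ) : IsMoment (areaOn F) (faceVectorTest fr ℓ F)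
      fun τ v x => tr₂ (fr.n F) (val τ x.1) ⬝ᵥ v x where
  add_left τ σ q x := by rw [val_add, tr₂_add, add_dotProduct]
  smul_left c τ q x := by rw [val_smul, tr₂_smul, smul_dotProduct, smul_eq_mul]
  add_right τ q r x := by rw [Pi.add_apply, dotProduct_add]
  smul_right c τ q x := by rw [Pi.smul_apply, dotProduct_smul, smul_eq_mul]
  integrable τ q hq := h.integrable (Continuous.dotProduct ((continuous_tr₂ _).comp
    ((continuous_val τ).comp continuous_subtype_val)) (continuous_of_mem_faceVectorTest hq))

theorem isMoment_vol (fr : Frame) (k : ℕ) (K : Finset E3) :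
    IsMoment (volume.restrict (hull K)) (bubble fr k K)
      fun τ q x => frob (val τ x) (val q x) where
  add_left τ σ q x := by rw [val_add, frob_add_left]
  smul_left c τ q x := by rw [val_smul, frob_smul_left]
  add_right τ q r x := by rw [val_add, frob_add]
  smul_right c τ q x := by rw [val_smul, frob_smul]
  integrable τ q _ := (continuous_frob (continuous_val τ)
    (continuous_val q)).continuousOn.integrableOn_compact (isCompact_hull K)

/-- The bilinear form `aᵀ A b` as a linear map in `A`. -/
noncomputable def bilMap (u w : V3) : PolM →ₗ[ℝ] Pol where
  toFun := bil u w
  map_add' := bil_add u w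
  map_smul' := bil_smul u w

/-- The curl as a linear map. -/
noncomputable def curlMap : PolM →ₗ[ℝ] PolM where
  toFun := polCurl
  map_add' A B := by
    ext1 i j
    fin_cases j <;> simp [polCurl, curl] <;> ring
  map_smul' c A := by
    ext1 i j
    fin_cases j <;> simp [polCurl, curl, smul_sub]

/-- The symmetric curl as a linear map. -/
noncomputable def symCurlMap : PolM →ₗ[ℝ] PolM where
  toFun := symCurl
  map_add' A B := by
    have h : polCurl (A + B) = polCurl A + polCurl B := curlMap.map_add A B
    rw [symCurl, symCurl, symCurl, h, sym, sym, sym, transpose_add, ← smul_add]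
    congr 1
    abel
  map_smul' c A := by
    have h : polCurl (c • A) = c • polCurl A := curlMap.map_smul c A
    rw [symCurl, symCurl, h, sym, sym, transpose_smul, ← smul_add, smul_comm]
    rfl

/-- A directional derivative as a linear map. -/
noncomputable def dirDerivMap (t : V3) : PolM →ₗ[ℝ] PolM where
  toFun := dirDeriv t
  map_add' A B := by
    ext1 i j
    simp [dirDeriv, smul_add, Finset.sum_add_distrib]
  map_smul' c A := by
    ext1 i j
    simp [dirDeriv, Finset.smul_sum, smul_comm c]

/-- The integrand of `edgeDofNN`. -/
noncomputable def intNN (fr : Frame) (e : Finset E3) (i j : Fin 2) : PolM →ₗ[ℝ] Pol :=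
  bilMap (fr.nE e i) (fr.nE e j) ∘ₗ symCurlMap

/-- The integrand of `edgeDofNT`. -/
noncomputable def intNT (fr : Frame) (e : Finset E3) (i : Fin 2) : PolM →ₗ[ℝ] Pol :=
  bilMap (fr.nE e i) (fr.t e)

/-- The integrand of `edgeDofCurl`. -/
noncomputable def intCurl (fr : Frame) (e : Finset E3) : PolM →ₗ[ℝ] Pol :=
  bilMap (fr.n₂ e) (fr.n₁ e) ∘ₗ curlMap + bilMap (fr.t e) (fr.t e) ∘ₗ dirDerivMap (fr.t e)

variable {b : Fin 2 → E3} {e : Finset E3} {F : Finset E3} (fr : Frame) (τ : PolM)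

theorem Orders.map_intNN (h : Orders b e) (i j : Fin 2) {k : ℕ} (q : polyOn k e) :
    (h.isMoment_edge (intNN fr e i j) k).map τ q = edgeDofNN fr τ e i j q := by
  rw [IsMoment.map_apply, edgeDofNN]
  simp only [← eval_bil]
  rfl

theorem Orders.map_intNT (h : Orders b e) (i : Fin 2) {k : ℕ} (q : polyOn k e) :
    (h.isMoment_edge (intNT fr e i) k).map τ q = edgeDofNT fr τ e i q := by
  rw [IsMoment.map_apply, edgeDofNT]
  simp only [← eval_bil]
  rfl

theorem Orders.map_intCurl (h : Orders b e) {k : ℕ} (q : polyOn k e) :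
    (h.isMoment_edge (intCurl fr e) k).map τ q = edgeDofCurl fr τ e q := by
  rw [IsMoment.map_apply, edgeDofCurl]
  simp only [← eval_bil, ← map_add]
  rfl

theorem edgeDofNN_comm (i j : Fin 2) (q : hull e → ℝ) :
    edgeDofNN fr τ e i j q = edgeDofNN fr τ e j i q := by
  have h : ∀ x, (val (symCurl τ) x).IsSymm := fun x => by
    rw [val_symCurl, IsSymm, sym, transpose_smul, transpose_add, transpose_transpose, add_comm]
  rw [edgeDofNN, edgeDofNN]
  simp only [dot_mulVec_comm_of_isSymm (h _) (fr.nE e i)]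

end Moments

/-! ### Unisolvence -/

section Unisolvence

open MvPolynomial

/-- The entries of a trace-free matrix which determine it. -/
abbrev TraceFreeIdx := {p : Fin 3 × Fin 3 // p ≠ (2, 2)}

/-- The entries of a symmetric matrix which determine it. -/
abbrev SymmIdx (n : ℕ) := {p : Fin n × Fin n // p.1 ≤ p.2}

theorem card_traceFreeIdx : Fintype.card TraceFreeIdx = 8 := by decide

theorem card_symmIdx_two : Fintype.card (SymmIdx 2) = 3 := by decide

theorem card_symmIdx_three : Fintype.card (SymmIdx 3) = 6 := by decide

theorem eq_of_traceFree {A B : M3} (hA : A.trace = 0) (hB : B.trace = 0)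
    (h : ∀ p : TraceFreeIdx, A p.1.1 p.1.2 = B p.1.1 p.1.2) : A = B := by
  have h' : ∀ i j, (i, j) ≠ ((2, 2) : Fin 3 × Fin 3) → A i j = B i j := fun i j hij => h ⟨_, hij⟩
  ext i j
  by_cases hij : (i, j) = ((2, 2) : Fin 3 × Fin 3)
  · rw [Prod.mk.injEq] at hij
    rw [hij.1, hij.2]
    rw [Matrix.trace_fin_three] at hA hB
    have h0 := h' 0 0 (by decide)
    have h1 := h' 1 1 (by decide)
    linarith
  · exact h' i j hij

theorem eq_of_isSymm {A B : M3} (hA : A.IsSymm) (hB : B.IsSymm)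
    (h : ∀ p : SymmIdx 3, A p.1.1 p.1.2 = B p.1.1 p.1.2) : A = B := by
  ext i j
  rcases le_total i j with hij | hij
  · exact h ⟨(i, j), hij⟩
  · rw [← hA.apply, ← hB.apply]
    exact h ⟨(j, i), hij⟩

theorem isSymm_val_symCurl (τ : PolM) (x : E3) : (val (symCurl τ) x).IsSymm := by
  rw [val_symCurl, IsSymm, sym, transpose_smul, transpose_add, transpose_transpose, add_comm]

theorem trace_val {k : ℕ} {τ : PolM} (hτ : τ ∈ polyT k) (x : E3) : (val τ x).trace = 0 := by
  have h1 := congr_arg (eval x.ofLp) hτ.1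
  simpa [val, Matrix.trace] using h1

/-- The integral is a positive multiple of a sum of integrals of squares over the reference simplex.
-/
theorem eq_zero_of_integral_frob_self {K : Finset E3} (hK : IsTetrahedron K) {τ : PolM}
    (h : volDof τ K τ = 0) : τ = 0 := by
  obtain ⟨a, ha⟩ := exists_orders (d := 3) hK.1 hK.2
  have h1 := ha.integral_pol (∑ i, ∑ j, τ i j * τ i j)
  have h2 : (μHE[3] : Measure E3) = volume := by
    exact EuclideanSpace.euclideanHausdorffMeasure_eq_volume 3
  have h3 : ∫ x in hull K, eval x.ofLp (∑ i, ∑ j, τ i j * τ i j) ∂(μHE[3] : Measure E3) = 0 := by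
    rw [h2, ← h]
    simp [volDof, frob, val]
  rw [h3] at h1
  have h4 := (mul_eq_zero.1 h1.symm).resolve_left (chartVol_pos ha.1).ne'
  simp only [map_sum, map_mul] at h4
  have h5 : ∀ p : MvPolynomial (Fin 3) ℝ, 0 ≤ refInt 3 (p * p) := fun p => by
    rw [refInt_apply]
    exact setIntegral_nonneg (measurableSet_refSimplex 3) fun x _ => by
      rw [map_mul]; exact mul_self_nonneg _
  ext1 i j
  have h6 := (Finset.sum_eq_zero_iff_of_nonneg fun i _ => Finset.sum_nonneg fun j _ => h5 _).1 h4 i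
    (Finset.mem_univ i)
  have h7 := (Finset.sum_eq_zero_iff_of_nonneg fun j _ => h5 _).1 h6 j (Finset.mem_univ j)
  refine eq_zero_of_pull_eq_zero ha.1 (eq_zero_of_integral_weight_mul_sq (w := 1) (by simp)
    (by simp) ?_)
  rw [one_mul]
  exact h7

variable {fr : Frame} {ℓ : ℕ} {K : Finset E3}

theorem exists_orders_edge (hK : IsTetrahedron K) {e : Finset E3} (he : e ∈ edges K) :
    ∃ b : Fin 2 → E3, Orders b e :=
  have h := Finset.mem_powersetCard.1 he
  exists_orders h.2 (affineIndependent_subset hK.2 h.1)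

theorem exists_orders_face (hK : IsTetrahedron K) {F : Finset E3} (hF : F ∈ faces K) :
    ∃ a : Fin 3 → E3, Orders a F :=
  have h := Finset.mem_powersetCard.1 hF
  exists_orders h.2 (affineIndependent_subset hK.2 h.1)

/-- If the degrees of freedom on a face of a tetrahedron vanish, so do the traces. -/
theorem traces_eq_zero (hℓ : 3 ≤ ℓ) (hK : IsTetrahedron K) (hfr : fr.Good K) {F : Finset E3}
    (hF : F ∈ faces K) {τ : PolM} (hτ : τ ∈ polyT (ℓ + 1)) (hv : ∀ δ ∈ F, val τ δ = 0)
    (hc : ∀ δ ∈ F, val (symCurl τ) δ = 0) (he : ∀ e ∈ edges F, EdgeMomentsVanish fr ℓ τ e)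
    (h : FaceMomentsVanish fr ℓ τ F) (x : E3) (hx : x ∈ hull F) :
    tr₂ (fr.n F) (val τ x) = 0 ∧ tr₁perp (fr.n F) (val τ x) = 0 := by
  have hF' := Finset.mem_powersetCard.1 hF
  exact h.traces hℓ hF'.2 (affineIndependent_subset hK.2 hF'.1) (hfr.2 F hF)
    (fun e he => hfr.1 e (Finset.mem_powersetCard.2
      ⟨(Finset.mem_powersetCard.1 he).1.trans hF'.1, (Finset.mem_powersetCard.1 he).2⟩))
    (mem_polyT_iff.1 hτ).2 hv hc he x hx

theorem edges_subset {F : Finset E3} (hF : F ∈ faces K) : edges F ⊆ edges K :=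
  Finset.powersetCard_mono (Finset.mem_powersetCard.1 hF).1

/-- All traces vanish by the face lemma, so τ is itself an admissible test function for the interior
moments. -/
theorem eq_zero_of_dofs (hℓ : 3 ≤ ℓ) (hK : IsTetrahedron K) (hfr : fr.Good K) {τ : PolM}
    (hτ : τ ∈ polyT (ℓ + 1)) (hv : ∀ δ ∈ K, val τ δ = 0) (hc : ∀ δ ∈ K, val (symCurl τ) δ = 0)
    (he : ∀ e ∈ edges K, EdgeMomentsVanish fr ℓ τ e)
    (hF : ∀ F ∈ faces K, FaceMomentsVanish fr ℓ τ F)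
    (hvol : ∀ q ∈ bubble fr (ℓ + 1) K, volDof τ K q = 0) : τ = 0 := by
  refine eq_zero_of_integral_frob_self hK (hvol τ ⟨hτ, fun F hFK x hx => ?_⟩)
  have hs := (Finset.mem_powersetCard.1 hFK).1
  exact traces_eq_zero hℓ hK hfr hFK hτ (fun δ hδ => hv δ (hs hδ)) (fun δ hδ => hc δ (hs hδ))
    (fun e heF => he e (edges_subset hFK heF)) (hF F hFK) x hx

/-- The values of a tensor polynomial and of its symmetric curl at the vertices. -/
noncomputable def vertexMap (K : Finset E3) :
    PolM →ₗ[ℝ] (K → TraceFreeIdx → ℝ) × (K → SymmIdx 3 → ℝ) where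
  toFun τ := (fun δ p => val τ δ p.1.1 p.1.2, fun δ p => val (symCurl τ) δ p.1.1 p.1.2)
  map_add' τ σ := by
    have h : symCurl (τ + σ) = symCurl τ + symCurl σ := symCurlMap.map_add τ σ
    simp only [h, val_add]
    rfl
  map_smul' c τ := by
    have h : symCurl (c • τ) = c • symCurl τ := symCurlMap.map_smul c τ
    simp only [h, val_smul]
    rfl

section

variable (hK : IsTetrahedron K) (fr ℓ)

/-- The moments on the edges. -/
noncomputable def edgeMap : PolM →ₗ[ℝ]
    (∀ e : edges K, SymmIdx 2 → Module.Dual ℝ (polyOn (ℓ - 2) e.1)) ×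
    (∀ e : edges K, Fin 2 → Module.Dual ℝ (polyOn (ℓ - 1) e.1)) ×
    (∀ e : edges K, Module.Dual ℝ (polyOn ℓ e.1)) :=
  (LinearMap.pi fun e => LinearMap.pi fun p =>
    ((exists_orders_edge hK e.2).choose_spec.isMoment_edge
      (intNN fr e.1 p.1.1 p.1.2) (ℓ - 2)).map).prod
  ((LinearMap.pi fun e => LinearMap.pi fun i =>
    ((exists_orders_edge hK e.2).choose_spec.isMoment_edge
      (intNT fr e.1 i) (ℓ - 1)).map).prod
  (LinearMap.pi fun e =>
    ((exists_orders_edge hK e.2).choose_spec.isMoment_edge (intCurl fr e.1) ℓ).map))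

/-- The moments on the faces. -/
noncomputable def faceMap : PolM →ₗ[ℝ]
    (∀ F : faces K, Module.Dual ℝ (faceTensorTest fr ℓ F.1)) ×
    (∀ F : faces K, Module.Dual ℝ (faceVectorTest fr ℓ F.1)) :=
  (LinearMap.pi fun F => ((exists_orders_face hK F.2).choose_spec.isMoment_tensor fr ℓ).map).prod
  (LinearMap.pi fun F => ((exists_orders_face hK F.2).choose_spec.isMoment_vector fr ℓ).map)

/-- All degrees of freedom. -/
noncomputable def dofMap : polyT (ℓ + 1) →ₗ[ℝ]
    ((K → TraceFreeIdx → ℝ) × (K → SymmIdx 3 → ℝ)) ×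
    ((∀ e : edges K, SymmIdx 2 → Module.Dual ℝ (polyOn (ℓ - 2) e.1)) ×
      (∀ e : edges K, Fin 2 → Module.Dual ℝ (polyOn (ℓ - 1) e.1)) ×
      (∀ e : edges K, Module.Dual ℝ (polyOn ℓ e.1))) ×
    ((∀ F : faces K, Module.Dual ℝ (faceTensorTest fr ℓ F.1)) ×
      (∀ F : faces K, Module.Dual ℝ (faceVectorTest fr ℓ F.1))) ×
    Module.Dual ℝ (bubble fr (ℓ + 1) K) :=
  ((vertexMap K).prod ((edgeMap fr ℓ hK).prod ((faceMap fr ℓ hK).prod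
    (isMoment_vol fr (ℓ + 1) K).map))) ∘ₗ (polyT (ℓ + 1)).subtype

end

theorem dofMap_injective (hℓ : 3 ≤ ℓ) (hK : IsTetrahedron K) (hfr : fr.Good K) :
    Function.Injective (dofMap fr ℓ hK) := by
  rw [← LinearMap.ker_eq_bot, LinearMap.ker_eq_bot']
  rintro ⟨τ, hτ⟩ h
  have hV := congr_arg (fun z => z.1) h
  have hNN := congr_arg (fun z => z.2.1.1) h
  have hNT := congr_arg (fun z => z.2.1.2.1) h
  have hC := congr_arg (fun z => z.2.1.2.2) h
  have hT := congr_arg (fun z => z.2.2.1.1) h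
  have hW := congr_arg (fun z => z.2.2.1.2) h
  have hB := congr_arg (fun z => z.2.2.2) h
  have hv0 : ∀ δ ∈ K, val τ δ = 0 := fun δ hδ =>
    eq_of_traceFree (trace_val hτ δ) (by simp) fun p =>
      congr_fun (congr_fun (congr_arg Prod.fst hV) ⟨δ, hδ⟩) p
  have hv1 : ∀ δ ∈ K, val (symCurl τ) δ = 0 := fun δ hδ =>
    eq_of_isSymm (isSymm_val_symCurl τ δ) (by simp [IsSymm]) fun p =>
      congr_fun (congr_fun (congr_arg Prod.snd hV) ⟨δ, hδ⟩) p
  have he : ∀ e ∈ edges K, EdgeMomentsVanish fr ℓ τ e := by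
    intro e he
    have h1 : ∀ i j, i ≤ j → ∀ q ∈ polyOn (ℓ - 2) e, edgeDofNN fr τ e i j q = 0 :=
      fun i j hij q hq => by
        exact ((exists_orders_edge hK he).choose_spec.map_intNN fr τ i j ⟨q, hq⟩).symm.trans
          (LinearMap.congr_fun (congr_fun (congr_fun hNN ⟨e, he⟩) ⟨(i, j), hij⟩) ⟨q, hq⟩)
    refine ⟨fun i j q hq => ?_, fun i q hq => ?_, fun q hq => ?_⟩
    · rcases le_total i j with hij | hij
      · exact h1 i j hij q hq
      · rw [edgeDofNN_comm]
        exact h1 j i hij q hq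
    · exact ((exists_orders_edge hK he).choose_spec.map_intNT fr τ i ⟨q, hq⟩).symm.trans
        (LinearMap.congr_fun (congr_fun (congr_fun hNT ⟨e, he⟩) i) ⟨q, hq⟩)
    · exact ((exists_orders_edge hK he).choose_spec.map_intCurl fr τ ⟨q, hq⟩).symm.trans
        (LinearMap.congr_fun (congr_fun hC ⟨e, he⟩) ⟨q, hq⟩)
  refine Subtype.ext (eq_zero_of_dofs hℓ hK hfr hτ hv0 hv1 he (fun F hF =>
    ⟨fun ς hς => LinearMap.congr_fun (congr_fun hT ⟨F, hF⟩) ⟨ς, hς⟩,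
      fun v hv => LinearMap.congr_fun (congr_fun hW ⟨F, hF⟩) ⟨v, hv⟩⟩)
    fun q hq => LinearMap.congr_fun hB ⟨q, hq⟩)

theorem two_mul_choose_two (n : ℕ) : 2 * (n + 2).choose 2 = (n + 2) * (n + 1) := by
  induction n with
  | zero => rfl
  | succ n ih =>
    rw [Nat.choose_succ_succ' (n + 2) 1, Nat.choose_one_right, mul_add, ih]
    ring

theorem six_mul_choose_three (n : ℕ) :
    6 * (n + 3).choose 3 = (n + 3) * (n + 2) * (n + 1) := by
  induction n with
  | zero => rfl
  | succ n ih =>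
    have h := two_mul_choose_two (n + 1)
    rw [Nat.choose_succ_succ' (n + 3) 2, mul_add, ih]
    have h2 : (n + 3).choose 2 = (n + 1 + 2).choose 2 := rfl
    rw [h2]
    linear_combination 3 * h

/-- Summands: vertex values and vertex curls, three edge families, two face families, bubbles. At
the extreme values of r and N both sides agree, so none of the dimension bounds has slack. -/
theorem count_le {r N : ℕ} (hℓ : 3 ≤ ℓ)
    (b8 : r + (ℓ - 1 + 4).choose 3 ≤ 3 * (ℓ - 1 + 3).choose 3 + 1)
    (b9 : 8 * (ℓ + 1 + 3).choose 3 ≤ N) :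
    4 * 8 + 4 * 6 + (6 * (3 * (ℓ - 2 + 1)) + (6 * (2 * (ℓ - 1 + 1)) + 6 * (ℓ + 1)) +
      (4 * (3 * (ℓ - 1 + 2).choose 2 - 3) +
        4 * ((ℓ - 3 + 2).choose 2 + (ℓ - 1 + 2).choose 2 - 1) + 4 * r)) ≤ N := by
  -- Writing ℓ = m + 3 removes the truncated subtractions from the degrees.
  obtain ⟨m, rfl⟩ := Nat.exists_eq_add_of_le hℓ
  have e1 : 3 + m - 1 = m + 2 := by omega
  have e2 : 3 + m - 3 = m := by omega
  have e3 : 3 + m - 2 = m + 1 := by omega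
  have e4 : 3 + m + 1 = m + 4 := by omega
  simp only [e1, e2, e3, e4] at b8 b9 ⊢
  have c1 := two_mul_choose_two m
  have c2 := two_mul_choose_two (m + 2)
  have c3 : 6 * (m + 2 + 3).choose 3 = _ := six_mul_choose_three (m + 2)
  have c4 : 6 * (m + 2 + 4).choose 3 = _ := six_mul_choose_three (m + 3)
  have c5 : 6 * (m + 4 + 3).choose 3 = _ := six_mul_choose_three (m + 4)
  have c6 : 1 ≤ (m + 2 + 2).choose 2 := Nat.choose_pos (by omega)
  ring_nf at c1 c2 c3 c4 c5 c6 b8 b9 ⊢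
  omega

/-- The space `V` is finite-dimensional of dimension at most `c`. -/
def FinrankLE (V : Type*) [AddCommGroup V] [Module ℝ V] (c : ℕ) : Prop :=
  Module.Finite ℝ V ∧ Module.finrank ℝ V ≤ c

theorem finrankLE_real : FinrankLE ℝ 1 := ⟨inferInstance, (Module.finrank_self ℝ).le⟩

theorem FinrankLE.dual {V : Type*} [AddCommGroup V] [Module ℝ V] {c : ℕ} (h : FinrankLE V c) :
    FinrankLE (Module.Dual ℝ V) c := by
  have := h.1
  exact ⟨inferInstance, Subspace.dual_finrank_eq.le.trans h.2⟩

theorem FinrankLE.prod {V W : Type*} [AddCommGroup V] [Module ℝ V] [AddCommGroup W] [Module ℝ W]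
    {c d : ℕ} (h : FinrankLE V c) (h' : FinrankLE W d) : FinrankLE (V × W) (c + d) := by
  have := h.1
  have := h'.1
  exact ⟨inferInstance, Module.finrank_prod.le.trans (add_le_add h.2 h'.2)⟩

theorem FinrankLE.pi {ι : Type*} [Fintype ι] {V : ι → Type*} [∀ i, AddCommGroup (V i)]
    [∀ i, Module ℝ (V i)] {c n : ℕ} (hn : Fintype.card ι = n) (h : ∀ i, FinrankLE (V i) c) :
    FinrankLE (∀ i, V i) (n * c) := by
  have := fun i => (h i).1
  refine ⟨inferInstance, ?_⟩
  rw [Module.finrank_pi_fintype]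
  exact (Finset.sum_le_card_nsmul _ _ c fun i _ => (h i).2).trans (by simp [hn])

theorem FinrankLE.surjective {V W : Type*} [AddCommGroup V] [Module ℝ V] [Module.Finite ℝ V]
    [AddCommGroup W] [Module ℝ W] {c : ℕ} (h : FinrankLE W c) (hc : c ≤ Module.finrank ℝ V)
    {f : V →ₗ[ℝ] W} (hf : Function.Injective f) : Function.Surjective f := by
  have := h.1
  exact (LinearMap.injective_iff_surjective_of_finrank_eq_finrank (le_antisymm
    (LinearMap.finrank_le_finrank_of_injective hf) (h.2.trans hc))).1 hf

theorem card_edges (hK : IsTetrahedron K) : Fintype.card (edges K) = 6 := by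
  rw [Fintype.card_coe, edges, Finset.card_powersetCard, hK.1]; rfl

theorem card_faces (hK : IsTetrahedron K) : Fintype.card (faces K) = 4 := by
  rw [Fintype.card_coe, faces, Finset.card_powersetCard, hK.1]; rfl

/-- The target is no larger than the source, so injectivity forces surjectivity; exact dimensions of
the test spaces are not needed. -/
theorem dofMap_surjective (hℓ : 3 ≤ ℓ) (hK : IsTetrahedron K) (hfr : fr.Good K) :
    Function.Surjective (dofMap fr ℓ hK) := by
  have bE : ∀ k, ∀ e : edges K, FinrankLE (polyOn k e.1) (k + 1) := fun k e =>
    have h := (exists_orders_edge hK e.2).choose_spec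
    ⟨h.finite_polyOn k, (h.finrank_polyOn_le k).trans (by simp)⟩
  have bT : ∀ F : faces K, FinrankLE (faceTensorTest fr ℓ F.1) (3 * (ℓ - 1 + 2).choose 2 - 3) :=
    fun F => by
      have h := finrank_faceTensorTest_le (exists_orders_face hK F.2).choose_spec (hfr.2 F.1 F.2)
        (ℓ := ℓ) (by omega)
      exact ⟨h.1, by omega⟩
  have bV : ∀ F : faces K, FinrankLE (faceVectorTest fr ℓ F.1)
      ((ℓ - 3 + 2).choose 2 + (ℓ - 1 + 2).choose 2 - 1) := fun F => by
    have h := finrank_faceVectorTest_le (exists_orders_face hK F.2).choose_spec (hfr.2 F.1 F.2) ℓ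
    exact ⟨h.1, by omega⟩
  have bB : FinrankLE (bubble fr (ℓ + 1) K) (4 * Module.finrank ℝ (relations (ℓ - 1))) :=
    ⟨inferInstance, finrank_bubble_le (by omega) hK hfr⟩
  have hK4 : Fintype.card K = 4 := by rw [Fintype.card_coe, hK.1]
  have hE := card_edges hK
  have hF := card_faces hK
  have b := ((FinrankLE.pi hK4 fun _ => .pi card_traceFreeIdx fun _ => finrankLE_real).prod
    (FinrankLE.pi hK4 fun _ => .pi card_symmIdx_three fun _ => finrankLE_real)).prod
    (((FinrankLE.pi hE fun e => .pi card_symmIdx_two fun _ => (bE (ℓ - 2) e).dual).prod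
      ((FinrankLE.pi hE fun e => .pi (Fintype.card_fin 2) fun _ => (bE (ℓ - 1) e).dual).prod
        (FinrankLE.pi hE fun e => (bE ℓ e).dual))).prod
    (((FinrankLE.pi hF fun F => (bT F).dual).prod (FinrankLE.pi hF fun F => (bV F).dual)).prod
      bB.dual))
  refine FinrankLE.surjective b ?_ (dofMap_injective hℓ hK hfr)
  exact count_le hℓ (finrank_relations_le (ℓ - 1)) (le_finrank_polyT (ℓ + 1))

/-- The values of the degrees of freedom in the target of `dofMap`. -/
def DofValues.toTarget (d : DofValues fr ℓ K) :
    ((K → TraceFreeIdx → ℝ) × (K → SymmIdx 3 → ℝ)) ×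
    ((∀ e : edges K, SymmIdx 2 → Module.Dual ℝ (polyOn (ℓ - 2) e.1)) ×
      (∀ e : edges K, Fin 2 → Module.Dual ℝ (polyOn (ℓ - 1) e.1)) ×
      (∀ e : edges K, Module.Dual ℝ (polyOn ℓ e.1))) ×
    ((∀ F : faces K, Module.Dual ℝ (faceTensorTest fr ℓ F.1)) ×
      (∀ F : faces K, Module.Dual ℝ (faceVectorTest fr ℓ F.1))) ×
    Module.Dual ℝ (bubble fr (ℓ + 1) K) :=
  ((fun δ p => (d.vertex δ.1 δ.2).1 p.1.1 p.1.2, fun δ p => (d.vertexCurl δ.1 δ.2).1 p.1.1 p.1.2),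
    (fun e p => d.edgeNN e.1 e.2 p.1.1 p.1.2, fun e i => d.edgeNT e.1 e.2 i,
      fun e => d.edgeCurl e.1 e.2),
    (fun F => d.faceTensor F.1 F.2, fun F => d.faceVector F.1 F.2), d.vol)

theorem dofMap_eq_iff (hK : IsTetrahedron K) (d : DofValues fr ℓ K) (τ : polyT (ℓ + 1)) :
    dofMap fr ℓ hK τ = d.toTarget ↔ HasDofs d τ.1 := by
  constructor
  · intro h
    have hV := congr_arg (fun z => z.1) h
    have hNN := congr_arg (fun z => z.2.1.1) h
    have hNT := congr_arg (fun z => z.2.1.2.1) h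
    have hC := congr_arg (fun z => z.2.1.2.2) h
    have hT := congr_arg (fun z => z.2.2.1.1) h
    have hW := congr_arg (fun z => z.2.2.1.2) h
    have hB := congr_arg (fun z => z.2.2.2) h
    have h1 : ∀ e (he : e ∈ edges K) i j, i ≤ j → ∀ q : polyOn (ℓ - 2) e,
        edgeDofNN fr τ e i j q = d.edgeNN e he i j q := fun e he i j hij q =>
      ((exists_orders_edge hK he).choose_spec.map_intNN fr τ.1 i j q).symm.trans
        (LinearMap.congr_fun (congr_fun (congr_fun hNN ⟨e, he⟩) ⟨(i, j), hij⟩) q)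
    refine ⟨fun δ hδ => ?_, fun δ hδ => ?_, fun e he i j q => ?_, fun e he i q => ?_,
      fun e he q => ?_, fun F hF ς => LinearMap.congr_fun (congr_fun hT ⟨F, hF⟩) ς,
      fun F hF v => LinearMap.congr_fun (congr_fun hW ⟨F, hF⟩) v, fun q => LinearMap.congr_fun hB q⟩
    · exact eq_of_traceFree (trace_val τ.2 δ) (d.vertex δ hδ).2 fun p =>
        congr_fun (congr_fun (congr_arg Prod.fst hV) ⟨δ, hδ⟩) p
    · exact eq_of_isSymm (isSymm_val_symCurl τ.1 δ) (d.vertexCurl δ hδ).2 fun p =>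
        congr_fun (congr_fun (congr_arg Prod.snd hV) ⟨δ, hδ⟩) p
    · rcases le_total i j with hij | hij
      · exact h1 e he i j hij q
      · rw [edgeDofNN_comm, d.edgeNN_symm]
        exact h1 e he j i hij q
    · exact ((exists_orders_edge hK he).choose_spec.map_intNT fr τ.1 i q).symm.trans
        (LinearMap.congr_fun (congr_fun (congr_fun hNT ⟨e, he⟩) i) q)
    · exact ((exists_orders_edge hK he).choose_spec.map_intCurl fr τ.1 q).symm.trans
        (LinearMap.congr_fun (congr_fun hC ⟨e, he⟩) q)
  · intro h
    refine Prod.ext (Prod.ext ?_ ?_) (Prod.ext (Prod.ext ?_ (Prod.ext ?_ ?_))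
      (Prod.ext (Prod.ext ?_ ?_) ?_))
    · exact funext fun δ => funext fun p => congr_fun (congr_fun (h.vertex δ.1 δ.2) _) _
    · exact funext fun δ => funext fun p => congr_fun (congr_fun (h.vertexCurl δ.1 δ.2) _) _
    · exact funext fun e => funext fun p => LinearMap.ext fun q =>
        ((exists_orders_edge hK e.2).choose_spec.map_intNN fr τ.1 _ _ q).trans (h.edgeNN e.1 e.2 _ _ q)
    · exact funext fun e => funext fun i => LinearMap.ext fun q =>
        ((exists_orders_edge hK e.2).choose_spec.map_intNT fr τ.1 _ q).trans (h.edgeNT e.1 e.2 _ q)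
    · exact funext fun e => LinearMap.ext fun q =>
        ((exists_orders_edge hK e.2).choose_spec.map_intCurl fr τ.1 q).trans (h.edgeCurl e.1 e.2 q)
    · exact funext fun F => LinearMap.ext fun q => h.faceTensor F.1 F.2 q
    · exact funext fun F => LinearMap.ext fun q => h.faceVector F.1 F.2 q
    · exact LinearMap.ext fun q => h.vol q

theorem unisolvent (hℓ : 3 ≤ ℓ) (hK : IsTetrahedron K) (hfr : fr.Good K) :
    Unisolvent fr ℓ K := by
  intro d
  obtain ⟨τ, hτ⟩ := dofMap_surjective hℓ hK hfr d.toTarget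
  refine ⟨τ.1, ⟨τ.2, (dofMap_eq_iff hK d τ).1 hτ⟩, fun σ hσ => ?_⟩
  have h := (dofMap_eq_iff hK d ⟨σ, hσ.1⟩).2 hσ.2
  exact congr_arg Subtype.val (dofMap_injective hℓ hK hfr (h.trans hτ.symm))

end Unisolvence

/-! ### The divergence theorem on a tetrahedron -/

section Divergence

theorem contDiff_chart {d : ℕ} (a : Fin (d + 1) → E3) {n : WithTop ℕ∞} :
    ContDiff ℝ n (chart a) := by
  unfold chart; fun_prop

theorem fderiv_chart {d : ℕ} (a : Fin (d + 1) → E3) (y : Fin d → ℝ) (j : Fin d) :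
    fderiv ℝ (chart a) y (Pi.single j 1) = a j.succ - a 0 := by
  set L : (Fin d → ℝ) →L[ℝ] E3 :=
    LinearMap.toContinuousLinearMap (Fintype.linearCombination ℝ fun j => a j.succ - a 0) with hL
  have h : HasFDerivAt (chart a) L y := by
    have h1 := (L.hasFDerivAt (x := y)).const_add (a 0)
    refine h1.congr_of_eventuallyEq (Filter.Eventually.of_forall fun x => ?_)
    simp [chart, hL, Fintype.linearCombination_apply]
  rw [h.fderiv, hL]
  simp [Fintype.linearCombination_apply_single]

theorem chartVol_triangle {a : Fin 3 → E3} {n : V3} {J : ℝ} (hn : n ⬝ᵥ n = 1)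
    (hJ : edgeVec a 0 ⨯₃ edgeVec a 1 = J • n) : chartVol a = |J| := by
  have h : (Matrix.of fun i j => edgeVec a i ⬝ᵥ edgeVec a j).det = J ^ 2 := by
    have h1 := cross_dot_cross (edgeVec a 0) (edgeVec a 1) (edgeVec a 0) (edgeVec a 1)
    rw [hJ, smul_dotProduct, dotProduct_smul, hn] at h1
    rw [Matrix.det_fin_two]
    simp only [of_apply, smul_eq_mul] at h1 ⊢
    linear_combination -h1
  rw [chartVol, h, Real.sqrt_sq_eq_abs]

theorem chartVol_tetrahedron (b : Fin 4 → E3) :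
    chartVol b = |edgeVec b 0 ⬝ᵥ (edgeVec b 1 ⨯₃ edgeVec b 2)| := by
  have h : (Matrix.of fun i j => edgeVec b i ⬝ᵥ edgeVec b j).det =
      (edgeVec b 0 ⬝ᵥ (edgeVec b 1 ⨯₃ edgeVec b 2)) ^ 2 := by
    rw [Matrix.det_fin_three]
    simp only [of_apply, dot_eq, cross_eq]
    simp
    ring
  rw [chartVol, h, Real.sqrt_sq_eq_abs]

/-- Volume is base times height. The triple products are compared as squares because reordering
vertices may change their sign. -/
theorem chartVol_eq_mul {b : Fin 4 → E3} {a : Fin 3 → E3} {F : Finset E3} {fr : Frame}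
    (ha : Orders a F) (hfr : fr.GoodFace F) {e : V3}
    (he : (e ⬝ᵥ (edgeVec a 0 ⨯₃ edgeVec a 1)) ^ 2 =
      (edgeVec b 0 ⬝ᵥ (edgeVec b 1 ⨯₃ edgeVec b 2)) ^ 2) :
    chartVol b = chartVol a * |fr.n F ⬝ᵥ e| := by
  obtain ⟨J, -, hJ⟩ := ha.exists_cross_eq hfr
  rw [chartVol_tetrahedron, chartVol_triangle hfr.1 hJ, ← abs_mul, ← sq_eq_sq_iff_abs_eq_abs, ← he,
    hJ, dotProduct_smul, dotProduct_comm, smul_eq_mul]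

theorem integral_chart_face {a : Fin 3 → E3} {F : Finset E3} (ha : Orders a F) (f : E3 → ℝ)
    {V h : ℝ} (hV : V = chartVol a * h) :
    V * ∫ y in refSimplex 2, f (chart a y) = h * ∫ x in hull F, f x ∂(μHE[2] : Measure E3) := by
  rw [ha.integral_eq, hV]
  ring

variable {b : Fin 4 → E3} {K : Finset E3}

theorem chart_insertNth_zero (b : Fin 4 → E3) (j : Fin 3) (y : Fin 2 → ℝ) :
    chart b (j.insertNth 0 y) = chart (b ∘ j.succ.succAbove) y := by
  rw [chart, chart, Fin.sum_univ_succAbove _ j]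
  simp

/-- The vertices of the face opposite to `b 0`, beginning with `b j.succ`. -/
def oppFace (b : Fin 4 → E3) (j : Fin 3) : Fin 3 → E3 :=
  Fin.cons (b j.succ) fun i => b (j.succAbove i).succ

theorem chart_insertNth_one (b : Fin 4 → E3) (j : Fin 3) (y : Fin 2 → ℝ) :
    chart b (j.insertNth (1 - ∑ i, y i) y) = chart (oppFace b j) y := by
  rw [chart_eq_sum, chart_eq_sum, Fin.sum_univ_succAbove _ j, Fin.sum_univ_succAbove _ j]
  simp [oppFace]

theorem Orders.face [DecidableEq E3] (hb : Orders b K) (i : Fin 4) :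
    Orders (b ∘ i.succAbove) (K.erase (b i)) := by
  refine ⟨hb.1.comp_embedding ⟨i.succAbove, Fin.succAbove_right_injective⟩, ?_⟩
  rw [Finset.coe_erase, hb.2, Set.range_comp, Fin.range_succAbove,
    Set.image_compl_eq_range_sdiff_image hb.1.injective, Set.image_singleton]

theorem Orders.oppFace [DecidableEq E3] (hb : Orders b K) (j : Fin 3) :
    Orders (oppFace b j) (K.erase (b 0)) := by
  set f : Fin 3 → Fin 3 := Fin.cons j j.succAbove with hf
  have hinj : Function.Injective f := by
    rw [hf]; revert j; decide
  have h0 := hb.face 0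
  have e : SymCurlFEM.oppFace b j = (b ∘ Fin.succAbove 0) ∘ f := by
    ext1 i
    refine Fin.cases rfl (fun _ => rfl) i
  rw [e]
  refine ⟨h0.1.comp_embedding ⟨f, hinj⟩, ?_⟩
  rw [(Finite.injective_iff_surjective.1 hinj).range_comp, h0.2]

theorem edgeVec_face (b : Fin 4 → E3) (j : Fin 3) (i : Fin 2) :
    edgeVec (b ∘ j.succ.succAbove) i = edgeVec b (j.succAbove i) := by
  simp [edgeVec]

theorem edgeVec_oppFace (b : Fin 4 → E3) (j : Fin 3) (i : Fin 2) :
    edgeVec (oppFace b j) i = edgeVec b (j.succAbove i) - edgeVec b j := by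
  simp [edgeVec, oppFace]

/-- The sign which makes the normal vector of the face `F` point out of `K`. -/
noncomputable def outSign [DecidableEq E3] (fr : Frame) (K F : Finset E3) : ℝ :=
  -(SignType.sign (∑ p ∈ K \ F, fr.n F ⬝ᵥ (p - fr.o F).ofLp) : ℝ)

theorem dot_sub_origin {a : Fin 3 → E3} {F : Finset E3} {fr : Frame} (ha : Orders a F)
    (hfr : fr.GoodFace F) {q : E3} (hq : q ∈ F) (p : E3) :
    fr.n F ⬝ᵥ (p - fr.o F).ofLp = fr.n F ⬝ᵥ (p - q).ofLp := by
  obtain ⟨y, hy⟩ := exists_chart_eq ha hfr.2.2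
  have h1 : fr.n F ⬝ᵥ (a 0 - fr.o F).ofLp = 0 := by
    rw [hy, WithLp.ofLp_sub, chart_ofLp, sub_add_cancel_left, dotProduct_neg, dotProduct_sum,
      neg_eq_zero]
    refine Finset.sum_eq_zero fun j _ => ?_
    rw [dotProduct_smul, edgeVec, hfr.2.1 _ (ha.mem 0) _ (ha.mem _), smul_zero]
  have h2 := hfr.2.1 _ (ha.mem 0) _ hq
  have h3 : (p - fr.o F).ofLp = (p - q).ofLp + (q - a 0).ofLp + (a 0 - fr.o F).ofLp := by
    simp
  rw [h3, dotProduct_add, dotProduct_add, h1, h2, add_zero, add_zero]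

/-- The sum in `outSign` runs over the apex alone, and any vertex of the face may replace the origin
of its plane. -/
theorem Orders.outSign_face [DecidableEq E3] {fr : Frame} (hb : Orders b K) (hfr : fr.Good K)
    (i : Fin 4) {q : E3} (hq : q ∈ K.erase (b i)) : outSign fr K (K.erase (b i)) =
      -(SignType.sign (fr.n (K.erase (b i)) ⬝ᵥ (b i - q).ofLp) : ℝ) := by
  have h : K \ K.erase (b i) = {b i} := by
    ext x
    simp only [Finset.mem_sdiff, Finset.mem_erase, Finset.mem_singleton, not_and]
    exact ⟨fun h => by_contra fun hx => h.2 hx h.1, fun h => by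
      rw [h]; exact ⟨hb.mem i, fun h' => absurd rfl h'⟩⟩
  rw [outSign, h, Finset.sum_singleton,
    dot_sub_origin (hb.face i) (hfr.2 _ (hb.erase_mem_faces i)) hq]

theorem continuousOn_fderiv_apply {f : E3 → ℝ} (hf : ContDiff ℝ 1 f) (v : E3) :
    Continuous fun x => fderiv ℝ f x v :=
  (hf.continuous_fderiv one_ne_zero).clm_apply continuous_const

/-- The fundamental theorem of calculus along lines parallel to the edge from b 0 to b j.succ, which
enter and leave through the faces opposite to its endpoints. The other two faces contain this edge
direction. -/
theorem integral_fderiv_edge [DecidableEq E3] {fr : Frame} (hb : Orders b K) (hfr : fr.Good K)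
    {f : E3 → ℝ} (hf : ContDiff ℝ 1 f) (j : Fin 3) :
    ∫ x in hull K, fderiv ℝ f x (b j.succ - b 0) =
      |fr.n (K.erase (b 0)) ⬝ᵥ edgeVec b j| *
        ∫ x in hull (K.erase (b 0)), f x ∂(μHE[2] : Measure E3) -
      |fr.n (K.erase (b j.succ)) ⬝ᵥ edgeVec b j| *
        ∫ x in hull (K.erase (b j.succ)), f x ∂(μHE[2] : Measure E3) := by
  have hvol : (μHE[3] : Measure E3) = volume :=
    EuclideanSpace.euclideanHausdorffMeasure_eq_volume 3
  have h1 := hb.integral_eq fun x => fderiv ℝ f x (b j.succ - b 0)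
  rw [hvol] at h1
  have h2 := integral_refSimplex_fderiv (d := 2) j (hf.comp (contDiff_chart b))
  have h3 : ∀ y, fderiv ℝ (f ∘ chart b) y (Pi.single j 1) =
      fderiv ℝ f (chart b y) (b j.succ - b 0) := fun y => by
    rw [fderiv_comp _ (hf.differentiable one_ne_zero _)
      ((contDiff_chart b (n := 1)).differentiable one_ne_zero _), ContinuousLinearMap.comp_apply,
      fderiv_chart]
  simp only [h3, Function.comp_apply, chart_insertNth_zero, chart_insertNth_one] at h2
  rw [h1, h2, mul_sub]
  congr 1
  · refine integral_chart_face (hb.oppFace j) f (chartVol_eq_mul (hb.oppFace j)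
      (hfr.2 _ (hb.erase_mem_faces 0)) ?_)
    rw [edgeVec_oppFace, edgeVec_oppFace]
    simp only [dot_eq, cross_eq]
    fin_cases j <;> simp [Fin.succAbove] <;> ring
  · refine integral_chart_face (hb.face j.succ) f (chartVol_eq_mul (hb.face j.succ)
      (hfr.2 _ (hb.erase_mem_faces j.succ)) ?_)
    rw [edgeVec_face, edgeVec_face]
    simp only [dot_eq, cross_eq]
    fin_cases j <;> simp [Fin.succAbove] <;> ring

/-- The divergence theorem on a tetrahedron. -/
theorem integral_fderiv_tetrahedron [DecidableEq E3] {fr : Frame} (hK : IsTetrahedron K)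
    (hfr : fr.Good K) {f : E3 → ℝ} (hf : ContDiff ℝ 1 f) (v : E3) :
    ∫ x in hull K, fderiv ℝ f x v = ∑ F ∈ faces K, outSign fr K F * (fr.n F ⬝ᵥ v.ofLp) *
      ∫ x in hull F, f x ∂(μHE[2] : Measure E3) := by
  obtain ⟨b, hb⟩ := exists_orders (d := 3) hK.1 hK.2
  have hfaces : faces K = Finset.univ.image fun i => K.erase (b i) := by
    refine (Finset.eq_of_subset_of_card_le ?_ ?_).symm
    · intro F hF
      obtain ⟨i, -, rfl⟩ := Finset.mem_image.1 hF
      exact hb.erase_mem_faces i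
    · rw [Finset.card_image_of_injective, faces, Finset.card_powersetCard, hK.1]
      · rfl
      · intro i j hij
        exact hb.1.injective ((Finset.erase_inj _ (hb.mem i)).1 hij)
  have hinj : Set.InjOn (fun i => K.erase (b i)) (Finset.univ : Finset (Fin 4)) := fun i _ j _ h =>
    hb.1.injective ((Finset.erase_inj _ (hb.mem i)).1 h)
  rw [hfaces, Finset.sum_image hinj]
  -- For an edge vector the faces parallel to it drop out of the sum; on the remaining two the
  -- outward sign turns n · v into ±|n · v|.
  have key : ∀ j : Fin 3, ∫ x in hull K, fderiv ℝ f x (b j.succ - b 0) =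
      ∑ i, outSign fr K (K.erase (b i)) * (fr.n (K.erase (b i)) ⬝ᵥ (b j.succ - b 0).ofLp) *
        ∫ x in hull (K.erase (b i)), f x ∂(μHE[2] : Measure E3) := by
    intro j
    have hm : ∀ {i j : Fin 4}, i ≠ j → b i ∈ K.erase (b j) := fun {i j} hij =>
      Finset.mem_erase.2 ⟨hb.1.injective.ne hij, hb.mem i⟩
    have h0 : ∀ i : Fin 3, i ≠ j → fr.n (K.erase (b i.succ)) ⬝ᵥ (b j.succ - b 0).ofLp = 0 :=
      fun i hij => (hfr.2 _ (hb.erase_mem_faces i.succ)).2.1 _ (hm (Fin.succ_ne_zero _).symm) _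
        (hm (by simpa using hij.symm))
    rw [integral_fderiv_edge hb hfr hf j, Fin.sum_univ_succ, Finset.sum_eq_single j
      (fun i _ hij => by rw [h0 i hij]; simp) (by simp),
      hb.outSign_face hfr 0 (hm (Fin.succ_ne_zero j)),
      hb.outSign_face hfr j.succ (hm (Fin.succ_ne_zero j).symm), neg_mul (b := (fr.n (K.erase (b j.succ)) ⬝ᵥ _)), sign_mul_self,
      ← neg_sub (b j.succ) (b 0), WithLp.ofLp_neg, dotProduct_neg, Left.sign_neg,
      SignType.coe_neg, neg_neg, sign_mul_self, neg_mul, ← sub_eq_add_neg]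
    rfl
  -- The formula is linear in v and the edge vectors at one vertex span.
  have hv : ∃ c : Fin 3 → ℝ, v = ∑ j, c j • (b j.succ - b 0) := by
    obtain ⟨y, hy⟩ : ∃ y, b 0 + v = chart b y := by
      have hx : b 0 + v ∈ affineSpan ℝ (Set.range b) := by
        rw [hb.1.affineSpan_eq_top_iff_card_eq_finrank_add_one.2 (by simp)]
        trivial
      obtain ⟨w, hw, hwx⟩ := eq_affineCombination_of_mem_affineSpan_of_fintype hx
      refine ⟨fun j => w j.succ, ?_⟩
      rw [hwx, Finset.affineCombination_eq_linear_combination _ _ _ hw, chart_eq_sum,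
        Fin.sum_univ_succ]
      rw [Fin.sum_univ_succ] at hw
      rw [← hw, add_sub_cancel_right]
    exact ⟨y, add_left_cancel (hy.trans rfl)⟩
  obtain ⟨c, rfl⟩ := hv
  have hint : ∀ v, IntegrableOn (fun x => fderiv ℝ f x v) (hull K) := fun v =>
    (continuousOn_fderiv_apply hf v).continuousOn.integrableOn_compact (isCompact_hull K)
  simp only [map_sum, map_smul]
  rw [integral_finsetSum Finset.univ (f := fun j x => c j • fderiv ℝ f x (b j.succ - b 0))
    fun j _ => (hint _).smul (c j)]
  simp only [integral_smul, key]
  simp only [WithLp.ofLp_sum, WithLp.ofLp_smul, dotProduct_sum,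
    dotProduct_smul, smul_eq_mul, Finset.mul_sum, Finset.sum_mul]
  rw [Finset.sum_comm]
  exact Finset.sum_congr rfl fun i _ => Finset.sum_congr rfl fun j _ => by ring

end Divergence

/-! ### Green's formula for sym curl -/

section Green

/-- Split S = sym(M × n) along n and the tangent plane: its tangential block is tr₁^⊥ up to rotation
and sign, its normal row is half of tr₂, and its normal-normal entry is zero. So the two traces
together are the full boundary term of sym curl. -/
theorem sym_crossRight_eq_zero {n : V3} (hn : n ⬝ᵥ n = 1) {M : M3} (h2 : tr₂ n M = 0)
    (h1 : tr₁perp n M = 0) : sym (crossRight M n) = 0 := by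
  set S := sym (crossRight M n) with hS
  have hdec : ∀ u : V3, u = (n ⬝ᵥ u) • n - n ⨯₃ (n ⨯₃ u) := fun u => by
    have h : n ⨯₃ (n ⨯₃ u) = (n ⬝ᵥ u) • n - (n ⬝ᵥ n) • u := by
      ext i
      fin_cases i <;> simp [cross_eq, dot_eq] <;> ring
    rw [h, hn]; simp
  have htan : ∀ u v : V3, (n ⨯₃ u) ⬝ᵥ (S *ᵥ (n ⨯₃ v)) = 0 := fun u v => by
    have h := dot_crossRight_crossLeft n u v S
    rw [hS, ← tr₁perp, h1] at h
    simpa using h.symm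
  have hnS : ∀ v : V3, n ⬝ᵥ (S *ᵥ v) = 0 := fun v => by
    have h : tr₂ n M ⬝ᵥ v = n ⬝ᵥ (M *ᵥ (n ⨯₃ v)) := by
      simp only [tr₂, dot_mulVec_eq, cross_eq]
      simp only [dot_eq, vecMul]
      simp
      ring
    rw [h2, zero_dotProduct] at h
    rw [hS, dot_sym_crossRight, ← h]
    simp
  have hSn : ∀ u : V3, u ⬝ᵥ (S *ᵥ n) = 0 := fun u => by
    have hsymm : S.IsSymm := by
      rw [hS, sym, Matrix.IsSymm, transpose_smul, transpose_add, transpose_transpose, add_comm]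
    rw [dot_mulVec_comm_of_isSymm hsymm, hnS]
  refine eq_zero_of_dot_mulVec fun u v => ?_
  rw [hdec u, sub_dotProduct, smul_dotProduct, hnS, smul_zero, hdec v, mulVec_sub, mulVec_smul,
    dotProduct_sub, dotProduct_smul, hSn, htan]
  simp

theorem frob_sym {A B : M3} (hB : B.IsSymm) : frob (sym A) B = frob A B := by
  have h1 := hB.apply 0 1
  have h2 := hB.apply 0 2
  have h3 := hB.apply 1 2
  simp only [frob, sym, Fin.sum_univ_three]
  simp
  rw [h1, h2, h3]
  ring

theorem frob_crossRight_eq_zero {n : V3} (hn : n ⬝ᵥ n = 1) {M B : M3} (h2 : tr₂ n M = 0)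
    (h1 : tr₁perp n M = 0) (hB : B.IsSymm) : frob (crossRight M n) B = 0 := by
  rw [← frob_sym hB, sym_crossRight_eq_zero hn h2 h1]
  simp [frob]

theorem contDiff_eval_ofLp (p : Pol) :
    ContDiff ℝ 1 fun x : E3 => MvPolynomial.eval x.ofLp p :=
  ((contDiff_eval p).of_le (by simp)).comp (EuclideanSpace.equiv (Fin 3) ℝ).contDiff

theorem partialDeriv_eval (k : Fin 3) (p : Pol) (x : E3) :
    partialDeriv k (fun x => MvPolynomial.eval x.ofLp p) x =
      MvPolynomial.eval x.ofLp (MvPolynomial.pderiv k p) := by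
  have h := (hasFDerivAt_eval p x.ofLp).comp x (EuclideanSpace.equiv (Fin 3) ℝ).hasFDerivAt
  have h1 : fderiv ℝ (fun x : E3 => MvPolynomial.eval x.ofLp p) x = _ := h.fderiv
  rw [partialDeriv, h1]
  simp [_root_.sum_apply]

theorem partialDeriv_mul (k : Fin 3) {f g : E3 → ℝ} (hf : ContDiff ℝ 1 f) (hg : ContDiff ℝ 1 g)
    (x : E3) : partialDeriv k (fun x => f x * g x) x =
      f x * partialDeriv k g x + g x * partialDeriv k f x := by
  rw [partialDeriv, fderiv_fun_mul (hf.differentiable one_ne_zero x)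
    (hg.differentiable one_ne_zero x)]
  rfl

/-- The product rule puts the difference in divergence form; index addition in `Fin 3` is cyclic and
encodes the signs of the cross product. -/
theorem frob_curl_sub (τ : PolM) {φ : Matrix (Fin 3) (Fin 3) (E3 → ℝ)}
    (hφ : ∀ i j, ContDiff ℝ 1 (φ i j)) (x : E3) :
    frob (val (polCurl τ) x) (Matrix.of fun i j => φ i j x) -
      frob (val τ x) (Matrix.of fun i j => curl partialDeriv φ i j x) =
    ∑ i, ∑ k, (partialDeriv k (fun x => val τ x i (k + 1) * φ i (k + 2) x) x -
      partialDeriv k (fun x => val τ x i (k + 2) * φ i (k + 1) x) x) := by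
  have h : ∀ k i l m, partialDeriv k (fun x => val τ x i l * φ i m x) x =
      val τ x i l * partialDeriv k (φ i m) x + φ i m x * val (pd k τ) x i l := fun k i l m => by
    have := partialDeriv_mul k (contDiff_eval_ofLp (τ i l)) (hφ i m) x
    rw [partialDeriv_eval] at this
    exact this
  simp only [h]
  rw [val_polCurl]
  simp only [frob, curlOf, curl, Fin.sum_univ_three, of_apply]
  simp
  ring

theorem frob_crossRight (A : M3) (n : V3) (B : M3) : -frob (crossRight A n) B =
    ∑ i, ∑ k, n k * (A i (k + 1) * B i (k + 2) - A i (k + 2) * B i (k + 1)) := by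
  simp only [frob, crossRight, cross_eq, Fin.sum_univ_three, of_apply]
  simp
  ring

end Green

section Green

theorem Orders.integrableOn {d : ℕ} {a : Fin (d + 1) → E3} {s : Finset E3} (h : Orders a s)
    {f : E3 → ℝ} (hf : Continuous f) : IntegrableOn f (hull s) (μHE[d] : Measure E3) := by
  have := (h.integrable (hf.comp continuous_subtype_val))
  rwa [← (MeasurableEmbedding.subtype_coe (measurableSet_hull s)).integrableOn_range_iff_comap,
    Subtype.range_coe] at this

/-- Integration by parts for `sym curl` on a tetrahedron. -/
theorem integral_symCurl_sub [DecidableEq E3] {K : Finset E3} {fr : Frame} (hK : IsTetrahedron K)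
    (hfr : fr.Good K) (τ : PolM) {φ : Matrix (Fin 3) (Fin 3) (E3 → ℝ)} (hs : φ.IsSymm)
    (hφ : ∀ i j, ContDiff ℝ 1 (φ i j)) :
    ∫ x in hull K, (frob (val (symCurl τ) x) (Matrix.of fun i j => φ i j x) -
      frob (val τ x) (Matrix.of fun i j => curl partialDeriv φ i j x)) =
    ∑ F ∈ faces K, outSign fr K F * -∫ x in hull F,
      frob (crossRight (val τ x) (fr.n F)) (Matrix.of fun i j => φ i j x)
        ∂(μHE[2] : Measure E3) := by
  have hf : ∀ i l m, ContDiff ℝ 1 fun x => val τ x i l * φ i m x := fun i l m =>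
    (contDiff_eval_ofLp (τ i l)).mul (hφ i m)
  have hint : ∀ i k l m, IntegrableOn (partialDeriv k fun x => val τ x i l * φ i m x) (hull K) :=
    fun i k l m =>
      (continuousOn_fderiv_apply (hf i l m) _).continuousOn.integrableOn_compact (isCompact_hull K)
  have hd : ∀ i k, IntegrableOn (fun x =>
      partialDeriv k (fun x => val τ x i (k + 1) * φ i (k + 2) x) x -
      partialDeriv k (fun x => val τ x i (k + 2) * φ i (k + 1) x) x) (hull K) := fun i k =>
    (hint i k (k + 1) (k + 2)).sub (hint i k (k + 2) (k + 1))
  -- Against a symmetric test tensor the symmetrisation of the curl can be dropped.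
  have h1 : ∀ x, frob (val (symCurl τ) x) (Matrix.of fun i j => φ i j x) =
      frob (val (polCurl τ) x) (Matrix.of fun i j => φ i j x) := fun x => by
    rw [val_symCurl, frob_sym]
    ext i j
    rw [transpose_apply, of_apply, of_apply, hs.apply i j]
  simp only [h1, frob_curl_sub τ hφ]
  rw [integral_finsetSum _ fun i _ => integrable_finsetSum _ fun k _ => hd i k]
  have h2 : ∀ i, ∫ x in hull K, ∑ k, (partialDeriv k (fun x => val τ x i (k + 1) * φ i (k + 2) x) x -
      partialDeriv k (fun x => val τ x i (k + 2) * φ i (k + 1) x) x) =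
      ∑ k, ∑ F ∈ faces K, outSign fr K F * (fr.n F k * (
        ∫ x in hull F, val τ x i (k + 1) * φ i (k + 2) x ∂(μHE[2] : Measure E3) -
        ∫ x in hull F, val τ x i (k + 2) * φ i (k + 1) x ∂(μHE[2] : Measure E3))) := by
    intro i
    rw [integral_finsetSum _ fun k _ => hd i k]
    refine Finset.sum_congr rfl fun k _ => ?_
    rw [integral_sub (hint i k (k + 1) (k + 2)) (hint i k (k + 2) (k + 1))]
    unfold partialDeriv
    rw [integral_fderiv_tetrahedron hK hfr (hf _ _ _), integral_fderiv_tetrahedron hK hfr (hf _ _ _),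
      ← Finset.sum_sub_distrib]
    refine Finset.sum_congr rfl fun F _ => ?_
    simp
    ring
  simp only [h2]
  rw [Finset.sum_congr rfl fun i _ => Finset.sum_comm, Finset.sum_comm]
  refine Finset.sum_congr rfl fun F hF => ?_
  obtain ⟨a, ha⟩ := exists_orders_face hK hF
  have hi : ∀ i l m, IntegrableOn (fun x => val τ x i l * φ i m x) (hull F)
      (μHE[2] : Measure E3) := fun i l m => ha.integrableOn (hf i l m).continuous
  have hj : ∀ i k, IntegrableOn (fun x => fr.n F k *
      (val τ x i (k + 1) * φ i (k + 2) x - val τ x i (k + 2) * φ i (k + 1) x)) (hull F)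
      (μHE[2] : Measure E3) := fun i k =>
    ((hi i (k + 1) (k + 2)).sub (hi i (k + 2) (k + 1))).const_mul _
  rw [← integral_neg]
  simp only [frob_crossRight, of_apply]
  rw [integral_finsetSum _ fun i _ => integrable_finsetSum _ fun k _ => hj i k, Finset.mul_sum]
  refine Finset.sum_congr rfl fun i _ => ?_
  rw [integral_finsetSum _ fun k _ => hj i k, Finset.mul_sum]
  refine Finset.sum_congr rfl fun k _ => ?_
  rw [integral_const_mul, integral_sub (hi i (k + 1) (k + 2)) (hi i (k + 2) (k + 1))]

end Green

/-! ### The two sides of a face in a triangulation -/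

section Sides

open Filter Topology

theorem IsTetrahedron.exists_weights {K : Finset E3} (hK : IsTetrahedron K) (x : E3) :
    ∃ w : E3 → ℝ, ∑ y ∈ K, w y = 1 ∧ ∑ y ∈ K, w y • y = x := by
  classical
  have hx : x ∈ affineSpan ℝ (Set.range ((↑) : K → E3)) := by
    rw [hK.2.affineSpan_eq_top_iff_card_eq_finrank_add_one.2 (by simp [hK.1])]
    trivial
  obtain ⟨w, hw, rfl⟩ := eq_affineCombination_of_mem_affineSpan_of_fintype hx
  refine ⟨fun y => if h : y ∈ K then w ⟨y, h⟩ else 0, ?_, ?_⟩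
  · rw [← Finset.sum_coe_sort]
    simpa using hw
  · rw [Finset.affineCombination_eq_linear_combination _ _ _ hw, ← Finset.sum_coe_sort]
    simp

/-- The relative interior of the simplex with vertex set `F`. -/
def relInt (F : Finset E3) : Set E3 :=
  {x | ∃ w : E3 → ℝ, (∀ y ∈ F, 0 < w y) ∧ ∑ y ∈ F, w y = 1 ∧ ∑ y ∈ F, w y • y = x}

theorem relInt_subset_hull (F : Finset E3) : relInt F ⊆ hull F := fun _ ⟨w, h0, h1, h⟩ =>
  Finset.mem_convexHull'.2 ⟨w, fun y hy => (h0 y hy).le, h1, h⟩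

/-- Moving slightly towards the barycentre makes all weights positive and stays in the open set. -/
theorem exists_mem_relInt {F : Finset E3} {x : E3} (hx : x ∈ hull F) {Ω : Set E3} (hΩ : IsOpen Ω)
    (hxΩ : x ∈ Ω) : ∃ x' ∈ relInt F, x' ∈ Ω := by
  obtain ⟨u, hu0, hu1, hu⟩ := Finset.mem_convexHull'.1 hx
  have hF : F.Nonempty := by
    rw [Finset.nonempty_iff_ne_empty]
    rintro rfl
    simp at hu1
  have hc : 0 < (F.card : ℝ) := by exact_mod_cast hF.card_pos
  set c : E3 := ∑ y ∈ F, (F.card : ℝ)⁻¹ • y with hcdef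
  have ht : Tendsto (fun s : ℝ => (1 - s) • x + s • c) (𝓝[>] 0) (𝓝 x) := by
    have h : Continuous fun s : ℝ => (1 - s) • x + s • c := by fun_prop
    have := (h.tendsto 0).mono_left (nhdsWithin_le_nhds (s := Set.Ioi 0))
    simpa using this
  obtain ⟨s, hs, hs0, hs1⟩ := ((ht.eventually (hΩ.mem_nhds hxΩ)).and
    (Ioo_mem_nhdsGT (zero_lt_one (α := ℝ)))).exists
  refine ⟨_, ⟨fun y => (1 - s) * u y + s * (F.card : ℝ)⁻¹, fun y hy => ?_, ?_, ?_⟩, hs⟩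
  · have := mul_nonneg (sub_pos.2 hs1).le (hu0 y hy)
    have := mul_pos hs0 (inv_pos.2 hc)
    linarith
  · rw [Finset.sum_add_distrib, ← Finset.mul_sum, hu1, Finset.sum_const, nsmul_eq_mul]
    field_simp
    ring
  · simp only [add_smul, Finset.sum_add_distrib, mul_smul, ← Finset.smul_sum, hu]
    rw [← hcdef]

/-- Barycentric coordinates are unique: a vertex of F outside G would have weight zero. -/
theorem subset_of_mem_relInt {F G : Finset E3} (hF : AffineIndependent ℝ ((↑) : F → E3)) {x : E3}
    (hx : x ∈ relInt F) (hG : G ⊆ F) (hxG : x ∈ hull G) : F ⊆ G := by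
  obtain ⟨w, h0, h1, rfl⟩ := hx
  intro y hy
  by_contra hyG
  have hw : ∑ i : F, w i = 1 := by rw [Finset.sum_coe_sort, h1]
  refine (h0 y hy).ne' (hF.eq_zero_of_affineCombination_mem_affineSpan (fs := Finset.univ)
    (w := fun i : F => w i) hw (s := {i : F | i.1 ∈ G}) ?_ (i := ⟨y, hy⟩) (Finset.mem_univ _) hyG)
  rw [Finset.affineCombination_eq_linear_combination _ _ _ hw,
    Finset.sum_coe_sort F fun i => w i • i]
  have e : ((↑) : F → E3) '' {i : F | i.1 ∈ G} = G := by
    ext z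
    simp only [Set.mem_image, Set.mem_ofPred_eq, Subtype.exists, Finset.mem_coe]
    exact ⟨fun ⟨a, ha, h, e⟩ => e ▸ h, fun h => ⟨z, hG h, h, rfl⟩⟩
  rw [e]
  exact convexHull_subset_affineSpan _ hxG

variable {K : Finset E3} {p q : E3} {n : V3}

/-- The height above the face opposite to p is the barycentric coordinate of p times the height of
p, since the other vertices have height zero. -/
theorem dot_weights [DecidableEq E3] (hp : p ∈ K)
    (hn : ∀ a ∈ K.erase p, ∀ b ∈ K.erase p, n ⬝ᵥ (b - a).ofLp = 0) (hq : q ∈ K.erase p)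
    {u : E3 → ℝ} (hu : ∑ y ∈ K, u y = 1) :
    n ⬝ᵥ (∑ y ∈ K, u y • y - q).ofLp = u p * (n ⬝ᵥ (p - q).ofLp) := by
  have h : ∑ y ∈ K, u y • y - q = ∑ y ∈ K, u y • (y - q) := by
    simp only [smul_sub, Finset.sum_sub_distrib, ← Finset.sum_smul, hu, one_smul]
  rw [h, WithLp.ofLp_sum, dotProduct_sum, ← Finset.add_sum_erase _ _ hp,
    Finset.sum_eq_zero (s := K.erase p), add_zero, WithLp.ofLp_smul, dotProduct_smul, smul_eq_mul]
  intro y hy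
  rw [WithLp.ofLp_smul, dotProduct_smul, hn q hq y hy, smul_zero]

theorem mul_nonneg_of_mem_hull [DecidableEq E3] (hp : p ∈ K)
    (hn : ∀ a ∈ K.erase p, ∀ b ∈ K.erase p, n ⬝ᵥ (b - a).ofLp = 0) (hq : q ∈ K.erase p) {x : E3}
    (hx : x ∈ hull K) : 0 ≤ n ⬝ᵥ (x - q).ofLp * (n ⬝ᵥ (p - q).ofLp) := by
  obtain ⟨u, hu0, hu1, rfl⟩ := Finset.mem_convexHull'.1 hx
  rw [dot_weights hp hn hq hu1, mul_assoc]
  exact mul_nonneg (hu0 p hp) (mul_self_nonneg _)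

/-- Otherwise every point of space would have height zero above the face, including q + n. -/
theorem IsTetrahedron.dot_ne_zero [DecidableEq E3] (hK : IsTetrahedron K) (hp : p ∈ K)
    (hn : ∀ a ∈ K.erase p, ∀ b ∈ K.erase p, n ⬝ᵥ (b - a).ofLp = 0) (hq : q ∈ K.erase p)
    (hn1 : n ⬝ᵥ n = 1) : n ⬝ᵥ (p - q).ofLp ≠ 0 := by
  intro h0
  obtain ⟨c, hc, hx⟩ := hK.exists_weights (q + WithLp.toLp 2 n)
  have h := dot_weights hp hn hq hc
  rw [hx, h0, mul_zero, add_sub_cancel_left, hn1] at h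
  exact one_ne_zero h

/-- With c the weights of p + v, the point x + εv has weights w + εc on the face, positive for small
ε, and ε(c p − 1) at p, positive because v points to the side of p. -/
theorem IsTetrahedron.eventually_mem_hull [DecidableEq E3] (hK : IsTetrahedron K) (hp : p ∈ K)
    (hn : ∀ a ∈ K.erase p, ∀ b ∈ K.erase p, n ⬝ᵥ (b - a).ofLp = 0) (hq : q ∈ K.erase p) {v x : E3}
    (hv : 0 < n ⬝ᵥ v.ofLp * (n ⬝ᵥ (p - q).ofLp)) (hx : x ∈ relInt (K.erase p)) :
    ∀ᶠ ε in 𝓝[>] (0 : ℝ), x + ε • v ∈ hull K := by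
  obtain ⟨c, hc1, hc⟩ := hK.exists_weights (p + v)
  obtain ⟨w, hw0, hw1, rfl⟩ := hx
  have hcp : 1 < c p := by
    have h := dot_weights hp hn hq hc1
    rw [hc, add_sub_right_comm, WithLp.ofLp_add, dotProduct_add] at h
    have h2 : n ⬝ᵥ v.ofLp = (c p - 1) * (n ⬝ᵥ (p - q).ofLp) := by linear_combination h
    rw [h2, mul_assoc] at hv
    exact sub_pos.1 (pos_of_mul_pos_left hv (mul_self_nonneg _))
  have h1 : ∀ᶠ ε in 𝓝[>] (0 : ℝ), ∀ y ∈ K.erase p, 0 < w y + ε * c y := by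
    refine (Filter.eventually_all_finset _).2 fun y hy => ?_
    have hcont : Continuous fun ε : ℝ => w y + ε * c y := by fun_prop
    have := (hcont.tendsto 0).mono_left (nhdsWithin_le_nhds (s := Set.Ioi 0))
    rw [zero_mul, add_zero] at this
    exact this.eventually_const_lt (hw0 y hy)
  filter_upwards [h1, self_mem_nhdsWithin] with ε hε hε0
  have hε0 : 0 < ε := hε0
  refine Finset.mem_convexHull'.2
    ⟨fun y => if y = p then ε * (c p - 1) else w y + ε * c y, fun y hy => ?_, ?_, ?_⟩
  · dsimp only
    split_ifs with h
    · exact (mul_pos hε0 (sub_pos.2 hcp)).le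
    · exact (hε y (Finset.mem_erase.2 ⟨h, hy⟩)).le
  · rw [← Finset.add_sum_erase _ _ hp, if_pos rfl, Finset.sum_congr rfl fun y hy =>
      if_neg (Finset.ne_of_mem_erase hy), Finset.sum_add_distrib, hw1, ← Finset.mul_sum]
    rw [← Finset.add_sum_erase _ _ hp] at hc1
    linear_combination ε * hc1
  · dsimp only
    rw [← Finset.add_sum_erase _ _ hp, if_pos rfl, Finset.sum_congr rfl fun y hy => by
      rw [if_neg (Finset.ne_of_mem_erase hy)]]
    rw [← Finset.add_sum_erase _ _ hp] at hc
    simp only [add_smul, Finset.sum_add_distrib, mul_smul, ← Finset.smul_sum]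
    have hv : v = c p • p + ∑ y ∈ K.erase p, c y • y - p := by rw [hc]; simp
    rw [hv]
    module

end Sides

section Sides

open Filter Topology

theorem exists_apex [DecidableEq E3] {K F : Finset E3} {fr : Frame} (hK : IsTetrahedron K)
    (hfr : fr.Good K) (hF : F ∈ faces K) : ∃ p ∈ K, K.erase p = F ∧ ∀ q ∈ F,
      outSign fr K F = -(SignType.sign (fr.n F ⬝ᵥ (p - q).ofLp) : ℝ) := by
  have hF' := Finset.mem_powersetCard.1 hF
  obtain ⟨p, hp⟩ := Finset.card_eq_one.1 (show (K \ F).card = 1 by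
    rw [Finset.card_sdiff_of_subset hF'.1, hF'.2, hK.1])
  have hpK : p ∈ K := (Finset.mem_sdiff.1 (hp ▸ Finset.mem_singleton_self p)).1
  refine ⟨p, hpK, ?_, fun q hq => ?_⟩
  · rw [← Finset.sdiff_singleton_eq_erase, ← hp, Finset.sdiff_sdiff_eq_self hF'.1]
  · obtain ⟨a, ha⟩ := exists_orders_face hK hF
    rw [outSign, hp, Finset.sum_singleton, dot_sub_origin ha (hfr.2 F hF) hq]

theorem signType_cast_injective : Function.Injective ((↑) : SignType → ℝ) := by
  intro s t h
  rcases s <;> rcases t <;> first | rfl | (norm_num at h)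

theorem dot_sub_eq_zero {F : Finset E3} {n : V3} (hn : ∀ a ∈ F, ∀ b ∈ F, n ⬝ᵥ (b - a).ofLp = 0)
    {q y : E3} (hq : q ∈ F) (hy : y ∈ hull F) : n ⬝ᵥ (y - q).ofLp = 0 := by
  obtain ⟨u, -, hu1, rfl⟩ := Finset.mem_convexHull'.1 hy
  have e : ∑ y ∈ F, u y • y - q = ∑ y ∈ F, u y • (y - q) := by
    simp only [smul_sub, Finset.sum_sub_distrib, ← Finset.sum_smul, hu1, one_smul]
  rw [e, WithLp.ofLp_sum, dotProduct_sum]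
  refine Finset.sum_eq_zero fun y hy => ?_
  rw [WithLp.ofLp_smul, dotProduct_smul, hn q hq y hy, smul_zero]

variable {T : Geometry.SimplicialComplex ℝ E3} {Ω : Set E3} {fr : Frame}

theorem isTetrahedron_of_mem_tets {K : Finset E3} (hK : K ∈ tets T) : IsTetrahedron K :=
  ⟨hK.2, T.indep hK.1⟩

theorem mem_faces_of_faces {K F : Finset E3} (hK : K ∈ tets T) (hF : F ∈ faces K) :
    F ∈ T.faces := by
  have hF' := Finset.mem_powersetCard.1 hF
  exact T.down_closed hK.1 hF'.1 (Finset.card_pos.1 (by omega))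

theorem hull_inter_hull [DecidableEq E3] {s t : Finset E3} (hs : s ∈ T.faces) (ht : t ∈ T.faces) :
    hull s ∩ hull t = hull (s ∩ t) := by
  rw [T.convexHull_inter_convexHull hs ht, hull, Finset.coe_inter]

/-- Two tetrahedra on the same side of F both contain x + ε(p − q) for some ε > 0. Distinct ones
meet only in the hull of their common vertices, which is F, but this point lies off the plane of F.
-/
theorem eq_of_outSign_eq [DecidableEq E3] (hfr : ∀ K ∈ tets T, fr.Good K) {K K' F : Finset E3}
    (hK : K ∈ tets T) (hK' : K' ∈ tets T) (hF : F ∈ faces K) (hF' : F ∈ faces K') {x : E3}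
    (hx : x ∈ relInt F) (h : outSign fr K F = outSign fr K' F) : K = K' := by
  have hF3 := Finset.mem_powersetCard.1 hF
  have hF3' := Finset.mem_powersetCard.1 hF'
  obtain ⟨q, hq⟩ : F.Nonempty := Finset.card_pos.1 (by omega)
  have hn := (hfr K hK).2 F hF
  have hKt := isTetrahedron_of_mem_tets hK
  have hKt' := isTetrahedron_of_mem_tets hK'
  obtain ⟨p, hp, hpF, hs⟩ := exists_apex hKt (hfr K hK) hF
  obtain ⟨p', hp', hpF', hs'⟩ := exists_apex hKt' (hfr K' hK') hF'
  have hsign : SignType.sign (fr.n F ⬝ᵥ (p - q).ofLp) = SignType.sign (fr.n F ⬝ᵥ (p' - q).ofLp) := by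
    rw [hs q hq, hs' q hq] at h
    exact signType_cast_injective (neg_inj.1 h)
  have h0 : fr.n F ⬝ᵥ (p - q).ofLp ≠ 0 := by
    subst hpF; exact hKt.dot_ne_zero hp hn.2.1 hq hn.1
  have h0' : fr.n F ⬝ᵥ (p' - q).ofLp ≠ 0 := by
    subst hpF'; exact hKt'.dot_ne_zero hp' hn.2.1 hq hn.1
  have e1 : ∀ᶠ ε in 𝓝[>] (0 : ℝ), x + ε • (p - q) ∈ hull K := by
    subst hpF; exact hKt.eventually_mem_hull hp hn.2.1 hq (mul_self_pos.2 h0) hx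
  have e2 : ∀ᶠ ε in 𝓝[>] (0 : ℝ), x + ε • (p - q) ∈ hull K' := by
    have hpos : 0 < fr.n F ⬝ᵥ (p - q).ofLp * (fr.n F ⬝ᵥ (p' - q).ofLp) := by
      rw [← sign_eq_one_iff, sign_mul, hsign, ← sign_mul, sign_eq_one_iff]
      exact mul_self_pos.2 h0'
    subst hpF'; exact hKt'.eventually_mem_hull hp' hn.2.1 hq hpos hx
  obtain ⟨ε, ⟨h1, h2⟩, hε⟩ := ((e1.and e2).and self_mem_nhdsWithin).exists
  have hε : 0 < ε := hε
  by_contra hne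
  have hFKK : F ⊆ K ∩ K' := Finset.subset_inter hF3.1 hF3'.1
  have hcard : (K ∩ K').card < 4 := by
    by_contra hc
    have e := Finset.eq_of_subset_of_card_le (Finset.inter_subset_left (s₁ := K) (s₂ := K'))
      (by rw [hKt.1]; omega)
    have e' := Finset.eq_of_subset_of_card_le (Finset.inter_subset_right (s₁ := K) (s₂ := K'))
      (by rw [hKt'.1]; omega)
    exact hne (e.symm.trans e')
  have hFe : F = K ∩ K' := Finset.eq_of_subset_of_card_le hFKK (by omega)
  have hxF : x + ε • (p - q) ∈ hull F := by
    rw [hFe, ← hull_inter_hull hK.1 hK'.1]; exact ⟨h1, h2⟩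
  have f1 := dot_sub_eq_zero hn.2.1 hq hxF
  have f2 := dot_sub_eq_zero hn.2.1 hq (relInt_subset_hull F hx)
  rw [add_sub_right_comm, WithLp.ofLp_add, dotProduct_add, f2, zero_add, WithLp.ofLp_smul,
    dotProduct_smul, smul_eq_mul] at f1
  exact (mul_ne_zero hε.ne' h0) f1

/-- Points x + εv with small ε > 0 lie in Ω, which finitely many tetrahedra cover, so one of them
contains such points for arbitrarily small ε. Being closed it contains x, hence all of F because x
is in the relative interior; the sign of the height shows on which side it lies. -/
theorem exists_tet_of_direction [DecidableEq E3] (hT : IsTriangulation T Ω)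
    (hfr : ∀ K ∈ tets T, fr.Good K) {F : Finset E3} (hFT : F ∈ T.faces) (hF3 : F.card = 3)
    (hn1 : fr.n F ⬝ᵥ fr.n F = 1) {x : E3} (hx : x ∈ relInt F) (hxΩ : x ∈ Ω) {v : E3}
    (hv : fr.n F ⬝ᵥ v.ofLp ≠ 0) : ∃ K ∈ tets T, F ∈ faces K ∧
      outSign fr K F = -(SignType.sign (fr.n F ⬝ᵥ v.ofLp) : ℝ) := by
  have ht : Tendsto (fun ε : ℝ => x + ε • v) (𝓝[>] 0) (𝓝 x) := by
    have h : Continuous fun ε : ℝ => x + ε • v := by fun_prop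
    have := (h.tendsto 0).mono_left (nhdsWithin_le_nhds (s := Set.Ioi 0))
    simpa using this
  have h1 : ∃ᶠ ε in 𝓝[>] (0 : ℝ), ∃ K ∈ tets T, x + ε • v ∈ hull K := by
    refine (ht.eventually (hT.isOpen.mem_nhds hxΩ)).frequently.mono fun ε hε => ?_
    have := subset_closure hε
    rw [hT.closure_eq] at this
    simpa using this
  have hfin : (tets T).Finite := hT.finite.subset fun K hK => hK.1
  obtain ⟨K, hK, hKf⟩ := (Filter.frequently_exists_finite hfin).1 h1
  have hxK : x ∈ hull K := by
    have hcl := (isCompact_hull K).isClosed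
    by_contra hxK
    exact hKf ((ht.eventually (hcl.isOpen_compl.mem_nhds hxK)).mono fun ε hε => hε)
  have hKt := isTetrahedron_of_mem_tets hK
  have hFK : F ⊆ K := by
    have := subset_of_mem_relInt (T.indep hFT) hx Finset.inter_subset_left
      (show x ∈ hull (F ∩ K) by
        rw [← hull_inter_hull hFT hK.1]; exact ⟨relInt_subset_hull F hx, hxK⟩)
    exact this.trans Finset.inter_subset_right
  have hF : F ∈ faces K := Finset.mem_powersetCard.2 ⟨hFK, hF3⟩
  have hn := (hfr K hK).2 F hF
  refine ⟨K, hK, hF, ?_⟩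
  obtain ⟨q, hq⟩ : F.Nonempty := Finset.card_pos.1 (by omega)
  obtain ⟨p, hp, hpF, hs⟩ := exists_apex hKt (hfr K hK) hF
  obtain ⟨ε, hεK, hε⟩ := (hKf.and_eventually self_mem_nhdsWithin).exists
  have hε : 0 < ε := hε
  have hflat := dot_sub_eq_zero hn.2.1 hq (relInt_subset_hull F hx)
  have h0 : fr.n F ⬝ᵥ (p - q).ofLp ≠ 0 := by
    subst hpF; exact hKt.dot_ne_zero hp hn.2.1 hq hn.1
  have hnn : 0 ≤ fr.n F ⬝ᵥ (x + ε • v - q).ofLp * (fr.n F ⬝ᵥ (p - q).ofLp) := by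
    subst hpF; exact mul_nonneg_of_mem_hull hp hn.2.1 hq hεK
  rw [add_sub_right_comm, WithLp.ofLp_add, dotProduct_add, hflat, zero_add, WithLp.ofLp_smul,
    dotProduct_smul, smul_eq_mul, mul_assoc] at hnn
  have hpos : 0 < fr.n F ⬝ᵥ v.ofLp * (fr.n F ⬝ᵥ (p - q).ofLp) :=
    lt_of_le_of_ne (nonneg_of_mul_nonneg_right hnn hε) (mul_ne_zero hv h0).symm
  rw [hs q hq]
  congr 2
  rcases mul_pos_iff.1 hpos with ⟨h, h'⟩ | ⟨h, h'⟩
  · rw [sign_pos h, sign_pos h']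
  · rw [sign_neg h, sign_neg h']

/-- A face which meets the domain has a tetrahedron on each of its sides. -/
theorem sum_outSign_eq_zero [DecidableEq E3] (hT : IsTriangulation T Ω)
    (hfr : ∀ K ∈ tets T, fr.Good K) {S : Finset (Finset E3)} (hS : ∀ K, K ∈ S ↔ K ∈ tets T)
    {F : Finset E3} (hF : ∃ K ∈ S, F ∈ faces K) {x : E3} (hx : x ∈ hull F) (hxΩ : x ∈ Ω) :
    ∑ K ∈ S with F ∈ faces K, outSign fr K F = 0 := by
  obtain ⟨K₀, hK₀, hF₀⟩ := hF
  rw [hS] at hK₀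
  obtain ⟨x', hx', hxΩ'⟩ := exists_mem_relInt hx hT.isOpen hxΩ
  have hn1 := ((hfr _ hK₀).2 F hF₀).1
  have hFT := mem_faces_of_faces hK₀ hF₀
  have hF3 := (Finset.mem_powersetCard.1 hF₀).2
  obtain ⟨K₁, hK₁, hF₁, h₁⟩ := exists_tet_of_direction hT hfr hFT hF3 hn1 hx' hxΩ'
    (v := WithLp.toLp 2 (fr.n F)) (by simp [hn1])
  obtain ⟨K₂, hK₂, hF₂, h₂⟩ := exists_tet_of_direction hT hfr hFT hF3 hn1 hx' hxΩ'
    (v := -WithLp.toLp 2 (fr.n F)) (by simp [hn1])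
  simp only [WithLp.ofLp_neg, dotProduct_neg, hn1, sign_one, Left.sign_neg, SignType.coe_neg,
    SignType.coe_one, neg_neg] at h₁ h₂
  have hne : K₁ ≠ K₂ := by
    rintro rfl
    rw [h₁] at h₂
    norm_num at h₂
  have hset : S.filter (F ∈ faces ·) = {K₁, K₂} := by
    ext K
    simp only [Finset.mem_filter, hS, Finset.mem_insert, Finset.mem_singleton]
    constructor
    · rintro ⟨hK, hF⟩
      have hKt := isTetrahedron_of_mem_tets hK
      have hn := (hfr K hK).2 F hF
      obtain ⟨q, hq⟩ : F.Nonempty := Finset.card_pos.1 (by omega)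
      obtain ⟨p, hp, hpF, hs⟩ := exists_apex hKt (hfr K hK) hF
      have h0 : fr.n F ⬝ᵥ (p - q).ofLp ≠ 0 := by
        subst hpF; exact hKt.dot_ne_zero hp hn.2.1 hq hn.1
      rcases lt_or_gt_of_ne h0 with h | h
      · refine Or.inr (eq_of_outSign_eq hfr hK hK₂ hF hF₂ hx' ?_)
        rw [h₂, hs q hq, sign_neg h]
        simp
      · refine Or.inl (eq_of_outSign_eq hfr hK hK₁ hF hF₁ hx' ?_)
        rw [h₁, hs q hq, sign_pos h]
        simp
    · rintro (rfl | rfl)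
      · exact ⟨hK₁, hF₁⟩
      · exact ⟨hK₂, hF₂⟩
  rw [hset, Finset.sum_pair hne, h₁, h₂]
  norm_num

end Sides

/-! ### Cancellation of the face integrals -/

section Cancellation

variable {T : Geometry.SimplicialComplex ℝ E3} {Ω : Set E3} {fr : Frame} {ℓ : ℕ}
  {τ : Finset E3 → PolM}

theorem SingleValued.edgeMomentsVanish (h : SingleValued fr ℓ T τ) {K K' e : Finset E3}
    (hK : K ∈ tets T) (hK' : K' ∈ tets T) (he : e ∈ edges K) (he' : e ∈ edges K') :
    EdgeMomentsVanish fr ℓ (τ K - τ K') e := by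
  obtain ⟨b, hb⟩ := exists_orders_edge (isTetrahedron_of_mem_tets hK) he
  refine ⟨fun i j q hq => ?_, fun i q hq => ?_, fun q hq => ?_⟩
  · rw [← hb.map_intNN fr _ i j ⟨q, hq⟩, map_sub, LinearMap.sub_apply, hb.map_intNN, hb.map_intNN,
      h.edgeNN K hK K' hK' e he he' i j q hq, sub_self]
  · rw [← hb.map_intNT fr _ i ⟨q, hq⟩, map_sub, LinearMap.sub_apply, hb.map_intNT, hb.map_intNT,
      h.edgeNT K hK K' hK' e he he' i q hq, sub_self]
  · rw [← hb.map_intCurl fr _ ⟨q, hq⟩, map_sub, LinearMap.sub_apply, hb.map_intCurl,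
      hb.map_intCurl, h.edgeCurl K hK K' hK' e he he' q hq, sub_self]

theorem SingleValued.faceMomentsVanish (h : SingleValued fr ℓ T τ) {K K' F : Finset E3}
    (hK : K ∈ tets T) (hK' : K' ∈ tets T) (hF : F ∈ faces K) (hF' : F ∈ faces K') :
    FaceMomentsVanish fr ℓ (τ K - τ K') F := by
  obtain ⟨a, ha⟩ := exists_orders_face (isTetrahedron_of_mem_tets hK) hF
  refine ⟨fun q hq => ?_, fun q hq => ?_⟩
  · have e : ∀ σ, (ha.isMoment_tensor fr ℓ).map σ ⟨q, hq⟩ = faceDofTensor fr σ F q := fun σ => rfl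
    rw [← e, map_sub, LinearMap.sub_apply, e, e, h.faceTensor K hK K' hK' F hF hF' q hq, sub_self]
  · have e : ∀ σ, (ha.isMoment_vector fr ℓ).map σ ⟨q, hq⟩ = faceDofVector fr σ F q := fun σ => rfl
    rw [← e, map_sub, LinearMap.sub_apply, e, e, h.faceVector K hK K' hK' F hF hF' q hq, sub_self]

theorem crossRight_sub (A B : M3) (n : V3) :
    crossRight (A - B) n = crossRight A n - crossRight B n := by
  ext i j
  fin_cases j <;> simp [crossRight, cross_eq] <;> ring

theorem frob_sub_left (A B C : M3) : frob (A - B) C = frob A C - frob B C := by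
  simp [frob, Fin.sum_univ_three]; ring

/-- The tangential symmetric trace is continuous across a common face. -/
theorem frob_crossRight_eq (hℓ : 3 ≤ ℓ) (hfr : ∀ K ∈ tets T, fr.Good K)
    (hτ : ∀ K ∈ tets T, τ K ∈ polyT (ℓ + 1)) (h : SingleValued fr ℓ T τ) {K K' F : Finset E3}
    (hK : K ∈ tets T) (hK' : K' ∈ tets T) (hF : F ∈ faces K) (hF' : F ∈ faces K') {x : E3}
    (hx : x ∈ hull F) {B : M3} (hB : B.IsSymm) :
    frob (crossRight (val (τ K) x) (fr.n F)) B = frob (crossRight (val (τ K') x) (fr.n F)) B := by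
  have hFK := (Finset.mem_powersetCard.1 hF).1
  have hFK' := (Finset.mem_powersetCard.1 hF').1
  obtain ⟨h2, h1⟩ := traces_eq_zero hℓ (isTetrahedron_of_mem_tets hK) (hfr K hK) hF
    (sub_mem (hτ K hK) (hτ K' hK'))
    (fun δ hδ => by rw [val_sub, h.vertex K hK K' hK' δ (hFK hδ) (hFK' hδ), sub_self])
    (fun δ hδ => by
      rw [symCurl_sub, val_sub, h.vertexCurl K hK K' hK' δ (hFK hδ) (hFK' hδ), sub_self])
    (fun e he => h.edgeMomentsVanish hK hK' (edges_subset hF he) (edges_subset hF' he))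
    (h.faceMomentsVanish hK hK' hF hF') x hx
  have h0 := frob_crossRight_eq_zero ((hfr K hK).2 F hF).1 h2 h1 hB
  rw [val_sub, crossRight_sub, frob_sub_left] at h0
  exact sub_eq_zero.1 h0

theorem IsTestTensor.isSymm_eval {φ : Matrix (Fin 3) (Fin 3) (E3 → ℝ)} (hφ : IsTestTensor Ω φ)
    (x : E3) : (Matrix.of fun i j => φ i j x).IsSymm := by
  ext i j
  rw [transpose_apply, of_apply, of_apply, hφ.1.apply i j]

theorem IsTestTensor.eval_eq_zero {φ : Matrix (Fin 3) (Fin 3) (E3 → ℝ)} (hφ : IsTestTensor Ω φ)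
    {x : E3} (hx : x ∉ Ω) : (Matrix.of fun i j => φ i j x) = 0 := by
  ext i j
  exact image_eq_zero_of_notMem_tsupport (f := φ i j) fun h => hx ((hφ.2 i j).2.2 h)

theorem IsTestTensor.curl_eq_zero {φ : Matrix (Fin 3) (Fin 3) (E3 → ℝ)} (hφ : IsTestTensor Ω φ)
    {x : E3} (hx : x ∉ Ω) : (Matrix.of fun i j => curl partialDeriv φ i j x) = 0 := by
  have h : ∀ k i j, partialDeriv k (φ i j) x = 0 := fun k i j => by
    rw [partialDeriv, fderiv_of_notMem_tsupport (𝕜 := ℝ) fun h => hx ((hφ.2 i j).2.2 h)]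
    rfl
  ext i j
  fin_cases j <;> simp [curl, h]

theorem frob_zero (A : M3) : frob A 0 = 0 := by simp [frob]

/-- After exchanging the sums over tetrahedra and faces, the integral over a face meeting Ω does not
depend on the tetrahedron, so it is multiplied by the sum of the outward signs, which is zero. -/
theorem sum_integral_symCurl_sub (hℓ : 3 ≤ ℓ) (hT : IsTriangulation T Ω)
    (hfr : ∀ K ∈ tets T, fr.Good K) (hτ : ∀ K ∈ tets T, τ K ∈ polyT (ℓ + 1))
    (h : SingleValued fr ℓ T τ) {S : Finset (Finset E3)} (hS : ∀ K, K ∈ S ↔ K ∈ tets T)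
    {φ : Matrix (Fin 3) (Fin 3) (E3 → ℝ)} (hφ : IsTestTensor Ω φ) :
    ∑ K ∈ S, ∫ x in hull K, (frob (val (symCurl (τ K)) x) (Matrix.of fun i j => φ i j x) -
      frob (val (τ K) x) (Matrix.of fun i j => curl partialDeriv φ i j x)) = 0 := by
  classical
  rw [Finset.sum_congr rfl fun K hK => integral_symCurl_sub
    (isTetrahedron_of_mem_tets ((hS K).1 hK)) (hfr K ((hS K).1 hK)) (τ K) hφ.1
    fun i j => (hφ.2 i j).1.of_le (by simp)]
  rw [Finset.sum_comm' (t' := S.biUnion faces) (s' := fun F => S.filter (F ∈ faces ·)) fun K F => by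
    simp only [Finset.mem_filter, Finset.mem_biUnion]
    exact ⟨fun h => ⟨h, K, h⟩, fun h => h.1⟩]
  refine Finset.sum_eq_zero fun F hF => ?_
  obtain ⟨K₀, hK₀, hF₀⟩ := Finset.mem_biUnion.1 hF
  by_cases hne : ∃ x ∈ hull F, x ∈ Ω
  · obtain ⟨x, hx, hxΩ⟩ := hne
    have hsum := sum_outSign_eq_zero hT hfr hS ⟨K₀, hK₀, hF₀⟩ hx hxΩ
    rw [← zero_mul (-∫ x in hull F, frob (crossRight (val (τ K₀) x) (fr.n F))
      (Matrix.of fun i j => φ i j x) ∂(μHE[2] : Measure E3)), ← hsum, Finset.sum_mul]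
    refine Finset.sum_congr rfl fun K hK => ?_
    obtain ⟨hK, hFK⟩ := Finset.mem_filter.1 hK
    congr 2
    exact setIntegral_congr_fun (measurableSet_hull F) fun x hx =>
      frob_crossRight_eq hℓ hfr hτ h ((hS K).1 hK) ((hS K₀).1 hK₀) hFK hF₀ hx (hφ.isSymm_eval x)
  -- A face outside Ω may belong to one tetrahedron only, but the test tensor vanishes on it.
  · push Not at hne
    refine Finset.sum_eq_zero fun K _ => ?_
    rw [setIntegral_eq_zero_of_forall_eq_zero, neg_zero, mul_zero]
    intro x hx
    rw [hφ.eval_eq_zero (hne x hx), frob_zero]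

end Cancellation

/-! ### The piecewise sym curl is the weak sym curl -/

section Global

variable {T : Geometry.SimplicialComplex ℝ E3} {Ω : Set E3} {fr : Frame} {ℓ : ℕ}
  {S : Finset (Finset E3)}

/-- The hull of the common vertices has an interior point, so it needs four vertices. -/
theorem eq_of_mem_interior {K K' : Finset E3} (hK : K ∈ tets T) (hK' : K' ∈ tets T) {x : E3}
    (hx : x ∈ interior (hull K)) (hx' : x ∈ interior (hull K')) : K = K' := by
  classical
  have h : x ∈ interior (hull (K ∩ K')) := by
    rw [← hull_inter_hull hK.1 hK'.1, interior_inter]; exact ⟨hx, hx'⟩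
  have htop := interior_convexHull_nonempty_iff_affineSpan_eq_top.1 ⟨x, h⟩
  have hind := affineIndependent_subset (T.indep hK.1) (Finset.inter_subset_left (s₂ := K'))
  have hcard : (K ∩ K').card = 4 := by
    have := (hind.affineSpan_eq_top_iff_card_eq_finrank_add_one).1
      (by rw [Subtype.range_coe_subtype]; exact htop)
    simpa using this
  have e := Finset.eq_of_subset_of_card_le (Finset.inter_subset_left (s₁ := K) (s₂ := K'))
    (by rw [hK.2, hcard])
  have e' := Finset.eq_of_subset_of_card_le (Finset.inter_subset_right (s₁ := K) (s₂ := K'))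
    (by rw [hK'.2, hcard])
  exact e.symm.trans e'

/-- The function which equals `G K` in the interior of each simplex `K` of `S`. -/
noncomputable def piecewise {M : Type*} [AddCommMonoid M] (S : Finset (Finset E3))
    (G : Finset E3 → E3 → M) (x : E3) : M :=
  ∑ K ∈ S, (interior (hull K)).indicator (G K) x

theorem piecewise_of_mem {M : Type*} [AddCommMonoid M] (hS : ∀ K, K ∈ S ↔ K ∈ tets T)
    (G : Finset E3 → E3 → M) {K : Finset E3} (hK : K ∈ tets T) {x : E3}
    (hx : x ∈ interior (hull K)) : piecewise S G x = G K x := by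
  rw [piecewise, Finset.sum_eq_single_of_mem K ((hS K).2 hK) fun K' hK' hne =>
    Set.indicator_of_notMem (fun hx' => hne (eq_of_mem_interior ((hS K').1 hK') hK hx' hx)) _,
    Set.indicator_of_mem hx]

theorem ae_notMem_frontier (S : Finset (Finset E3)) :
    ∀ᵐ x : E3, ∀ K ∈ S, x ∉ frontier (hull K) := by
  refine (Filter.eventually_all_finset S).2 fun K _ => ?_
  exact measure_eq_zero_iff_ae_notMem.1 ((convex_convexHull ℝ _).addHaar_frontier volume)

theorem IsTriangulation.exists_mem_hull (hT : IsTriangulation T Ω) {x : E3} (hx : x ∈ Ω) :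
    ∃ K ∈ tets T, x ∈ hull K := by
  have := subset_closure hx
  rw [hT.closure_eq] at this
  simpa using this

theorem ae_exists_mem_interior (hT : IsTriangulation T Ω) (hS : ∀ K, K ∈ S ↔ K ∈ tets T) :
    ∀ᵐ x : E3, x ∈ Ω → ∃ K ∈ tets T, x ∈ interior (hull K) := by
  filter_upwards [ae_notMem_frontier S] with x hx hxΩ
  obtain ⟨K, hK, hxK⟩ := hT.exists_mem_hull hxΩ
  refine ⟨K, hK, by_contra fun h => hx K ((hS K).2 hK) ⟨subset_closure hxK, h⟩⟩

theorem integrable_piece (K : Finset E3) {G : E3 → ℝ} (hG : Continuous G) :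
    Integrable ((interior (hull K)).indicator G) :=
  ((hG.continuousOn.integrableOn_compact (isCompact_hull K)).mono_set
    interior_subset).integrable_indicator isOpen_interior.measurableSet

theorem integral_interior (K : Finset E3) (G : E3 → ℝ) :
    ∫ x, (interior (hull K)).indicator G x = ∫ x in hull K, G x := by
  rw [integral_indicator isOpen_interior.measurableSet]
  refine setIntegral_congr_set ?_
  exact interior_ae_eq_of_null_frontier ((convex_convexHull ℝ _).addHaar_frontier volume)

/-- The union of the tetrahedra is only the closure of Ω, and the boundary of Ω need not be a null
set; vanishing of all integrands outside Ω makes this harmless. -/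
theorem integral_eq_sum (hT : IsTriangulation T Ω) (hS : ∀ K, K ∈ S ↔ K ∈ tets T) {g : E3 → ℝ}
    {G : Finset E3 → E3 → ℝ} (hG : ∀ K ∈ S, Continuous (G K)) (h0 : ∀ x, x ∉ Ω → g x = 0)
    (hG0 : ∀ x, x ∉ Ω → ∀ K, G K x = 0)
    (hg : ∀ K ∈ tets T, ∀ x ∈ interior (hull K), g x = G K x) :
    ∫ x in Ω, g x = ∑ K ∈ S, ∫ x in hull K, G K x := by
  rw [setIntegral_eq_integral_of_forall_compl_eq_zero h0]
  have h : g =ᵐ[volume] fun x => ∑ K ∈ S, (interior (hull K)).indicator (G K) x := by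
    filter_upwards [ae_exists_mem_interior hT hS] with x hx
    by_cases hxΩ : x ∈ Ω
    · obtain ⟨K, hK, hxK⟩ := hx hxΩ
      rw [hg K hK x hxK, ← piecewise_of_mem hS G hK hxK, piecewise]
    · rw [h0 x hxΩ, Finset.sum_eq_zero fun K _ => Set.indicator_apply_eq_zero.2 fun _ =>
        hG0 x hxΩ K]
  rw [integral_congr_ae h, integral_finsetSum _ fun K hK => integrable_piece K (hG K hK)]
  exact Finset.sum_congr rfl fun K _ => integral_interior K (G K)

theorem memLp_piecewise (S : Finset (Finset E3)) {G : Finset E3 → E3 → ℝ}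
    (hG : ∀ K ∈ S, Continuous (G K)) : MemLp (piecewise S G) 2 := by
  refine memLp_finsetSum S fun K hK => ?_
  rw [memLp_indicator_iff_restrict isOpen_interior.measurableSet]
  obtain ⟨C, hC⟩ := (isCompact_hull K).exists_bound_of_continuousOn (hG K hK).continuousOn
  have : IsFiniteMeasure (volume.restrict (interior (hull K))) :=
    ⟨by rw [Measure.restrict_apply_univ]
        exact (measure_mono interior_subset).trans_lt (isCompact_hull K).measure_lt_top⟩
  refine MemLp.of_bound (hG K hK).aestronglyMeasurable C ?_
  filter_upwards [ae_restrict_mem isOpen_interior.measurableSet] with x hx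
  exact hC x (interior_subset hx)

theorem piecewise_apply (S : Finset (Finset E3)) (G : Finset E3 → E3 → M3) (x : E3) (i j : Fin 3) :
    piecewise S G x i j = piecewise S (fun K x => G K x i j) x := by
  rw [piecewise, Matrix.sum_apply, piecewise]
  refine Finset.sum_congr rfl fun K _ => ?_
  by_cases hx : x ∈ interior (hull K)
  · rw [Set.indicator_of_mem hx, Set.indicator_of_mem hx]
  · rw [Set.indicator_of_notMem hx, Set.indicator_of_notMem hx]; rfl

/-- The witness σ is the sym curl taken on each tetrahedron. It is bounded with bounded support, and
the duality identity is the vanishing of the summed boundary terms. -/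
theorem memHSymCurl (hℓ : 3 ≤ ℓ) (hT : IsTriangulation T Ω) (hfr : ∀ K ∈ tets T, fr.Good K)
    {u : E3 → M3} (hu : IsFEFunction fr ℓ T u) : MemHSymCurl Ω u := by
  obtain ⟨τ, hτ, huτ, hsv⟩ := hu
  have hfin : (tets T).Finite := hT.finite.subset fun K hK => hK.1
  set S := hfin.toFinset with hSdef
  have hS : ∀ K, K ∈ S ↔ K ∈ tets T := fun K => hfin.mem_toFinset
  have hae : ∀ᵐ x ∂(volume.restrict Ω), ∃ K ∈ tets T, x ∈ interior (hull K) :=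
    (ae_restrict_iff' hT.isOpen.measurableSet).2 (ae_exists_mem_interior hT hS)
  have hcont : ∀ (A : PolM) i j, Continuous fun x => val A x i j := fun A i j =>
    (continuous_val A).matrix_elem i j
  refine ⟨fun i j => ?_, ?_, piecewise S fun K => val (symCurl (τ K)), fun i j => ?_, fun x => ?_,
    fun φ hφ => ?_⟩
  · refine MemLp.ae_eq ?_ ((memLp_piecewise S fun K _ => hcont (τ K) i j).restrict Ω)
    filter_upwards [hae] with x ⟨K, hK, hx⟩
    rw [piecewise_of_mem hS _ hK hx, huτ K hK x hx]
  · filter_upwards [hae] with x ⟨K, hK, hx⟩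
    rw [huτ K hK x hx, trace_val (hτ K hK)]
  · simp only [piecewise_apply]
    exact (memLp_piecewise S fun K _ => hcont (symCurl (τ K)) i j).restrict Ω
  · ext i j
    rw [transpose_apply, piecewise_apply, piecewise_apply]
    simp only [(isSymm_val_symCurl _ _).apply i j]
  · have hφc : Continuous fun x => Matrix.of fun i j => φ i j x :=
      continuous_matrix fun i j => (hφ.2 i j).1.continuous
    have hpd : ∀ k i j, Continuous (partialDeriv k (φ i j)) := fun k i j =>
      continuousOn_fderiv_apply ((hφ.2 i j).1.of_le (by simp)) _
    have hφd : Continuous fun x => Matrix.of fun i j => curl partialDeriv φ i j x :=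
      continuous_matrix fun i j => by fin_cases j <;> exact (hpd _ _ _).sub (hpd _ _ _)
    have hc1 : ∀ K, Continuous fun x =>
        frob (val (symCurl (τ K)) x) (Matrix.of fun i j => φ i j x) := fun K =>
      continuous_frob (continuous_val _) hφc
    have hc2 : ∀ K, Continuous fun x =>
        frob (val (τ K) x) (Matrix.of fun i j => curl partialDeriv φ i j x) := fun K =>
      continuous_frob (continuous_val _) hφd
    rw [integral_eq_sum hT hS (fun K _ => hc1 K)
        (fun x hx => by rw [hφ.eval_eq_zero hx, frob_zero])
        (fun x hx K => by rw [hφ.eval_eq_zero hx, frob_zero])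
        fun K hK x hx => by rw [piecewise_of_mem hS _ hK hx],
      integral_eq_sum hT hS (fun K _ => hc2 K)
        (fun x hx => by rw [hφ.curl_eq_zero hx, frob_zero])
        (fun x hx K => by rw [hφ.curl_eq_zero hx, frob_zero])
        fun K hK x hx => by rw [huτ K hK x hx],
      ← sub_eq_zero, ← Finset.sum_sub_distrib,
      ← sum_integral_symCurl_sub hℓ hT hfr hτ hsv hS hφ]
    refine Finset.sum_congr rfl fun K _ => ?_
    rw [integral_sub ((hc1 K).continuousOn.integrableOn_compact (isCompact_hull K))
      ((hc2 K).continuousOn.integrableOn_compact (isCompact_hull K))]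

end Global

end SymCurlFEM

theorem mainTheorem3 (ℓ : ℕ) (hℓ : 3 ≤ ℓ) :
    (∀ (K : Finset E3) (fr : Frame), IsTetrahedron K → fr.Good K → Unisolvent fr ℓ K) ∧
    (∀ (T : Geometry.SimplicialComplex ℝ E3) (Ω : Set E3) (fr : Frame), IsTriangulation T Ω →
      (∀ K ∈ tets T, fr.Good K) →
      ∀ u : E3 → M3, IsFEFunction fr ℓ T u → MemHSymCurl Ω u) := by
  exact ⟨fun K fr hK hfr => unisolvent hℓ hK hfr,
    fun T Ω fr hT hfr u hu => memHSymCurl hℓ hT hfr hu⟩
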